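/- **Setting.** Let $(\mathcal X,d)$ be a locally compact separable metric space, $B(x,r)=\{y:d(x,y)<r\}$, and let $X=(X_t,\mathcal G_t,\mathbb P_x)$ be a Hunt process on $\mathcal X$ (with cemetery $\partial$ adjoined as in the one-point compactification, and with its augmented filtration $(\mathcal G_t)$). Functions on $\mathcal X$ are extended by $0$ to $\partial$. Assume that there is a kernel $J(x,dy)$, with $J(x,\cdot)$ a $\sigma$-finite measure on $\mathcal X\setminus\{x\}$, such that $(J(x,dy),t)$ is a Lévy system of $X$: for every Borel $f\ge 0$ on $[0,\infty)\times\mathcal X\times\mathcal X$ vanishing on the diagonal of $\mathcal X\times\mathcal X$, every $(\mathcal G_t)$-stopping time $T$ and every $x\in\mathcal X$, $$\mathbb E_x\sum_{s\le T}f(s,X_{s-},X_s)=\mathbb E_x\int_0^T\int_{\mathcal X}f(s,X_s,y)\,J(X_s,dy)\,ds .$$ For $D\subset\mathcal X$ let $\tau_D=\inf\{t\ge 0:X_t\notin D\}$. A function $h$ on $\mathcal X$ is regular harmonic in an open set $U$ if $\mathbb E_x[|h(X_{\tau_U})|;\tau_U<\infty]<\infty$ and $h(x)=\mathbb E_x[h(X_{\tau_U});\tau_U<\infty]$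 for every $x\in U$. Let $\phi:[0,\infty)\to[0,\infty)$ be strictly increasing with $\phi(0)=0$, $\phi(1)=1$, and let $c\ge 1$, $\beta>0$ be such that $$\phi(R)/\phi(r)\le c\,(R/r)^\beta\qquad(0<r\le R<\infty).\tag{1}$$ For $\bar r,r_0\in(0,\infty]$ consider the following conditions. * $(\mathbf{Jc})_{\bar r}$, with constants $C_1\in(0,\infty)$, $C_2\in(0,1)$, $C_3\in(1,\infty)$, $\theta\in(0,\infty)$: for all $x,y\in\mathcal X$ with $d(x,y)<\bar r$, $J(x,dz)\le C_1\bigl(1+\frac{d(y,z)}{d(x,z)}\bigr)^{\theta}J(y,dz)$ on $\mathcal X$; and for all $x,y\in\mathcal X$ and $r,s\in(0,\bar r)$ with $d(x,y)>s+C_3r$, $J(x,B(y,s))\le C_2\,J(x,B(x,r)^c)$. * $(\mathbf{Jt})_{\phi,\bar r}$, with constants $0<C_4\le C_5$: $\frac{C_4}{\phi(r)}\le J(x,B(x,r)^c)\le\frac{C_5}{\phi(r)}$ for all $x\in\mathcal X$, $0<r<\bar r$. * $(\mathbf{EP})_{\phi,r_0,\le}$, with constant $C_6>0$: $\mathbb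 P_x(\tau_{B(x,r)}<t)\le C_6\,\frac{t}{\phi(r)}$ for all $t>0$, $x\in\mathcal X$, $r\in(0,r_0)$. **Theorem 1.3.** Suppose that $(\mathbf{Jc})_{\bar r}$, $(\mathbf{Jt})_{\phi,\bar r}$ and $(\mathbf{EP})_{\phi,r_0,\le}$ hold for some $\bar r,r_0\in(0,\infty]$, and put $R:=\min\{\bar r/2,r_0\}$. Then for every $\kappa\in(0,2)$ there is a constant $C\in(1,\infty)$, depending only on $\kappa$ and on the constants $C_1,C_2,C_3,\theta,C_4,C_5,C_6,c,\beta$, such that for every proper open set $D\subset\mathcal X$, every $r\in(0,R)$, every $\xi\in\partial D$ and any two non-negative functions $h_1,h_2$ on $\mathcal X$ that are regular harmonic in $D\cap B(\xi,2r)$ and vanish on $B(\xi,2r)\setminus D$, $$h_1(x)h_2(y)\le C\,h_1(y)h_2(x)\qquad\text{for all }x,y\in D\cap B(\xi,\kappa r).$$ -/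

import Mathlib

open MeasureTheory ProbabilityTheory Filter Topology Set
open scoped NNReal ENNReal

noncomputable section

/-- The state space with its cemetery point `∂ = ∞` adjoined carries the Borel σ-algebra of the
one-point compactification. -/
instance OnePoint.borelMeasurableSpace {𝒳 : Type*} [TopologicalSpace 𝒳] :
    MeasurableSpace (OnePoint 𝒳) := borel _

instance OnePoint.borelSpace {𝒳 : Type*} [TopologicalSpace 𝒳] : BorelSpace (OnePoint 𝒳) := ⟨rfl⟩

/-- Path-level data of a normal right-continuous process with left limits, with cemetery `∞`:
paths `X`, laws `P x` (depending measurably on the starting point `x`) and shifts `shift`. -/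
structure CadlagFamily (𝒳 Ω : Type*) [TopologicalSpace 𝒳] [MeasurableSpace Ω] where
  X : ℝ≥0 → Ω → OnePoint 𝒳
  P : Kernel (OnePoint 𝒳) Ω
  shift : ℝ≥0 → Ω → Ω
  isMarkovKernel : IsMarkovKernel P
  /-- the events are those generated by the process -/
  generated : ‹MeasurableSpace Ω› = ⨆ t, MeasurableSpace.comap (X t) inferInstance
  X_shift : ∀ s t ω, X s (shift t ω) = X (t + s) ω
  X_zero : ∀ x, ∀ᵐ ω ∂(P x), X 0 ω = x
  /-- once at the cemetery, the path stays there -/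
  absorbed : ∀ s t ω, s ≤ t → X s ω = OnePoint.infty → X t ω = OnePoint.infty
  rightCts : ∀ ω t, ContinuousWithinAt (fun s => X s ω) (Ici t) t
  leftLimits : ∀ ω t, 0 < t → ∃ l, Tendsto (fun s => X s ω) (𝓝[<] t) (𝓝 l)

namespace CadlagFamily

variable {𝒳 Ω : Type*} [TopologicalSpace 𝒳] [MeasurableSpace Ω]

/-- The law `ℙ_μ = ∫ ℙ_x μ(dx)` of the process with initial distribution `μ`. -/
def law (Z : CadlagFamily 𝒳 Ω) (μ : Measure (OnePoint 𝒳)) : Measure Ω := μ.bind Z.P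

/-- `𝓕⁰_t = σ(X_s : s ≤ t)`. -/
abbrev rawSigma (Z : CadlagFamily 𝒳 Ω) (t : ℝ≥0) : MeasurableSpace Ω :=
  ⨆ s, ⨆ _ : s ≤ t, MeasurableSpace.comap (Z.X s) inferInstance

theorem rawSigma_mono (Z : CadlagFamily 𝒳 Ω) {s t : ℝ≥0} (h : s ≤ t) :
    Z.rawSigma s ≤ Z.rawSigma t :=
  iSup_mono fun _ => iSup_le fun hu => le_iSup_of_le (hu.trans h) le_rfl

/-- `⋂_μ 𝓕_t^μ`, where `μ` runs over all initial distributions and `𝓕_t^μ` consists of the sets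
that agree with a set of `𝓕⁰_t` up to a `ℙ_μ`-null set. As these sets need not belong to the
σ-algebra generated by the process, the ambient σ-algebra is `⊤`. -/
def completedFiltration (Z : CadlagFamily 𝒳 Ω) : Filtration ℝ≥0 (⊤ : MeasurableSpace Ω) where
  seq t := ⨅ μ : ProbabilityMeasure (OnePoint 𝒳),
    eventuallyMeasurableSpace (Z.rawSigma t) (ae (Z.law (μ : Measure (OnePoint 𝒳))))
  mono' := fun _ _ h => iInf_mono fun _ _ hA => by
    obtain ⟨B, hB, hAB⟩ := hA
    exact ⟨B, Z.rawSigma_mono h B hB, hAB⟩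
  le' := fun _ => le_top

/-- The augmented filtration `𝒢_t`, right-continuous and universally completed. -/
def augmentedFiltration (Z : CadlagFamily 𝒳 Ω) : Filtration ℝ≥0 (⊤ : MeasurableSpace Ω) :=
  Z.completedFiltration.rightCont

end CadlagFamily

/-- Hunt process on `𝒳`: a right-continuous process with left limits in `𝒳 ∪ {∂}` which is strong
Markov and quasi-left-continuous on `[0, ∞)` with respect to its augmented filtration. -/
structure HuntProcess (𝒳 Ω : Type*) [TopologicalSpace 𝒳] [MeasurableSpace Ω] extends
    CadlagFamily 𝒳 Ω where
  /-- `ℙ_μ(Λ ∩ {T < ∞} ∩ θ_T⁻¹ Γ) = 𝔼_μ[ℙ_{X_T}(Γ); Λ ∩ {T < ∞}]` for `Λ ∈ 𝒢_T`. -/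
  strongMarkov : ∀ (μ : Measure (OnePoint 𝒳)) [IsProbabilityMeasure μ]
    (T : Ω → WithTop ℝ≥0) (hT : IsStoppingTime toCadlagFamily.augmentedFiltration T)
    (Λ Γ : Set Ω), MeasurableSet[hT.measurableSpace] Λ → MeasurableSet Γ →
      toCadlagFamily.law μ (Λ ∩ {ω | T ω < ⊤ ∧ shift (T ω).untopA ω ∈ Γ}) =
        ∫⁻ ω in Λ ∩ {ω | T ω < ⊤}, P (stoppedValue X T ω) Γ ∂(toCadlagFamily.law μ)
  quasiLeftCts : ∀ (μ : Measure (OnePoint 𝒳)) [IsProbabilityMeasure μ]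
    (S : ℕ → Ω → WithTop ℝ≥0) (T : Ω → WithTop ℝ≥0),
      (∀ n, IsStoppingTime toCadlagFamily.augmentedFiltration (S n)) →
      (∀ ω, Monotone fun n => S n ω) → (∀ ω, IsLUB (range fun n => S n ω) (T ω)) →
      ∀ᵐ ω ∂(toCadlagFamily.law μ), T ω < ⊤ →
        Tendsto (fun n => stoppedValue X (S n) ω) atTop (𝓝 (stoppedValue X T ω))

namespace HuntProcess

variable {𝒳 Ω : Type*} [MeasurableSpace Ω]

/-- First exit time `τ_D = inf {t ≥ 0 : X_t ∉ D}`; the cemetery lies outside every `D ⊆ 𝒳`. -/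
def exitTime [TopologicalSpace 𝒳] (Z : HuntProcess 𝒳 Ω) (D : Set 𝒳) : Ω → WithTop ℝ≥0 :=
  hittingAfter Z.X (((↑) : 𝒳 → OnePoint 𝒳) '' D)ᶜ 0

/-- `(J(x, dy), t)` is a Lévy system of the process. Functions on `𝒳` are extended by `0` to the
cemetery, and `leftLim` at time `0` is `X_0`. -/
structure IsLevySystem [TopologicalSpace 𝒳] [MeasurableSpace 𝒳] (Z : HuntProcess 𝒳 Ω)
    (J : Kernel 𝒳 𝒳) : Prop where
  diag : ∀ x, J x {x} = 0
  sigmaFinite : ∀ x, SigmaFinite (J x)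
  formula : ∀ f : ℝ≥0 → 𝒳 → 𝒳 → ℝ≥0∞,
    Measurable (fun p : ℝ≥0 × 𝒳 × 𝒳 => f p.1 p.2.1 p.2.2) → (∀ s x, f s x x = 0) →
    ∀ T : Ω → WithTop ℝ≥0, IsStoppingTime Z.augmentedFiltration T → ∀ x : 𝒳,
      ∫⁻ ω, ∑' s : {s : ℝ≥0 // (s : WithTop ℝ≥0) ≤ T ω},
          (Function.leftLim (fun u => Z.X u ω) (s : ℝ≥0)).elim 0
            (fun a => (Z.X s ω).elim 0 (fun b => f s a b)) ∂(Z.P x) =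
        ∫⁻ ω, (∫⁻ s in {s : ℝ | 0 ≤ s ∧ (s.toNNReal : WithTop ℝ≥0) ≤ T ω},
          (Z.X s.toNNReal ω).elim 0 (fun a => ∫⁻ y, f s.toNNReal a y ∂(J a))) ∂(Z.P x)

/-- Exit probability upper bound `(EP)_{φ,r₀,≤}` with constant `C`. -/
structure ExitProbabilityBound [MetricSpace 𝒳] (Z : HuntProcess 𝒳 Ω) (φ : ℝ → ℝ) (r₀ : ℝ≥0∞)
    (C : ℝ) : Prop where
  pos : 0 < C
  bound : ∀ (t : ℝ≥0) (x : 𝒳) (r : ℝ), 0 < t → 0 < r → ENNReal.ofReal r < r₀ →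
    Z.P x {ω | Z.exitTime (Metric.ball x r) ω < t} ≤ ENNReal.ofReal (C * t / φ r)

/-- `h` is regular harmonic in `U`: `𝔼_x[|h(X_{τ_U})|; τ_U < ∞] < ∞` and
`h(x) = 𝔼_x[h(X_{τ_U}); τ_U < ∞]` for all `x ∈ U`, where `h(∂) = 0`. The function `h` is
universally measurable, so that the expectations make sense. -/
structure IsRegularHarmonic [TopologicalSpace 𝒳] [MeasurableSpace 𝒳] (Z : HuntProcess 𝒳 Ω)
    (h : 𝒳 → ℝ) (U : Set 𝒳) : Prop where
  universallyMeasurable : ∀ (ν : Measure 𝒳) [IsFiniteMeasure ν], AEMeasurable h ν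
  integrable : ∀ x ∈ U, IntegrableOn (fun ω => (stoppedValue Z.X (Z.exitTime U) ω).elim 0 h)
    {ω | Z.exitTime U ω < ⊤} (Z.P x)
  mean_value : ∀ x ∈ U, h x =
    ∫ ω in {ω | Z.exitTime U ω < ⊤}, (stoppedValue Z.X (Z.exitTime U) ω).elim 0 h ∂(Z.P x)

end HuntProcess

/-- Standing assumptions on `φ : [0,∞) → [0,∞)`, with the constants `c`, `β` of the doubling
inequality. -/
structure IsScaleFunction (φ : ℝ → ℝ) (c β : ℝ) : Prop where
  strictMono : StrictMonoOn φ (Ici 0)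
  zero : φ 0 = 0
  one : φ 1 = 1
  one_le : 1 ≤ c
  pos : 0 < β
  growth : ∀ r R : ℝ, 0 < r → r ≤ R → φ R / φ r ≤ c * (R / r) ^ β

/-- Jump measure comparability `(Jc)_{r̄}` with constants `C₁, C₂, C₃, θ`. -/
structure JumpComparable {𝒳 : Type*} [MetricSpace 𝒳] [MeasurableSpace 𝒳] (J : Kernel 𝒳 𝒳)
    (rbar : ℝ≥0∞) (C₁ C₂ C₃ θ : ℝ) : Prop where
  C₁_pos : 0 < C₁
  C₂_mem : C₂ ∈ Ioo (0 : ℝ) 1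
  C₃_gt : 1 < C₃
  θ_pos : 0 < θ
  compare : ∀ x y : 𝒳, edist x y < rbar →
    J x ≤ (J y).withDensity fun z => ENNReal.ofReal (C₁ * (1 + dist y z / dist x z) ^ θ)
  escape : ∀ (x y : 𝒳) (r s : ℝ), 0 < r → ENNReal.ofReal r < rbar → 0 < s →
    ENNReal.ofReal s < rbar → s + C₃ * r < dist x y →
    J x (Metric.ball y s) ≤ ENNReal.ofReal C₂ * J x (Metric.ball x r)ᶜ

/-- Jump measure tail estimate `(Jt)_{φ,r̄}` with constants `C₄ ≤ C₅`. -/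
structure JumpTail {𝒳 : Type*} [MetricSpace 𝒳] [MeasurableSpace 𝒳] (J : Kernel 𝒳 𝒳)
    (φ : ℝ → ℝ) (rbar : ℝ≥0∞) (C₄ C₅ : ℝ) : Prop where
  pos : 0 < C₄
  le : C₄ ≤ C₅
  lower : ∀ (x : 𝒳) (r : ℝ), 0 < r → ENNReal.ofReal r < rbar →
    ENNReal.ofReal (C₄ / φ r) ≤ J x (Metric.ball x r)ᶜ
  upper : ∀ (x : 𝒳) (r : ℝ), 0 < r → ENNReal.ofReal r < rbar →
    J x (Metric.ball x r)ᶜ ≤ ENNReal.ofReal (C₅ / φ r)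

end

/-! A non-negative function `h` that is regular harmonic in `D ∩ B(ξ, 2r)` and vanishes on `B(ξ, 2r)
\ D` factorizes. Put σ = (2 - κ)/5, V = D ∩ B(ξ, (2 - 4σ)r), N = B(ξ, (2 - 3σ)r) and Λ(h) = ∫_{Nᶜ} h
dJ(ξ, ·). For x in D ∩ B(ξ, κr), h(x) is comparable with 𝔼_x τ_V · Λ(h). The first factor does not
depend on h and the second does not depend on x, so both cancel when h₁(x)h₂(y) is compared with
h₁(y)h₂(x).

The lower bound (`factor_le_exitMean`) counts only jumps from V into Nᶜ: by the Lévy system their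
rate at w ∈ V is J(w, ·), which on Nᶜ is at least a constant times J(ξ, ·). In the upper bound
(`exitMean_le_factor`) such jumps are treated in the same way. The remaining contribution comes from
exits from V into N ∩ D, and two estimates control it.

Survival (`exitLaw_ball_le`): the probability of leaving D ∩ B(x, ρ) into D is at most C 𝔼_x τ /
φ(ρ). To leave D ∩ B(x, 2σ) into D, the process must last a time t, or make a jump of size
comparable to σ, or first leave D ∩ B(x, σ) into D and then move by σ/4 within time t. With t a
small multiple of φ(σ/4), the last event has at most a small multiple of the probability at half the
radius. Iterating over dyadic radii gives the claim.

Carleson (`carleson`): h ≤ C φ(r) Λ(h) on D ∩ N. At a point w, the process leaves a small ball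
around w intersected with D. By the survival estimate the chance of landing in D near w is bounded
by 𝔼τ/φ, while the chance of jumping far away is bounded below by 𝔼τ/φ; hence the former has a bound
τ < 1 (`exitMean_le_of_near`). So the supremum of δ^θ h, where δ is the truncated relative distance
to the sphere of radius 2r, is at most a contraction of itself plus a multiple of φ(r) Λ(h). The
weight δ^θ compensates exactly for the factor δ^(-θ) by which J(w, ·) may exceed J(ξ, ·) when w
approaches that sphere. The supremum is finite after truncating the exit data. -/

noncomputable section

set_option linter.unusedSectionVars false

/-! ### Second countability of the one-point compactification -/

/-- A countable base consists of a countable base of the space together with the complements of a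
compact exhaustion. This makes the compactification metrizable and its Borel σ-algebra countably
generated. -/
theorem OnePoint.secondCountableTopology_of_locallyCompact {𝒳 : Type*} [TopologicalSpace 𝒳]
    [T2Space 𝒳] [LocallyCompactSpace 𝒳] [SecondCountableTopology 𝒳] :
    SecondCountableTopology (OnePoint 𝒳) := by
  let K : CompactExhaustion 𝒳 := default
  let 𝓑 : Set (Set (OnePoint 𝒳)) :=
    (fun s : Set 𝒳 => ((↑) : 𝒳 → OnePoint 𝒳) '' s) '' TopologicalSpace.countableBasis 𝒳 ∪
      range fun n => (((↑) : 𝒳 → OnePoint 𝒳) '' K n)ᶜ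
  have hopen : ∀ u ∈ 𝓑, IsOpen u := by
    rintro u (⟨s, hs, rfl⟩ | ⟨n, rfl⟩)
    · exact OnePoint.isOpen_image_coe.2 (TopologicalSpace.isOpen_of_mem_countableBasis hs)
    · exact OnePoint.isOpen_compl_image_coe.2 ⟨(K.isCompact n).isClosed, K.isCompact n⟩
  have hbasis : TopologicalSpace.IsTopologicalBasis 𝓑 := by
    refine TopologicalSpace.isTopologicalBasis_of_isOpen_of_nhds hopen ?_
    intro a u ha hu
    induction a using OnePoint.rec with
    | infty =>
      obtain ⟨hc, hK⟩ := (OnePoint.isOpen_iff_of_mem ha).1 hu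
      obtain ⟨n, hn⟩ := K.exists_superset_of_isCompact hK
      refine ⟨_, Or.inr ⟨n, rfl⟩, by simp, ?_⟩
      intro z hz
      induction z using OnePoint.rec with
      | infty => exact ha
      | coe z =>
        by_contra hzu
        exact hz ⟨z, hn hzu, rfl⟩
    | coe a =>
      have hu' : IsOpen (((↑) : 𝒳 → OnePoint 𝒳) ⁻¹' u) := hu.preimage OnePoint.continuous_coe
      obtain ⟨v, hv, hav, hvu⟩ :=
        (TopologicalSpace.isBasis_countableBasis 𝒳).exists_subset_of_mem_open ha hu'
      exact ⟨_, Or.inl ⟨v, hv, rfl⟩, ⟨a, hav, rfl⟩, image_subset_iff.2 hvu⟩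
  exact hbasis.secondCountableTopology
    (((TopologicalSpace.countable_countableBasis 𝒳).image _).union (countable_range _))

/-! ### The augmented filtration and hitting times of open sets -/

namespace CadlagFamily

variable {𝒳 Ω : Type*} [TopologicalSpace 𝒳] [MeasurableSpace Ω]

theorem rawSigma_le (Z : CadlagFamily 𝒳 Ω) (t : ℝ≥0) : Z.rawSigma t ≤ ‹MeasurableSpace Ω› := by
  conv_rhs => rw [Z.generated]
  exact iSup_le fun s => iSup_le fun _ => le_iSup (fun t => MeasurableSpace.comap (Z.X t) _) s

theorem measurable_X (Z : CadlagFamily 𝒳 Ω) (t : ℝ≥0) : Measurable (Z.X t) := by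
  rw [measurable_iff_comap_le]
  conv_rhs => rw [Z.generated]
  exact le_iSup (fun t => MeasurableSpace.comap (Z.X t) _) t

theorem measurableSet_rawSigma (Z : CadlagFamily 𝒳 Ω) {s t : ℝ≥0} (hst : s ≤ t)
    {A : Set (OnePoint 𝒳)} (hA : MeasurableSet A) :
    MeasurableSet[Z.rawSigma t] {ω | Z.X s ω ∈ A} := by
  have : MeasurableSpace.comap (Z.X s) inferInstance ≤ Z.rawSigma t :=
    le_iSup₂_of_le s hst le_rfl
  exact this _ ⟨A, hA, rfl⟩

theorem measurableSet_augmentedFiltration_iff (Z : CadlagFamily 𝒳 Ω) (t : ℝ≥0) (A : Set Ω) :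
    MeasurableSet[Z.augmentedFiltration t] A ↔
      ∀ s > t, ∀ μ : Measure (OnePoint 𝒳), IsProbabilityMeasure μ →
        ∃ B, MeasurableSet[Z.rawSigma s] B ∧ A =ᵐ[Z.law μ] B := by
  have h : Z.augmentedFiltration t = ⨅ s > t, Z.completedFiltration s :=
    Filtration.rightCont_eq _ _
  rw [h]
  simp only [MeasurableSpace.measurableSet_iInf]
  refine forall₂_congr fun s _ => ?_
  change MeasurableSet[⨅ μ : ProbabilityMeasure (OnePoint 𝒳),
    eventuallyMeasurableSpace (Z.rawSigma s) (ae (Z.law (μ : Measure (OnePoint 𝒳))))] A ↔ _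
  rw [MeasurableSpace.measurableSet_iInf]
  exact ⟨fun h μ hμ => h ⟨μ, hμ⟩, fun h μ => h μ.1 μ.2⟩

theorem nullMeasurableSet_of_augmentedFiltration (Z : CadlagFamily 𝒳 Ω) {t : ℝ≥0} {A : Set Ω}
    (hA : MeasurableSet[Z.augmentedFiltration t] A) (μ : Measure (OnePoint 𝒳))
    [hμ : IsProbabilityMeasure μ] : NullMeasurableSet A (Z.law μ) := by
  obtain ⟨B, hB, hAB⟩ := (Z.measurableSet_augmentedFiltration_iff t A).1 hA (t + 1) (by simp) μ hμ
  exact ⟨B, Z.rawSigma_le _ _ hB, hAB⟩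

theorem law_dirac (Z : CadlagFamily 𝒳 Ω) (x : OnePoint 𝒳) :
    Z.law (Measure.dirac x) = Z.P x := Measure.dirac_bind Z.P.measurable x

theorem isProbabilityMeasure_law (Z : CadlagFamily 𝒳 Ω) (μ : Measure (OnePoint 𝒳))
    [IsProbabilityMeasure μ] : IsProbabilityMeasure (Z.law μ) := by
  have := Z.isMarkovKernel
  unfold law
  infer_instance

/-- The first hitting time of a set. -/
def hit (Z : CadlagFamily 𝒳 Ω) (A : Set (OnePoint 𝒳)) : Ω → WithTop ℝ≥0 :=
  hittingAfter Z.X A 0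

theorem stoppedValue_eq (Z : CadlagFamily 𝒳 Ω) {T : Ω → WithTop ℝ≥0} {t : ℝ≥0} {ω : Ω}
    (h : T ω = t) : stoppedValue Z.X T ω = Z.X t ω := by
  rw [stoppedValue, h]
  rfl

theorem hit_le_of_mem (Z : CadlagFamily 𝒳 Ω) {A : Set (OnePoint 𝒳)} {t : ℝ≥0} {ω : Ω}
    (h : Z.X t ω ∈ A) : Z.hit A ω ≤ t := hittingAfter_le_of_mem zero_le h

theorem hit_lt_iff (Z : CadlagFamily 𝒳 Ω) {A : Set (OnePoint 𝒳)} {t : ℝ≥0} {ω : Ω} :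
    Z.hit A ω < t ↔ ∃ s < t, Z.X s ω ∈ A := by
  unfold hit
  rw [hittingAfter_lt_iff]
  simp

theorem hit_anti (Z : CadlagFamily 𝒳 Ω) {A B : Set (OnePoint 𝒳)} (h : A ⊆ B) (ω : Ω) :
    Z.hit B ω ≤ Z.hit A ω := hittingAfter_anti Z.X 0 h ω

theorem notMem_of_lt_hit (Z : CadlagFamily 𝒳 Ω) {A : Set (OnePoint 𝒳)} {t : ℝ≥0} {ω : Ω}
    (h : (t : WithTop ℝ≥0) < Z.hit A ω) : Z.X t ω ∉ A :=
  fun hA => (Z.hit_le_of_mem hA).not_gt h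

theorem eventually_mem_of_isOpen (Z : CadlagFamily 𝒳 Ω) {O : Set (OnePoint 𝒳)} (hO : IsOpen O)
    {t : ℝ≥0} {ω : Ω} (h : Z.X t ω ∈ O) : ∃ u > t, ∀ s ∈ Ico t u, Z.X s ω ∈ O := by
  have h1 : ∀ᶠ s in 𝓝[≥] t, Z.X s ω ∈ O := (Z.rightCts ω t).eventually (hO.mem_nhds h)
  obtain ⟨u, hu, hsub⟩ := (mem_nhdsGE_iff_exists_Ico_subset' (show t < t + 1 by simp)).1 h1
  exact ⟨u, hu, fun s hs => hsub hs⟩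

theorem exists_seq_mem_of_hit_eq (Z : CadlagFamily 𝒳 Ω) {A : Set (OnePoint 𝒳)} {t : ℝ≥0} {ω : Ω}
    (h : Z.hit A ω = t) {u : ℝ≥0} (hu : t < u) : ∃ s ∈ Ico t u, Z.X s ω ∈ A := by
  have : Z.hit A ω < u := by rw [h]; exact_mod_cast hu
  obtain ⟨s, hs, hA⟩ := Z.hit_lt_iff.1 this
  refine ⟨s, ⟨?_, hs⟩, hA⟩
  have := Z.hit_le_of_mem hA
  rw [h] at this
  exact_mod_cast this

/-- At its hitting time of any set, the path lies in the closure of the set. -/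
theorem mem_closure_of_hit_eq (Z : CadlagFamily 𝒳 Ω) {A : Set (OnePoint 𝒳)} {t : ℝ≥0} {ω : Ω}
    (h : Z.hit A ω = t) : Z.X t ω ∈ closure A := by
  by_contra hn
  obtain ⟨u, hu, hsub⟩ := Z.eventually_mem_of_isOpen isClosed_closure.isOpen_compl hn
  obtain ⟨s, hs, hA⟩ := Z.exists_seq_mem_of_hit_eq h hu
  exact hsub s hs (subset_closure hA)

theorem exists_denseSeq_mem_of_isOpen (Z : CadlagFamily 𝒳 Ω) {O : Set (OnePoint 𝒳)} (hO : IsOpen O)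
    {s t : ℝ≥0} {ω : Ω} (hst : s < t) (h : Z.X s ω ∈ O) :
    ∃ n : ℕ, TopologicalSpace.denseSeq ℝ≥0 n < t ∧
      Z.X (TopologicalSpace.denseSeq ℝ≥0 n) ω ∈ O := by
  obtain ⟨u, hu, hsub⟩ := Z.eventually_mem_of_isOpen hO h
  have hlt : s < min u t := lt_min hu hst
  obtain ⟨n, hn1, hn2⟩ := (TopologicalSpace.denseRange_denseSeq ℝ≥0).exists_mem_open
    (isOpen_Ioo (a := s) (b := min u t)) (nonempty_Ioo.2 hlt)
  exact ⟨n, hn2.trans_le (min_le_right _ _), hsub _ ⟨hn1.le, hn2.trans_le (min_le_left _ _)⟩⟩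

/-- By right continuity, an open set visited before `t` is visited before `t` at a time of a
countable dense set. Right continuity of the filtration leaves room for the strictly later times `u
n` decreasing to `t`. -/
theorem isStoppingTime_hit_of_isOpen (Z : CadlagFamily 𝒳 Ω) {O : Set (OnePoint 𝒳)}
    (hO : IsOpen O) : IsStoppingTime Z.augmentedFiltration (Z.hit O) := by
  intro t
  rw [Z.measurableSet_augmentedFiltration_iff]
  intro s hs μ _
  refine ⟨_, ?_, EventuallyEq.rfl⟩
  obtain ⟨u, hu_anti, hu_lt, hu_lim⟩ := exists_seq_strictAnti_tendsto' hs
  have hset : {ω | Z.hit O ω ≤ t} =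
      ⋂ n, ⋃ q : ℕ, ⋃ _ : TopologicalSpace.denseSeq ℝ≥0 q < u n,
        {ω | Z.X (TopologicalSpace.denseSeq ℝ≥0 q) ω ∈ O} := by
    ext ω
    simp only [mem_ofPred_eq, mem_iInter, mem_iUnion, exists_prop]
    constructor
    · intro h n
      have : Z.hit O ω < u n := h.trans_lt (by exact_mod_cast (hu_lt n).1)
      obtain ⟨v, hv, hvO⟩ := Z.hit_lt_iff.1 this
      exact Z.exists_denseSeq_mem_of_isOpen hO hv hvO
    · intro h
      by_contra! hlt
      obtain ⟨n, hn⟩ : ∃ n, (u n : WithTop ℝ≥0) ≤ Z.hit O ω := by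
        cases hh : Z.hit O ω with
        | top => exact ⟨0, le_top⟩
        | coe a =>
          rw [hh] at hlt
          have hta : t < a := by exact_mod_cast hlt
          obtain ⟨n, hn⟩ := (hu_lim.eventually (gt_mem_nhds hta)).exists
          exact ⟨n, by exact_mod_cast hn.le⟩
      obtain ⟨q, hq, hqO⟩ := h n
      exact (Z.hit_lt_iff.2 ⟨_, hq, hqO⟩).not_ge hn
  rw [hset]
  refine MeasurableSet.iInter fun n => MeasurableSet.iUnion fun q => MeasurableSet.iUnion fun hq => ?_
  exact Z.measurableSet_rawSigma (hq.le.trans (hu_lt n).2.le) hO.measurableSet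

/-- The augmented filtration is complete under every initial law, so changing a stopping time on a
set that is null for all of them is harmless. -/
theorem isStoppingTime_congr (Z : CadlagFamily 𝒳 Ω) {S T : Ω → WithTop ℝ≥0}
    (hS : IsStoppingTime Z.augmentedFiltration S)
    (h : ∀ μ : Measure (OnePoint 𝒳), IsProbabilityMeasure μ → S =ᵐ[Z.law μ] T) :
    IsStoppingTime Z.augmentedFiltration T := by
  intro t
  rw [Z.measurableSet_augmentedFiltration_iff]
  intro s hs μ hμ
  obtain ⟨B, hB, hSB⟩ := (Z.measurableSet_augmentedFiltration_iff t _).1 (hS t) s hs μ hμ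
  refine ⟨B, hB, EventuallyEq.trans ?_ hSB⟩
  filter_upwards [h μ hμ] with ω hω
  simp only [eq_iff_iff]
  change T ω ≤ t ↔ S ω ≤ t
  rw [hω]

end CadlagFamily

/-! ### Hitting times of closed sets through quasi-left-continuity -/

namespace HuntProcess

variable {𝒳 Ω : Type*} [MetricSpace 𝒳] [LocallyCompactSpace 𝒳] [SecondCountableTopology 𝒳]
  [MeasurableSpace Ω]

/-- A closed set is hit exactly at the limit of the hitting times of its shrinking
neighbourhoods. -/
theorem exists_seq_hit_of_isClosed (Z : HuntProcess 𝒳 Ω) {F : Set (OnePoint 𝒳)}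
    (hF : IsClosed F) (hne : F.Nonempty) :
    ∃ G : ℕ → Set (OnePoint 𝒳), (∀ n, IsOpen (G n)) ∧ (∀ n, F ⊆ G n) ∧
      ∀ μ : Measure (OnePoint 𝒳), IsProbabilityMeasure μ →
        (fun ω => ⨆ n, Z.hit (G n) ω) =ᵐ[Z.law μ] Z.hit F := by
  have := OnePoint.secondCountableTopology_of_locallyCompact (𝒳 := 𝒳)
  let _ : MetricSpace (OnePoint 𝒳) := TopologicalSpace.metrizableSpaceMetric (OnePoint 𝒳)
  have hpos : ∀ n : ℕ, (0 : ℝ) < 1 / (n + 1) := fun n => by positivity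
  refine ⟨fun n => Metric.thickening (1 / (n + 1)) F, fun n => Metric.isOpen_thickening,
    fun n => Metric.self_subset_thickening (hpos n) F, fun μ _ => ?_⟩
  set S : ℕ → Ω → WithTop ℝ≥0 := fun n => Z.hit (Metric.thickening (1 / (n + 1)) F) with hS
  have hmono : ∀ ω, Monotone fun n => S n ω := by
    intro ω m n hmn
    refine Z.hit_anti (Metric.thickening_mono ?_ F) ω
    exact one_div_le_one_div_of_le (by positivity) (by gcongr)
  have hlub : ∀ ω, IsLUB (range fun n => S n ω) (⨆ n, S n ω) := fun ω => isLUB_iSup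
  have hle : ∀ ω, ⨆ n, S n ω ≤ Z.hit F ω := fun ω =>
    iSup_le fun n => Z.hit_anti (Metric.self_subset_thickening (hpos n) F) ω
  filter_upwards [Z.quasiLeftCts μ S (fun ω => ⨆ n, S n ω)
    (fun n => Z.isStoppingTime_hit_of_isOpen Metric.isOpen_thickening) hmono hlub] with ω hω
  refine le_antisymm (hle ω) ?_
  change Z.hit F ω ≤ ⨆ n, S n ω
  by_cases htop : ⨆ n, S n ω < ⊤
  swap
  · rw [not_lt_top_iff.1 htop]; exact le_top
  have hlim := hω htop
  -- At time `S n` the path is in the closure of the `n`-th neighbourhood. Quasi-left-continuity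
  -- carries this to the limit time, where the path must then be in `F` itself.
  have hmem : ∀ n, Metric.infDist (stoppedValue Z.X (S n) ω) F ≤ 1 / (n + 1) := by
    intro n
    have hn : S n ω ≠ ⊤ := ((le_iSup (fun n => S n ω) n).trans_lt htop).ne
    obtain ⟨t, ht⟩ := WithTop.ne_top_iff_exists.1 hn
    have := Z.mem_closure_of_hit_eq (A := Metric.thickening (1 / (n + 1)) F) ht.symm
    have := Metric.closure_thickening_subset_cthickening _ _ this
    rw [Metric.mem_cthickening_iff] at this
    rw [Z.stoppedValue_eq ht.symm]
    exact ENNReal.toReal_le_of_le_ofReal (hpos n).le this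
  have hzero : Metric.infDist (stoppedValue Z.X (fun ω => ⨆ n, S n ω) ω) F ≤ 0 := by
    refine le_of_tendsto_of_tendsto
      (((Metric.continuous_infDist_pt F).tendsto _).comp hlim)
      (tendsto_one_div_add_atTop_nhds_zero_nat) (Eventually.of_forall hmem)
  have hin : stoppedValue Z.X (fun ω => ⨆ n, S n ω) ω ∈ F := by
    rw [hF.mem_iff_infDist_zero hne]
    exact le_antisymm hzero Metric.infDist_nonneg
  obtain ⟨t, ht⟩ := WithTop.ne_top_iff_exists.1 htop.ne
  rw [← ht]
  refine Z.hit_le_of_mem ?_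
  rwa [Z.stoppedValue_eq ht.symm] at hin

theorem isStoppingTime_hit_of_isClosed (Z : HuntProcess 𝒳 Ω) {F : Set (OnePoint 𝒳)}
    (hF : IsClosed F) (hne : F.Nonempty) :
    IsStoppingTime Z.augmentedFiltration (Z.hit F) := by
  obtain ⟨G, hG, -, h⟩ := Z.exists_seq_hit_of_isClosed hF hne
  refine Z.isStoppingTime_congr (S := fun ω => ⨆ n, Z.hit (G n) ω) ?_ h
  intro t
  have : {ω | ⨆ n, Z.hit (G n) ω ≤ t} = ⋂ n, {ω | Z.hit (G n) ω ≤ t} := by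
    ext ω
    simp only [mem_ofPred_eq, mem_iInter, iSup_le_iff]
  rw [this]
  exact MeasurableSet.iInter fun n => Z.isStoppingTime_hit_of_isOpen (hG n) t

/-- Almost surely, a path whose left limit is the cemetery has died. -/
theorem ae_eq_infty_of_tendsto_infty (Z : HuntProcess 𝒳 Ω) (μ : Measure (OnePoint 𝒳))
    [hμ : IsProbabilityMeasure μ] :
    ∀ᵐ ω ∂(Z.law μ), ∀ t : ℝ≥0, 0 < t → Tendsto (fun s => Z.X s ω) (𝓝[<] t) (𝓝 OnePoint.infty) →
      Z.X t ω = OnePoint.infty := by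
  obtain ⟨G, hG, hsub, h⟩ := Z.exists_seq_hit_of_isClosed (F := {OnePoint.infty})
    isClosed_singleton (singleton_nonempty _)
  filter_upwards [h μ hμ] with ω hω t ht hlim
  -- A left limit at the cemetery forces a visit to each of its neighbourhoods before `t`, and the
  -- limit of those hitting times is the hitting time of the cemetery.
  have hle : Z.hit {OnePoint.infty} ω ≤ t := by
    rw [← hω]
    refine iSup_le fun n => ?_
    have h1 : ∀ᶠ s in 𝓝[<] t, Z.X s ω ∈ G n :=
      hlim.eventually ((hG n).mem_nhds (hsub n rfl))
    have : (𝓝[<] t).NeBot := nhdsLT_neBot_of_exists_lt ⟨0, ht⟩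
    obtain ⟨s, hs, hst⟩ := (h1.and self_mem_nhdsWithin).exists
    exact (Z.hit_le_of_mem hs).trans (by exact_mod_cast (le_of_lt hst))
  obtain ⟨u, hu⟩ := WithTop.ne_top_iff_exists.1 (hle.trans_lt (WithTop.coe_lt_top t)).ne
  have hmem := Z.mem_closure_of_hit_eq hu.symm
  rw [isClosed_singleton.closure_eq] at hmem
  rw [← hu] at hle
  exact Z.absorbed u t ω (by exact_mod_cast hle) hmem

end HuntProcess

/-! ### Measurability up to null sets and the strong Markov property -/

/-- A subset of a null measurable set that splits its measure additively is null measurable. -/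
theorem nullMeasurableSet_of_measure_add_le {Ω : Type*} [MeasurableSpace Ω] {μ : Measure Ω}
    [IsFiniteMeasure μ] {B E : Set Ω} (hE : NullMeasurableSet E μ) (hBE : B ⊆ E)
    (h : μ B + μ (E \ B) ≤ μ E) : NullMeasurableSet B μ := by
  set B' := toMeasurable μ B
  set D' := toMeasurable μ (E \ B)
  have hB' : MeasurableSet B' := measurableSet_toMeasurable _ _
  have hD' : MeasurableSet D' := measurableSet_toMeasurable _ _
  have hcover : E ⊆ B' ∪ D' := by
    intro ω hω
    by_cases hB : ω ∈ B
    · exact Or.inl (subset_toMeasurable _ _ hB)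
    · exact Or.inr (subset_toMeasurable _ _ ⟨hω, hB⟩)
  -- The measurable hulls of the two pieces cover `E` and have total mass at most `μ E`, so their
  -- overlap is null.
  have hzero : μ (B' ∩ D') = 0 := by
    have h1 : μ (B' ∪ D') + μ (B' ∩ D') ≤ μ E := by
      rw [measure_union_add_inter _ hD', measure_toMeasurable, measure_toMeasurable]
      exact h
    have h2 : μ (B' ∪ D') + μ (B' ∩ D') ≤ μ (B' ∪ D') + 0 := by
      rw [add_zero]; exact h1.trans (measure_mono hcover)
    simpa using (ENNReal.add_le_add_iff_left (measure_ne_top _ _)).1 h2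
  have hnull : μ ((B' ∩ E) \ B) = 0 := by
    refine measure_mono_null ?_ hzero
    rintro ω ⟨⟨h1, h2⟩, h3⟩
    exact ⟨h1, subset_toMeasurable _ _ ⟨h2, h3⟩⟩
  have hBsub : B ⊆ B' ∩ E := subset_inter (subset_toMeasurable _ _) hBE
  refine (hB'.nullMeasurableSet.inter hE).congr ?_
  refine (ae_eq_set).2 ⟨hnull, ?_⟩
  rw [sdiff_eq_empty.2 hBsub, measure_empty]

namespace OnePoint

variable {𝒳 : Type*} [TopologicalSpace 𝒳] [MeasurableSpace 𝒳] [BorelSpace 𝒳]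

theorem measurableEmbedding_coe : MeasurableEmbedding ((↑) : 𝒳 → OnePoint 𝒳) :=
  OnePoint.isOpenEmbedding_coe.measurableEmbedding

theorem elim_eq_extend (g : 𝒳 → ℝ≥0∞) :
    (fun y : OnePoint 𝒳 => y.elim 0 g) = Function.extend ((↑) : 𝒳 → OnePoint 𝒳) g (fun _ => 0) := by
  ext y
  induction y using OnePoint.rec with
  | infty =>
    rw [Function.extend_apply' _ _ _ (by rintro ⟨a, ha⟩; exact OnePoint.coe_ne_infty a ha)]
    rfl
  | coe y => rw [OnePoint.coe_injective.extend_apply]; rfl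

theorem measurable_elim {g : 𝒳 → ℝ≥0∞} (hg : Measurable g) :
    Measurable fun y : OnePoint 𝒳 => y.elim 0 g := by
  rw [elim_eq_extend]
  exact measurableEmbedding_coe.measurable_extend hg measurable_const

/-- Harmonic functions are only universally measurable, so measurability on the compactification is
tested law by law, by pulling `ν` back to the space. -/
theorem aemeasurable_elim {g : 𝒳 → ℝ≥0∞} (hg : ∀ ν : Measure 𝒳, IsFiniteMeasure ν → AEMeasurable g ν)
    (ν : Measure (OnePoint 𝒳)) [IsFiniteMeasure ν] :
    AEMeasurable (fun y : OnePoint 𝒳 => y.elim 0 g) ν := by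
  have hfin : IsFiniteMeasure (ν.comap ((↑) : 𝒳 → OnePoint 𝒳)) := by
    constructor
    rw [measurableEmbedding_coe.comap_apply]
    exact measure_lt_top _ _
  have h := hg _ hfin
  refine ⟨fun y => y.elim 0 (h.mk g), measurable_elim h.measurable_mk, ?_⟩
  have h0 := h.ae_eq_mk
  rw [Filter.EventuallyEq, ae_iff, measurableEmbedding_coe.comap_apply] at h0
  rw [Filter.EventuallyEq, ae_iff]
  refine measure_mono_null ?_ h0
  intro y hy
  induction y using OnePoint.rec with
  | infty => exact absurd rfl hy
  | coe y => exact ⟨y, hy, rfl⟩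

end OnePoint

namespace CadlagFamily

variable {𝒳 Ω : Type*} [TopologicalSpace 𝒳] [MeasurableSpace Ω]

theorem nullMeasurableSet_lt_top (Z : CadlagFamily 𝒳 Ω) {T : Ω → WithTop ℝ≥0}
    (hT : IsStoppingTime Z.augmentedFiltration T) (μ : Measure (OnePoint 𝒳))
    [IsProbabilityMeasure μ] : NullMeasurableSet {ω | T ω < ⊤} (Z.law μ) := by
  have : {ω | T ω < ⊤} = ⋃ n : ℕ, {ω | T ω ≤ ((n : ℝ≥0) : WithTop ℝ≥0)} := by
    ext ω
    simp only [mem_ofPred_eq, mem_iUnion]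
    constructor
    · intro h
      obtain ⟨t, ht⟩ := WithTop.ne_top_iff_exists.1 h.ne
      obtain ⟨n, hn⟩ := exists_nat_ge t
      exact ⟨n, by rw [← ht]; exact_mod_cast hn⟩
    · rintro ⟨n, hn⟩
      exact hn.trans_lt (WithTop.coe_lt_top _)
  rw [this]
  exact NullMeasurableSet.iUnion fun n => Z.nullMeasurableSet_of_augmentedFiltration (hT n) μ

/-- The time of hitting a set after `t` is computed by the shifted path. -/
theorem hit_eq_add_hit_shift (Z : CadlagFamily 𝒳 Ω) {A : Set (OnePoint 𝒳)} {t : ℝ≥0} {ω : Ω}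
    (h : (t : WithTop ℝ≥0) ≤ Z.hit A ω) : Z.hit A ω = t + Z.hit A (Z.shift t ω) := by
  refine eq_of_forall_gt_iff fun s => ?_
  cases s with
  | top =>
    have key : (∃ u, Z.X u ω ∈ A) ↔ ∃ u, Z.X u (Z.shift t ω) ∈ A := by
      constructor
      · rintro ⟨u, hu⟩
        have := h.trans (Z.hit_le_of_mem hu)
        have htu : t ≤ u := by exact_mod_cast this
        exact ⟨u - t, by rw [Z.X_shift, add_tsub_cancel_of_le htu]; exact hu⟩
      · rintro ⟨u, hu⟩
        exact ⟨t + u, by rwa [Z.X_shift] at hu⟩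
    have htop : ∀ ω', Z.hit A ω' < ⊤ ↔ ∃ u, Z.X u ω' ∈ A := by
      intro ω'
      rw [lt_top_iff_ne_top, ne_eq, hit, hittingAfter_eq_top_iff]
      simp
    rw [htop, key, ← htop, WithTop.add_lt_top]
    exact ⟨fun h => ⟨WithTop.coe_lt_top t, h⟩, fun h => h.2⟩
  | coe s =>
    rw [Z.hit_lt_iff]
    constructor
    · rintro ⟨u, hu, hA⟩
      have := h.trans (Z.hit_le_of_mem hA)
      have htu : t ≤ u := by exact_mod_cast this
      have h2 : Z.hit A (Z.shift t ω) ≤ (u - t : ℝ≥0) :=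
        Z.hit_le_of_mem (by rw [Z.X_shift, add_tsub_cancel_of_le htu]; exact hA)
      calc (t : WithTop ℝ≥0) + Z.hit A (Z.shift t ω) ≤ t + (u - t : ℝ≥0) := by gcongr
        _ = (u : WithTop ℝ≥0) := by rw [← WithTop.coe_add, add_tsub_cancel_of_le htu]
        _ < s := by exact_mod_cast hu
    · intro hlt
      cases hh : Z.hit A (Z.shift t ω) with
      | top => rw [hh, WithTop.add_top] at hlt; exact absurd hlt not_top_lt
      | coe v =>
        rw [hh, ← WithTop.coe_add] at hlt
        have hlt' : t + v < s := by exact_mod_cast hlt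
        have : Z.hit A (Z.shift t ω) < (s - t : ℝ≥0) := by
          rw [hh]; exact_mod_cast lt_tsub_iff_left.2 hlt'
        obtain ⟨u, hu, hA⟩ := Z.hit_lt_iff.1 this
        exact ⟨t + u, lt_tsub_iff_left.1 hu, by rwa [Z.X_shift] at hA⟩

/-- The law of the stopped path has mass at most one because of `{T = ∞}`; it is normalized in order
to use statements about probability laws. -/
theorem aemeasurable_law_of_isProbabilityMeasure (Z : CadlagFamily 𝒳 Ω) {F : Ω → ℝ≥0∞}
    (hF : ∀ μ : Measure (OnePoint 𝒳), IsProbabilityMeasure μ → AEMeasurable F (Z.law μ))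
    (ν : Measure (OnePoint 𝒳)) [IsFiniteMeasure ν] : AEMeasurable F (Z.law ν) := by
  by_cases h0 : ν = 0
  · subst h0
    have : Z.law 0 = 0 := by simp [law]
    rw [this]; exact aemeasurable_zero_measure
  · have : NeZero ν := ⟨h0⟩
    have hp : IsProbabilityMeasure ((ν univ)⁻¹ • ν) := inferInstance
    have hac : ν ≪ (ν univ)⁻¹ • ν := Measure.absolutelyContinuous_smul (by simp)
    exact (hF _ hp).mono_ac (hac.comp_right Z.P)

end CadlagFamily

namespace HuntProcess

variable {𝒳 Ω : Type*} [MeasurableSpace Ω]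

/-- The strong Markov identity holds a priori for outer measures. Applied to `Γ` and to `Γᶜ`, it
shows that the two pieces of `{T < ∞}` add up to at most its mass, which forces null measurability.
-/
theorem nullMeasurableSet_shift [TopologicalSpace 𝒳] (Z : HuntProcess 𝒳 Ω) {T : Ω → WithTop ℝ≥0}
    (hT : IsStoppingTime Z.augmentedFiltration T) (μ : Measure (OnePoint 𝒳))
    [IsProbabilityMeasure μ] {Γ : Set Ω} (hΓ : MeasurableSet Γ) :
    NullMeasurableSet {ω | T ω < ⊤ ∧ Z.shift (T ω).untopA ω ∈ Γ} (Z.law μ) := by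
  have := Z.isProbabilityMeasure_law μ
  have := Z.isMarkovKernel
  refine nullMeasurableSet_of_measure_add_le (Z.nullMeasurableSet_lt_top hT μ)
    (fun ω hω => hω.1) ?_
  have h1 := Z.strongMarkov μ T hT univ Γ MeasurableSet.univ hΓ
  have h2 := Z.strongMarkov μ T hT univ Γᶜ MeasurableSet.univ hΓ.compl
  simp only [univ_inter] at h1 h2
  have hd : {ω | T ω < ⊤} \ {ω | T ω < ⊤ ∧ Z.shift (T ω).untopA ω ∈ Γ} =
      {ω | T ω < ⊤ ∧ Z.shift (T ω).untopA ω ∈ Γᶜ} := by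
    ext ω; simp only [Set.mem_sdiff, mem_ofPred_eq, mem_compl_iff]; tauto
  rw [hd, h1, h2]
  -- Superadditivity of the lower integral needs no measurability of the integrands.
  refine (le_lintegral_add _ _).trans ?_
  calc ∫⁻ ω in {ω | T ω < ⊤}, (Z.P (stoppedValue Z.X T ω) Γ + Z.P (stoppedValue Z.X T ω) Γᶜ)
        ∂(Z.law μ) = ∫⁻ _ in {ω | T ω < ⊤}, 1 ∂(Z.law μ) := by
          refine lintegral_congr fun ω => ?_
          rw [measure_add_measure_compl hΓ, measure_univ]
    _ ≤ _ := by simp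

variable [MetricSpace 𝒳] [LocallyCompactSpace 𝒳] [SecondCountableTopology 𝒳]

theorem isStoppingTime_exitTime (Z : HuntProcess 𝒳 Ω) {D : Set 𝒳} (hD : IsOpen D) :
    IsStoppingTime Z.augmentedFiltration (Z.exitTime D) :=
  Z.isStoppingTime_hit_of_isClosed (OnePoint.isOpen_image_coe.2 hD).isClosed_compl
    ⟨OnePoint.infty, by simp⟩

theorem nullMeasurableSet_stoppedValue (Z : HuntProcess 𝒳 Ω) {T : Ω → WithTop ℝ≥0}
    (hT : IsStoppingTime Z.augmentedFiltration T) (μ : Measure (OnePoint 𝒳))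
    [IsProbabilityMeasure μ] {A : Set (OnePoint 𝒳)} (hA : MeasurableSet A) :
    NullMeasurableSet {ω | T ω < ⊤ ∧ stoppedValue Z.X T ω ∈ A} (Z.law μ) := by
  have := Z.nullMeasurableSet_shift hT μ (Z.measurable_X 0 hA)
  simp only [mem_preimage, Z.X_shift, add_zero] at this
  exact this

theorem aemeasurable_stoppedValue (Z : HuntProcess 𝒳 Ω) {T : Ω → WithTop ℝ≥0}
    (hT : IsStoppingTime Z.augmentedFiltration T) (μ : Measure (OnePoint 𝒳))
    [IsProbabilityMeasure μ] :
    AEMeasurable (stoppedValue Z.X T) ((Z.law μ).restrict {ω | T ω < ⊤}) := by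
  have := OnePoint.secondCountableTopology_of_locallyCompact (𝒳 := 𝒳)
  refine NullMeasurable.aemeasurable fun A hA => ?_
  have h := (Z.nullMeasurableSet_stoppedValue hT μ hA).mono_ac
    (Measure.restrict_le_self (s := {ω | T ω < ⊤})).absolutelyContinuous
  refine h.congr ?_
  have hmem : ∀ᵐ ω ∂((Z.law μ).restrict {ω | T ω < ⊤}), T ω < ⊤ :=
    ae_restrict_mem₀ (Z.nullMeasurableSet_lt_top hT μ)
  filter_upwards [hmem] with ω hω
  simp only [eq_iff_iff]
  exact ⟨fun h => h.2, fun h => ⟨hω, h⟩⟩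

/-- The distribution of `X_T` on `{T < ∞}`. -/
def stoppedLaw (Z : HuntProcess 𝒳 Ω) (T : Ω → WithTop ℝ≥0) (μ : Measure (OnePoint 𝒳)) :
    Measure (OnePoint 𝒳) :=
  ((Z.law μ).restrict {ω | T ω < ⊤}).map (stoppedValue Z.X T)

theorem isFiniteMeasure_stoppedLaw (Z : HuntProcess 𝒳 Ω) (T : Ω → WithTop ℝ≥0)
    (μ : Measure (OnePoint 𝒳)) [IsProbabilityMeasure μ] : IsFiniteMeasure (Z.stoppedLaw T μ) := by
  have := Z.isProbabilityMeasure_law μ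
  unfold stoppedLaw
  infer_instance

theorem stoppedLaw_apply (Z : HuntProcess 𝒳 Ω) {T : Ω → WithTop ℝ≥0}
    (hT : IsStoppingTime Z.augmentedFiltration T) (μ : Measure (OnePoint 𝒳))
    [IsProbabilityMeasure μ] {A : Set (OnePoint 𝒳)} (hA : MeasurableSet A) :
    Z.stoppedLaw T μ A = Z.law μ {ω | T ω < ⊤ ∧ stoppedValue Z.X T ω ∈ A} := by
  rw [stoppedLaw, Measure.map_apply_of_aemeasurable (Z.aemeasurable_stoppedValue hT μ) hA,
    Measure.restrict_apply₀' (Z.nullMeasurableSet_lt_top hT μ)]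
  congr 1
  ext ω
  exact and_comm

theorem law_stoppedLaw_apply (Z : HuntProcess 𝒳 Ω) {T : Ω → WithTop ℝ≥0}
    (hT : IsStoppingTime Z.augmentedFiltration T) (μ : Measure (OnePoint 𝒳))
    [IsProbabilityMeasure μ] {Γ : Set Ω} (hΓ : MeasurableSet Γ) :
    Z.law (Z.stoppedLaw T μ) Γ = Z.law μ {ω | T ω < ⊤ ∧ Z.shift (T ω).untopA ω ∈ Γ} := by
  have h1 := Z.strongMarkov μ T hT univ Γ MeasurableSet.univ hΓ
  simp only [univ_inter] at h1
  rw [h1, CadlagFamily.law, Measure.bind_apply hΓ Z.P.aemeasurable, stoppedLaw,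
    lintegral_map' (Z.P.measurable_coe hΓ).aemeasurable (Z.aemeasurable_stoppedValue hT μ)]

theorem nullMeasurable_shift_restrict (Z : HuntProcess 𝒳 Ω) {T : Ω → WithTop ℝ≥0}
    (hT : IsStoppingTime Z.augmentedFiltration T) (μ : Measure (OnePoint 𝒳))
    [IsProbabilityMeasure μ] :
    NullMeasurable (fun ω => Z.shift (T ω).untopA ω) ((Z.law μ).restrict {ω | T ω < ⊤}) := by
  intro Γ hΓ
  have h := (Z.nullMeasurableSet_shift hT μ hΓ).mono_ac
    (Measure.restrict_le_self (s := {ω | T ω < ⊤})).absolutelyContinuous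
  refine h.congr ?_
  have hmem : ∀ᵐ ω ∂((Z.law μ).restrict {ω | T ω < ⊤}), T ω < ⊤ :=
    ae_restrict_mem₀ (Z.nullMeasurableSet_lt_top hT μ)
  filter_upwards [hmem] with ω hω
  simp only [eq_iff_iff]
  exact ⟨fun h => h.2, fun h => ⟨hω, h⟩⟩

theorem lintegral_shift_of_measurable (Z : HuntProcess 𝒳 Ω) {T : Ω → WithTop ℝ≥0}
    (hT : IsStoppingTime Z.augmentedFiltration T) (μ : Measure (OnePoint 𝒳))
    [IsProbabilityMeasure μ] {F : Ω → ℝ≥0∞} (hF : Measurable F) :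
    ∫⁻ ω in {ω | T ω < ⊤}, F (Z.shift (T ω).untopA ω) ∂(Z.law μ) =
      ∫⁻ ω, F ω ∂(Z.law (Z.stoppedLaw T μ)) := by
  have hnull := Z.nullMeasurable_shift_restrict hT μ
  have hcomp : ∀ G : Ω → ℝ≥0∞, Measurable G →
      AEMeasurable (fun ω => G (Z.shift (T ω).untopA ω)) ((Z.law μ).restrict {ω | T ω < ⊤}) :=
    fun G hG => NullMeasurable.aemeasurable fun A hA => hnull (hG hA)
  refine Measurable.ennreal_induction
    (motive := fun F => ∫⁻ ω in {ω | T ω < ⊤}, F (Z.shift (T ω).untopA ω) ∂(Z.law μ) =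
      ∫⁻ ω, F ω ∂(Z.law (Z.stoppedLaw T μ))) ?_ ?_ ?_ hF
  · intro c Γ hΓ
    rw [lintegral_indicator_const hΓ, Z.law_stoppedLaw_apply hT μ hΓ]
    have : (fun ω => Γ.indicator (fun _ => c) (Z.shift (T ω).untopA ω)) =
        ({ω | Z.shift (T ω).untopA ω ∈ Γ}).indicator fun _ => c := by
      ext ω; rfl
    have hn : NullMeasurableSet {ω | Z.shift (T ω).untopA ω ∈ Γ}
      ((Z.law μ).restrict {ω | T ω < ⊤}) := hnull hΓ
    rw [this, lintegral_indicator_const₀ hn,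
      Measure.restrict_apply₀' (Z.nullMeasurableSet_lt_top hT μ)]
    congr 2
    ext ω
    exact and_comm
  · intro f g _ hf hg ihf ihg
    simp only [Pi.add_apply]
    rw [lintegral_add_left' (hcomp f hf), lintegral_add_left hf, ihf, ihg]
  · intro f hf hmono ih
    rw [lintegral_iSup' (fun n => hcomp _ (hf n)) (Eventually.of_forall fun ω m n h => hmono h _),
      lintegral_iSup hf hmono]
    exact iSup_congr ih

/-- The strong Markov property for functionals measurable up to null sets. -/
theorem lintegral_shift (Z : HuntProcess 𝒳 Ω) {T : Ω → WithTop ℝ≥0}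
    (hT : IsStoppingTime Z.augmentedFiltration T) (μ : Measure (OnePoint 𝒳))
    [IsProbabilityMeasure μ] {F : Ω → ℝ≥0∞} (hF : AEMeasurable F (Z.law (Z.stoppedLaw T μ))) :
    ∫⁻ ω in {ω | T ω < ⊤}, F (Z.shift (T ω).untopA ω) ∂(Z.law μ) =
      ∫⁻ y, ∫⁻ ω, F ω ∂(Z.P y) ∂(Z.stoppedLaw T μ) := by
  rw [← Measure.lintegral_bind Z.P.aemeasurable hF]
  change _ = ∫⁻ ω, F ω ∂(Z.law (Z.stoppedLaw T μ))
  rw [lintegral_congr_ae hF.ae_eq_mk, ← Z.lintegral_shift_of_measurable hT μ hF.measurable_mk]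
  refine lintegral_congr_ae ?_
  -- A measurable null set containing the points where `F` differs from its measurable version; by
  -- the strong Markov property the path shifted by `T` almost surely avoids it.
  set N := toMeasurable (Z.law (Z.stoppedLaw T μ)) {ω | F ω ≠ hF.mk F ω}
  have hN : Z.law (Z.stoppedLaw T μ) N = 0 := by
    rw [measure_toMeasurable]; exact hF.ae_eq_mk
  rw [Z.law_stoppedLaw_apply hT μ (measurableSet_toMeasurable _ _)] at hN
  have hmem : ∀ᵐ ω ∂((Z.law μ).restrict {ω | T ω < ⊤}), T ω < ⊤ :=
    ae_restrict_mem₀ (Z.nullMeasurableSet_lt_top hT μ)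
  have hN' : ∀ᵐ ω ∂((Z.law μ).restrict {ω | T ω < ⊤}),
      ¬ (T ω < ⊤ ∧ Z.shift (T ω).untopA ω ∈ N) := by
    refine ae_restrict_of_ae ?_
    rw [ae_iff]; simpa using hN
  filter_upwards [hmem, hN'] with ω h1 h2
  by_contra hne
  exact h2 ⟨h1, subset_toMeasurable _ _ hne⟩

end HuntProcess

/-! ### Exit times, exit laws and the mean value property -/

namespace HuntProcess

variable {𝒳 Ω : Type*} [MeasurableSpace Ω] [MetricSpace 𝒳]

theorem mem_of_lt_exitTime (Z : HuntProcess 𝒳 Ω) {D : Set 𝒳} {t : ℝ≥0} {ω : Ω}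
    (h : (t : WithTop ℝ≥0) < Z.exitTime D ω) : Z.X t ω ∈ ((↑) : 𝒳 → OnePoint 𝒳) '' D :=
  not_not.1 (Z.notMem_of_lt_hit (A := (((↑) : 𝒳 → OnePoint 𝒳) '' D)ᶜ) h)

theorem exitTime_le (Z : HuntProcess 𝒳 Ω) {D : Set 𝒳} {t : ℝ≥0} {ω : Ω}
    (h : Z.X t ω ∉ ((↑) : 𝒳 → OnePoint 𝒳) '' D) : Z.exitTime D ω ≤ t :=
  Z.hit_le_of_mem (A := (((↑) : 𝒳 → OnePoint 𝒳) '' D)ᶜ) h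

theorem exitTime_mono (Z : HuntProcess 𝒳 Ω) {D E : Set 𝒳} (h : D ⊆ E) (ω : Ω) :
    Z.exitTime D ω ≤ Z.exitTime E ω :=
  Z.hit_anti (compl_subset_compl.2 (image_mono h)) ω

theorem notMem_of_exitTime_eq (Z : HuntProcess 𝒳 Ω) {D : Set 𝒳} (hD : IsOpen D) {t : ℝ≥0} {ω : Ω}
    (h : Z.exitTime D ω = t) : Z.X t ω ∉ ((↑) : 𝒳 → OnePoint 𝒳) '' D := by
  have hcl : IsClosed (((↑) : 𝒳 → OnePoint 𝒳) '' D)ᶜ :=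
    (OnePoint.isOpen_image_coe.2 hD).isClosed_compl
  have := Z.mem_closure_of_hit_eq (A := (((↑) : 𝒳 → OnePoint 𝒳) '' D)ᶜ) h
  rwa [hcl.closure_eq] at this

theorem exitTime_eq_add_shift (Z : HuntProcess 𝒳 Ω) {D : Set 𝒳} {t : ℝ≥0} {ω : Ω}
    (h : (t : WithTop ℝ≥0) ≤ Z.exitTime D ω) :
    Z.exitTime D ω = t + Z.exitTime D (Z.shift t ω) :=
  Z.hit_eq_add_hit_shift (A := (((↑) : 𝒳 → OnePoint 𝒳) '' D)ᶜ) h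

/-- The function `g(X_{τ_U}) 1_{τ_U < ∞}`. -/
def exitValue (Z : HuntProcess 𝒳 Ω) (U : Set 𝒳) (g : 𝒳 → ℝ≥0∞) : Ω → ℝ≥0∞ :=
  {ω | Z.exitTime U ω < ⊤}.indicator fun ω => (stoppedValue Z.X (Z.exitTime U) ω).elim 0 g

/-- The function `y ↦ 𝔼_y[g(X_{τ_U}); τ_U < ∞]`. -/
def exitMean (Z : HuntProcess 𝒳 Ω) (U : Set 𝒳) (g : 𝒳 → ℝ≥0∞) (y : OnePoint 𝒳) : ℝ≥0∞ :=
  ∫⁻ ω, Z.exitValue U g ω ∂(Z.P y)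

theorem exitValue_of_eq (Z : HuntProcess 𝒳 Ω) {U : Set 𝒳} {g : 𝒳 → ℝ≥0∞} {t : ℝ≥0} {ω : Ω}
    (h : Z.exitTime U ω = t) : Z.exitValue U g ω = (Z.X t ω).elim 0 g := by
  have hlt : ω ∈ {ω | Z.exitTime U ω < ⊤} := by
    change Z.exitTime U ω < ⊤
    rw [h]; exact WithTop.coe_lt_top t
  rw [exitValue, indicator_of_mem hlt, Z.stoppedValue_eq h]

theorem exitValue_of_eq_top (Z : HuntProcess 𝒳 Ω) {U : Set 𝒳} {g : 𝒳 → ℝ≥0∞} {ω : Ω}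
    (h : Z.exitTime U ω = ⊤) : Z.exitValue U g ω = 0 :=
  indicator_of_notMem (by simp [h]) _

theorem exitValue_mono (Z : HuntProcess 𝒳 Ω) (U : Set 𝒳) {g g' : 𝒳 → ℝ≥0∞} (h : g ≤ g') (ω : Ω) :
    Z.exitValue U g ω ≤ Z.exitValue U g' ω := by
  cases ht : Z.exitTime U ω with
  | top => rw [Z.exitValue_of_eq_top ht]; exact zero_le
  | coe t =>
    rw [Z.exitValue_of_eq ht, Z.exitValue_of_eq ht]
    induction Z.X t ω using OnePoint.rec with
    | infty => exact le_rfl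
    | coe y => exact h y

theorem exitMean_mono (Z : HuntProcess 𝒳 Ω) (U : Set 𝒳) {g g' : 𝒳 → ℝ≥0∞} (h : g ≤ g')
    (y : OnePoint 𝒳) : Z.exitMean U g y ≤ Z.exitMean U g' y :=
  lintegral_mono (Z.exitValue_mono U h)

/-- Since `V ⊆ U`, the exit from `U` happens no earlier than that from `V`, so it can be read off
from the path shifted by the exit time of `V`. -/
theorem exitValue_shift (Z : HuntProcess 𝒳 Ω) {U V : Set 𝒳} (h : V ⊆ U) (g : 𝒳 → ℝ≥0∞) :
    Z.exitValue U g = {ω | Z.exitTime V ω < ⊤}.indicator fun ω =>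
      Z.exitValue U g (Z.shift (Z.exitTime V ω).untopA ω) := by
  ext ω
  have hle := Z.exitTime_mono h ω
  cases ht : Z.exitTime V ω with
  | top =>
    rw [ht, top_le_iff] at hle
    rw [Z.exitValue_of_eq_top hle, indicator_of_notMem (by simp [ht])]
  | coe t =>
    have hlt : ω ∈ {ω | Z.exitTime V ω < ⊤} := by
      change Z.exitTime V ω < ⊤
      rw [ht]; exact WithTop.coe_lt_top t
    rw [ht] at hle
    have hadd := Z.exitTime_eq_add_shift hle
    rw [indicator_of_mem hlt, ht]
    change _ = Z.exitValue U g (Z.shift t ω)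
    cases hs : Z.exitTime U (Z.shift t ω) with
    | top =>
      rw [hs, WithTop.add_top] at hadd
      rw [Z.exitValue_of_eq_top hadd, Z.exitValue_of_eq_top hs]
    | coe s =>
      rw [hs, ← WithTop.coe_add] at hadd
      rw [Z.exitValue_of_eq hadd, Z.exitValue_of_eq hs, Z.X_shift]

theorem isProbabilityMeasure_P (Z : HuntProcess 𝒳 Ω) (y : OnePoint 𝒳) :
    IsProbabilityMeasure (Z.P y) := Z.isMarkovKernel.isProbabilityMeasure y

theorem exitMean_of_notMem (Z : HuntProcess 𝒳 Ω) {U : Set 𝒳} (g : 𝒳 → ℝ≥0∞) {y : OnePoint 𝒳}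
    (hy : y ∉ ((↑) : 𝒳 → OnePoint 𝒳) '' U) : Z.exitMean U g y = y.elim 0 g := by
  have := Z.isProbabilityMeasure_P y
  have : ∀ᵐ ω ∂(Z.P y), Z.exitValue U g ω = y.elim 0 g := by
    filter_upwards [Z.X_zero y] with ω hω
    have h0 : Z.exitTime U ω ≤ (0 : ℝ≥0) := Z.exitTime_le (by rwa [hω])
    have h1 : Z.exitTime U ω = (0 : ℝ≥0) := le_antisymm h0 bot_le
    rw [Z.exitValue_of_eq h1, hω]
  rw [exitMean, lintegral_congr_ae this, lintegral_const, measure_univ, mul_one]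

variable [LocallyCompactSpace 𝒳] [SecondCountableTopology 𝒳]

/-- The distribution of `X_{τ_V}` on `{τ_V < ∞}` under `ℙ_x`. -/
def exitLaw (Z : HuntProcess 𝒳 Ω) (V : Set 𝒳) (x : OnePoint 𝒳) : Measure (OnePoint 𝒳) :=
  Z.stoppedLaw (Z.exitTime V) (Measure.dirac x)

theorem exitLaw_apply (Z : HuntProcess 𝒳 Ω) {V : Set 𝒳} (hV : IsOpen V) (x : OnePoint 𝒳)
    {A : Set (OnePoint 𝒳)} (hA : MeasurableSet A) :
    Z.exitLaw V x A =
      Z.P x {ω | Z.exitTime V ω < ⊤ ∧ stoppedValue Z.X (Z.exitTime V) ω ∈ A} := by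
  rw [exitLaw, Z.stoppedLaw_apply (Z.isStoppingTime_exitTime hV) _ hA, Z.law_dirac]

theorem exitLaw_univ_le (Z : HuntProcess 𝒳 Ω) {V : Set 𝒳} (hV : IsOpen V) (x : OnePoint 𝒳) :
    Z.exitLaw V x univ ≤ 1 := by
  have := Z.isProbabilityMeasure_P x
  rw [Z.exitLaw_apply hV x MeasurableSet.univ]
  exact prob_le_one

variable [MeasurableSpace 𝒳] [BorelSpace 𝒳]

theorem aemeasurable_exitValue (Z : HuntProcess 𝒳 Ω) {U : Set 𝒳} (hU : IsOpen U) {g : 𝒳 → ℝ≥0∞}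
    (hg : ∀ ν : Measure 𝒳, IsFiniteMeasure ν → AEMeasurable g ν) (μ : Measure (OnePoint 𝒳))
    [IsFiniteMeasure μ] : AEMeasurable (Z.exitValue U g) (Z.law μ) := by
  refine Z.aemeasurable_law_of_isProbabilityMeasure (fun μ _ => ?_) μ
  have hT := Z.isStoppingTime_exitTime hU
  refine (aemeasurable_indicator_iff₀ (Z.nullMeasurableSet_lt_top hT μ)).2 ?_
  have := Z.isFiniteMeasure_stoppedLaw (Z.exitTime U) μ
  exact (OnePoint.aemeasurable_elim hg (Z.stoppedLaw (Z.exitTime U) μ)).comp_aemeasurable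
    (Z.aemeasurable_stoppedValue hT μ)

/-- The mean value property of `y ↦ 𝔼_y[g(X_{τ_U}); τ_U < ∞]` on open subsets of `U`. -/
theorem exitMean_eq_lintegral_exitLaw (Z : HuntProcess 𝒳 Ω) {U V : Set 𝒳} (hU : IsOpen U)
    (hV : IsOpen V) (hVU : V ⊆ U) {g : 𝒳 → ℝ≥0∞}
    (hg : ∀ ν : Measure 𝒳, IsFiniteMeasure ν → AEMeasurable g ν) (x : OnePoint 𝒳) :
    Z.exitMean U g x = ∫⁻ y, Z.exitMean U g y ∂(Z.exitLaw V x) := by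
  have hT := Z.isStoppingTime_exitTime hV
  have := Z.isFiniteMeasure_stoppedLaw (Z.exitTime V) (Measure.dirac x)
  have hnull := Z.nullMeasurableSet_lt_top hT (Measure.dirac x)
  have hSM := Z.lintegral_shift hT (Measure.dirac x)
    (Z.aemeasurable_exitValue hU hg (Z.stoppedLaw (Z.exitTime V) (Measure.dirac x)))
  rw [exitLaw]
  unfold exitMean
  rw [← hSM, ← lintegral_indicator₀ hnull, ← Z.exitValue_shift hVU, Z.law_dirac]

theorem exitMean_le_of_le (Z : HuntProcess 𝒳 Ω) (U : Set 𝒳) {g : 𝒳 → ℝ≥0∞} {M : ℝ≥0∞}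
    (h : ∀ y, g y ≤ M) (y : OnePoint 𝒳) : Z.exitMean U g y ≤ M := by
  have := Z.isProbabilityMeasure_P y
  calc Z.exitMean U g y ≤ ∫⁻ _, M ∂(Z.P y) := by
        refine lintegral_mono fun ω => ?_
        cases ht : Z.exitTime U ω with
        | top => rw [Z.exitValue_of_eq_top ht]; exact zero_le
        | coe t =>
          rw [Z.exitValue_of_eq ht]
          induction Z.X t ω using OnePoint.rec with
          | infty => exact zero_le
          | coe y => exact h y
    _ = M := by simp

/-- Monotone convergence. The Carleson estimate is proved for bounded data and passes to the limit
through this identity. -/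
theorem exitMean_eq_iSup_min (Z : HuntProcess 𝒳 Ω) {U : Set 𝒳} (hU : IsOpen U) {g : 𝒳 → ℝ≥0∞}
    (hg : ∀ ν : Measure 𝒳, IsFiniteMeasure ν → AEMeasurable g ν) (hfin : ∀ y, g y ≠ ∞)
    (y : OnePoint 𝒳) :
    Z.exitMean U g y = ⨆ n : ℕ, Z.exitMean U (fun z => min (g z) n) y := by
  unfold exitMean
  have hmono : ∀ ω, Monotone fun n : ℕ => Z.exitValue U (fun z => min (g z) n) ω :=
    fun ω m n hmn => Z.exitValue_mono U (fun z => by dsimp only; gcongr) ω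
  rw [← lintegral_iSup' (fun n => ?_) (Eventually.of_forall hmono)]
  · refine lintegral_congr fun ω => ?_
    cases ht : Z.exitTime U ω with
    | top => simp [Z.exitValue_of_eq_top ht]
    | coe t =>
      simp only [Z.exitValue_of_eq ht]
      induction Z.X t ω using OnePoint.rec with
      | infty => simp
      | coe z =>
        simp only [OnePoint.elim_some]
        refine le_antisymm ?_ (iSup_le fun n => min_le_left _ _)
        obtain ⟨n, hn⟩ := ENNReal.exists_nat_gt (hfin z)
        exact le_iSup_of_le n (le_min le_rfl hn.le)
  · have hg' : ∀ ν : Measure 𝒳, IsFiniteMeasure ν → AEMeasurable (fun z => min (g z) n) ν :=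
      fun ν hν => (hg ν hν).min aemeasurable_const
    have := Z.aemeasurable_exitValue hU hg' (Measure.dirac y)
    rwa [Z.law_dirac] at this

/-- Valid at every point and not only in `U`: outside `U` the exit time is almost surely zero. -/
theorem IsRegularHarmonic.ofReal_eq_exitMean {Z : HuntProcess 𝒳 Ω} {U : Set 𝒳}
    {h : 𝒳 → ℝ} (hh : Z.IsRegularHarmonic h U) (hU : IsOpen U) (hpos : ∀ x, 0 ≤ h x) (x : 𝒳) :
    ENNReal.ofReal (h x) = Z.exitMean U (fun y => ENNReal.ofReal (h y)) x := by
  by_cases hx : x ∈ U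
  · have hnull := Z.nullMeasurableSet_lt_top (Z.isStoppingTime_exitTime hU) (Measure.dirac ↑x)
    rw [Z.law_dirac] at hnull
    have hnn : ∀ y : OnePoint 𝒳, 0 ≤ y.elim 0 h := by
      intro y
      induction y using OnePoint.rec with
      | infty => exact le_rfl
      | coe y => exact hpos y
    rw [hh.mean_value x hx, ofReal_integral_eq_lintegral_ofReal (hh.integrable x hx)
      (Eventually.of_forall fun ω => hnn _), exitMean]
    unfold exitValue
    rw [lintegral_indicator₀ hnull]
    refine lintegral_congr fun ω => ?_
    induction stoppedValue Z.X (Z.exitTime U) ω using OnePoint.rec with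
    | infty => simp
    | coe y => rfl
  · rw [Z.exitMean_of_notMem _ (by simpa using hx)]
    rfl

end HuntProcess

/-! ### Mean exit times and the Lévy system at the exit time -/

namespace HuntProcess

variable {𝒳 Ω : Type*} [MeasurableSpace Ω] [MetricSpace 𝒳]

/-- The mean exit time `𝔼_x τ_V`. -/
def meanExit (Z : HuntProcess 𝒳 Ω) (V : Set 𝒳) (x : OnePoint 𝒳) : ℝ≥0∞ :=
  ∫⁻ ω, volume {s : ℝ | 0 ≤ s ∧ (s.toNNReal : WithTop ℝ≥0) ≤ Z.exitTime V ω} ∂(Z.P x)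

theorem meanExit_mono (Z : HuntProcess 𝒳 Ω) {V W : Set 𝒳} (h : V ⊆ W) (x : OnePoint 𝒳) :
    Z.meanExit V x ≤ Z.meanExit W x :=
  lintegral_mono fun ω => measure_mono fun _ hs => ⟨hs.1, hs.2.trans (Z.exitTime_mono h ω)⟩

theorem measurableSet_setOf_toNNReal_le (T : WithTop ℝ≥0) :
    MeasurableSet {s : ℝ | 0 ≤ s ∧ (s.toNNReal : WithTop ℝ≥0) ≤ T} := by
  cases T with
  | top =>
    have : {s : ℝ | 0 ≤ s ∧ (s.toNNReal : WithTop ℝ≥0) ≤ ⊤} = Ici 0 := by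
      ext s
      exact ⟨fun h => h.1, fun h => ⟨h, le_top⟩⟩
    rw [this]
    exact measurableSet_Ici
  | coe t =>
    have : {s : ℝ | 0 ≤ s ∧ (s.toNNReal : WithTop ℝ≥0) ≤ t} = Icc 0 (t : ℝ) := by
      ext s
      simp only [mem_ofPred_eq, mem_Icc, WithTop.coe_le_coe, Real.toNNReal_le_iff_le_coe]
    rw [this]
    exact measurableSet_Icc

theorem ae_mem_of_mem_lifetime (Z : HuntProcess 𝒳 Ω) (V : Set 𝒳) (ω : Ω) :
    ∀ᵐ s : ℝ ∂(volume.restrict {s : ℝ | 0 ≤ s ∧ (s.toNNReal : WithTop ℝ≥0) ≤ Z.exitTime V ω}),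
      Z.X s.toNNReal ω ∈ ((↑) : 𝒳 → OnePoint 𝒳) '' V := by
  rw [ae_restrict_iff' (measurableSet_setOf_toNNReal_le _)]
  -- At the exit time itself the path is outside an open `V`; that one time is discarded as a null
  -- set. When the exit time is infinite, `untopA` is a default value and discarding it costs
  -- nothing.
  have : ∀ᵐ s : ℝ, s ≠ ((Z.exitTime V ω).untopA : ℝ≥0) := by
    rw [ae_iff]
    simp
  filter_upwards [this] with s hs hmem
  refine Z.mem_of_lt_exitTime (lt_of_le_of_ne hmem.2 fun heq => hs ?_)
  rw [← heq]
  change s = ((s.toNNReal : ℝ≥0) : ℝ)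
  rw [Real.coe_toNNReal s hmem.1]

variable [LocallyCompactSpace 𝒳] [SecondCountableTopology 𝒳]

theorem mul_measure_le_meanExit (Z : HuntProcess 𝒳 Ω) {V : Set 𝒳} (hV : IsOpen V)
    (x : OnePoint 𝒳) (t : ℝ≥0) :
    (t : ℝ≥0∞) * Z.P x {ω | (t : WithTop ℝ≥0) ≤ Z.exitTime V ω} ≤ Z.meanExit V x := by
  have hT := Z.isStoppingTime_exitTime hV
  have hnull : NullMeasurableSet {ω | (t : WithTop ℝ≥0) ≤ Z.exitTime V ω} (Z.P x) := by
    have h1 := Z.nullMeasurableSet_of_augmentedFiltration (hT.measurableSet_lt t) (Measure.dirac x)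
    rw [Z.law_dirac] at h1
    convert h1.compl using 1
    ext ω
    exact (not_lt (a := Z.exitTime V ω) (b := (t : WithTop ℝ≥0))).symm
  rw [← lintegral_indicator_const₀ hnull]
  refine lintegral_mono fun ω => ?_
  by_cases h : (t : WithTop ℝ≥0) ≤ Z.exitTime V ω
  · rw [indicator_of_mem (show ω ∈ {ω | (t : WithTop ℝ≥0) ≤ Z.exitTime V ω} from h)]
    calc (t : ℝ≥0∞) = volume (Icc (0 : ℝ) t) := by simp
      _ ≤ _ := by
        refine measure_mono fun s hs => ⟨hs.1, le_trans ?_ h⟩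
        exact_mod_cast Real.toNNReal_le_iff_le_coe.2 hs.2
  · rw [indicator_of_notMem (show ω ∉ {ω | (t : WithTop ℝ≥0) ≤ Z.exitTime V ω} from h)]
    exact zero_le

variable [MeasurableSpace 𝒳] [BorelSpace 𝒳]

/-- Up to the exit time of `V`, the only jump from `F` into `A` can occur at that time, because the
path is in `V ⊆ F` before it. So the sum in the Lévy system formula is the indicator of exiting into
`A`. -/
theorem exitLaw_image_eq (Z : HuntProcess 𝒳 Ω) {J : Kernel 𝒳 𝒳} (hJ : Z.IsLevySystem J)
    {V F A : Set 𝒳} (hV : IsOpen V) (hF : IsClosed F) (hVF : V ⊆ F) (hA : MeasurableSet A)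
    (hFA : Disjoint F A) {x : 𝒳} (hx : x ∈ V) :
    Z.exitLaw V x (((↑) : 𝒳 → OnePoint 𝒳) '' A) =
      ∫⁻ ω, (∫⁻ s in {s : ℝ | 0 ≤ s ∧ (s.toNNReal : WithTop ℝ≥0) ≤ Z.exitTime V ω},
        (Z.X s.toNNReal ω).elim 0 (F.indicator fun a => J a A)) ∂(Z.P x) := by
  have hT := Z.isStoppingTime_exitTime hV
  -- The starting point of the jump is tested against the closed set `F` rather than `V`: the left
  -- limit at the exit time may lie on the boundary of `V`.
  let f : ℝ≥0 → 𝒳 → 𝒳 → ℝ≥0∞ := fun _ a b => F.indicator 1 a * A.indicator 1 b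
  have hfm : Measurable (fun p : ℝ≥0 × 𝒳 × 𝒳 => f p.1 p.2.1 p.2.2) := by
    refine Measurable.mul ?_ ?_
    · exact (measurable_one.indicator hF.measurableSet).comp (measurable_fst.comp measurable_snd)
    · exact (measurable_one.indicator hA).comp (measurable_snd.comp measurable_snd)
  have hdiag : ∀ s a, f s a a = 0 := by
    intro s a
    by_cases ha : a ∈ F
    · simp [f, disjoint_left.1 hFA ha]
    · simp [f, ha]
  have hformula := hJ.formula f hfm hdiag (Z.exitTime V) hT x
  have hA' : MeasurableSet (((↑) : 𝒳 → OnePoint 𝒳) '' A) :=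
    OnePoint.measurableEmbedding_coe.measurableSet_image.2 hA
  have hright : ∀ ω (s : ℝ),
      (Z.X s.toNNReal ω).elim 0 (fun a => ∫⁻ y, f s.toNNReal a y ∂(J a)) =
        (Z.X s.toNNReal ω).elim 0 (F.indicator fun a => J a A) := by
    intro ω s
    congr 1
    ext a
    by_cases ha : a ∈ F
    · simp [f, ha, lintegral_indicator_one hA]
    · simp [f, ha]
  simp only [hright] at hformula
  rw [← hformula, Z.exitLaw_apply hV x hA']
  have hnull : NullMeasurableSet {ω | Z.exitTime V ω < ⊤ ∧
      stoppedValue Z.X (Z.exitTime V) ω ∈ ((↑) : 𝒳 → OnePoint 𝒳) '' A} (Z.P x) := by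
    have := Z.nullMeasurableSet_stoppedValue hT (Measure.dirac ↑x) hA'
    rwa [Z.law_dirac] at this
  rw [← lintegral_indicator_one₀ hnull]
  refine lintegral_congr_ae ?_
  have hleft := Z.ae_eq_infty_of_tendsto_infty (Measure.dirac ↑x)
  rw [Z.law_dirac] at hleft
  filter_upwards [hleft, Z.X_zero x] with ω hω h0
  have hbefore : ∀ s : ℝ≥0, (s : WithTop ℝ≥0) < Z.exitTime V ω →
      (Function.leftLim (fun u => Z.X u ω) s).elim 0
        (fun a => (Z.X s ω).elim 0 (fun b => f s a b)) = 0 := by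
    intro s hs
    obtain ⟨b, hb, hbX⟩ := Z.mem_of_lt_exitTime hs
    rw [← hbX]
    have hbA : b ∉ A := disjoint_left.1 hFA (hVF hb)
    induction Function.leftLim (fun u => Z.X u ω) s using OnePoint.rec with
    | infty => rfl
    | coe a => simp [f, hbA]
  cases ht : Z.exitTime V ω with
  | top =>
    rw [indicator_of_notMem (by simp [ht])]
    symm
    rw [ENNReal.tsum_eq_zero]
    rintro ⟨s, hs⟩
    exact hbefore s (by rw [ht]; exact WithTop.coe_lt_top s)
  | coe t =>
    rw [tsum_eq_single ⟨t, le_rfl⟩]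
    swap
    · rintro ⟨s, hs⟩ hne
      refine hbefore s ?_
      rw [ht]
      refine lt_of_le_of_ne hs fun h => hne ?_
      exact Subtype.ext (by exact_mod_cast h)
    have hXt := Z.notMem_of_exitTime_eq hV ht
    -- A positive exit time ensures that `leftLim` is a genuine limit along the path.
    have htpos : 0 < t := by
      rcases eq_or_ne t 0 with rfl | h
      · exact absurd ⟨x, hx, h0.symm⟩ hXt
      · exact pos_iff_ne_zero.2 h
    have hne : (𝓝[<] t).NeBot := nhdsLT_neBot_of_exists_lt ⟨0, htpos⟩
    obtain ⟨l, hl⟩ := Z.leftLimits ω t htpos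
    have hlim : Function.leftLim (fun u => Z.X u ω) t = l := leftLim_eq_of_tendsto hl
    dsimp only
    rw [hlim]
    by_cases hXA : Z.X t ω ∈ ((↑) : 𝒳 → OnePoint 𝒳) '' A
    · have hmem : ω ∈ {ω | Z.exitTime V ω < ⊤ ∧
          stoppedValue Z.X (Z.exitTime V) ω ∈ ((↑) : 𝒳 → OnePoint 𝒳) '' A} :=
        ⟨by rw [ht]; exact WithTop.coe_lt_top t, by rwa [Z.stoppedValue_eq ht]⟩
      rw [indicator_of_mem hmem]
      obtain ⟨b, hb, hbX⟩ := hXA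
      rw [← hbX]
      -- The left limit is a limit of points of `V`, hence in `F` unless it is the cemetery; the
      -- latter is excluded because a path tending to the cemetery almost surely dies there.
      induction l using OnePoint.rec with
      | infty =>
        have := hω t htpos hl
        rw [← hbX] at this
        exact absurd this (OnePoint.coe_ne_infty b)
      | coe a =>
        have haF : a ∈ F := by
          by_contra haF
          have hO : IsOpen (((↑) : 𝒳 → OnePoint 𝒳) '' Fᶜ) :=
            OnePoint.isOpen_image_coe.2 hF.isOpen_compl
          have h1 : ∀ᶠ s in 𝓝[<] t, Z.X s ω ∈ ((↑) : 𝒳 → OnePoint 𝒳) '' Fᶜ :=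
            hl.eventually (hO.mem_nhds ⟨a, haF, rfl⟩)
          obtain ⟨s, ⟨c, hc, hcX⟩, hst⟩ := (h1.and self_mem_nhdsWithin).exists
          obtain ⟨d, hd, hdX⟩ := Z.mem_of_lt_exitTime (D := V) (t := s) (ω := ω)
            (by rw [ht]; exact_mod_cast hst)
          rw [← hdX] at hcX
          rw [OnePoint.coe_eq_coe] at hcX
          exact hc (hcX ▸ hVF hd)
        simp [f, haF, hb]
    · have hnmem : ω ∉ {ω | Z.exitTime V ω < ⊤ ∧
          stoppedValue Z.X (Z.exitTime V) ω ∈ ((↑) : 𝒳 → OnePoint 𝒳) '' A} := by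
        rintro ⟨-, h⟩
        rw [Z.stoppedValue_eq ht] at h
        exact hXA h
      rw [indicator_of_notMem hnmem]
      induction l using OnePoint.rec with
      | infty => rfl
      | coe a =>
        generalize Z.X t ω = y at hXA
        induction y using OnePoint.rec with
        | infty => rfl
        | coe b =>
          have : b ∉ A := fun h => hXA ⟨b, h, rfl⟩
          simp [f, this]

theorem exitLaw_image_le (Z : HuntProcess 𝒳 Ω) {J : Kernel 𝒳 𝒳} (hJ : Z.IsLevySystem J)
    {V F A : Set 𝒳} (hV : IsOpen V) (hF : IsClosed F) (hVF : V ⊆ F) (hA : MeasurableSet A)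
    (hFA : Disjoint F A) {x : 𝒳} (hx : x ∈ V) {M : ℝ≥0∞} (hM : M ≠ ∞)
    (h : ∀ w ∈ V, J w A ≤ M) :
    Z.exitLaw V x (((↑) : 𝒳 → OnePoint 𝒳) '' A) ≤ M * Z.meanExit V x := by
  rw [Z.exitLaw_image_eq hJ hV hF hVF hA hFA hx, meanExit, ← lintegral_const_mul' _ _ hM]
  refine lintegral_mono fun ω => ?_
  rw [← setLIntegral_const]
  refine lintegral_mono_ae ?_
  filter_upwards [Z.ae_mem_of_mem_lifetime V ω] with s ⟨a, ha, has⟩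
  rw [← has, OnePoint.elim_some, indicator_of_mem (hVF ha)]
  exact h a ha

theorem le_exitLaw_image (Z : HuntProcess 𝒳 Ω) {J : Kernel 𝒳 𝒳} (hJ : Z.IsLevySystem J)
    {V F A : Set 𝒳} (hV : IsOpen V) (hF : IsClosed F) (hVF : V ⊆ F) (hA : MeasurableSet A)
    (hFA : Disjoint F A) {x : 𝒳} (hx : x ∈ V) {M : ℝ≥0∞}
    (h : ∀ w ∈ V, M ≤ J w A) :
    M * Z.meanExit V x ≤ Z.exitLaw V x (((↑) : 𝒳 → OnePoint 𝒳) '' A) := by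
  rw [Z.exitLaw_image_eq hJ hV hF hVF hA hFA hx, meanExit]
  refine (lintegral_const_mul_le _ _).trans (lintegral_mono fun ω => ?_)
  rw [← setLIntegral_const]
  refine lintegral_mono_ae ?_
  filter_upwards [Z.ae_mem_of_mem_lifetime V ω] with s ⟨a, ha, has⟩
  rw [← has, OnePoint.elim_some, indicator_of_mem (hVF ha)]
  exact h a ha

end HuntProcess

/-! ### The probability of leaving `D ∩ B(x, ρ)` without leaving `D` -/

namespace IsScaleFunction

variable {φ : ℝ → ℝ} {c β : ℝ}

theorem apply_pos (h : IsScaleFunction φ c β) {r : ℝ} (hr : 0 < r) : 0 < φ r := by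
  have := h.strictMono (mem_Ici.2 le_rfl) (mem_Ici.2 hr.le) hr
  rwa [h.zero] at this

theorem mono (h : IsScaleFunction φ c β) {r R : ℝ} (hr : 0 ≤ r) (hrR : r ≤ R) : φ r ≤ φ R :=
  h.strictMono.monotoneOn (mem_Ici.2 hr) (mem_Ici.2 (hr.trans hrR)) hrR

theorem inv_le (h : IsScaleFunction φ c β) {r R : ℝ} (hr : 0 < r) (hrR : r ≤ R) :
    1 / φ r ≤ c * (R / r) ^ β / φ R := by
  have h1 := h.growth r R hr hrR
  have h2 := h.apply_pos hr
  have h3 := h.apply_pos (hr.trans_le hrR)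
  rw [div_le_iff₀ h2] at h1
  rw [div_le_div_iff₀ h2 h3]
  linarith

theorem pos_const (h : IsScaleFunction φ c β) : 0 < c := zero_lt_one.trans_le h.one_le

end IsScaleFunction

namespace HuntProcess

variable {𝒳 Ω : Type*} [MeasurableSpace Ω] [MetricSpace 𝒳] [LocallyCompactSpace 𝒳]
  [SecondCountableTopology 𝒳]

/-- The probability of exiting a smaller set into `D` dominates that of exiting a larger one. -/
theorem exitLaw_image_anti (Z : HuntProcess 𝒳 Ω) {D V W : Set 𝒳} (hD : IsOpen D) (hV : IsOpen V)
    (hW : IsOpen W) (hVW : V ⊆ W) (hWV : ∀ y ∈ W, y ∉ V → y ∈ D) (x : OnePoint 𝒳) :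
    Z.exitLaw W x (((↑) : 𝒳 → OnePoint 𝒳) '' D) ≤
      Z.exitLaw V x (((↑) : 𝒳 → OnePoint 𝒳) '' D) := by
  have hD' := (OnePoint.isOpen_image_coe.2 hD).measurableSet
  rw [Z.exitLaw_apply hW x hD', Z.exitLaw_apply hV x hD']
  refine measure_mono ?_
  rintro ω ⟨h1, h2⟩
  have hle := Z.exitTime_mono hVW ω
  obtain ⟨t, ht⟩ := WithTop.ne_top_iff_exists.1 h1.ne
  obtain ⟨s, hs⟩ := WithTop.ne_top_iff_exists.1 (hle.trans_lt h1).ne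
  refine ⟨hle.trans_lt h1, ?_⟩
  rw [Z.stoppedValue_eq ht.symm] at h2
  rw [Z.stoppedValue_eq hs.symm]
  -- On leaving `V` the path is either still in `W`, hence in `D` by `hWV`, or it leaves both sets
  -- at once and lands at the same point of `D`.
  by_cases hsW : Z.X s ω ∈ ((↑) : 𝒳 → OnePoint 𝒳) '' W
  · obtain ⟨y, hy, hyX⟩ := hsW
    refine ⟨y, hWV y hy fun hyV => ?_, hyX⟩
    exact Z.notMem_of_exitTime_eq hV hs.symm ⟨y, hyV, hyX⟩
  · have h3 : Z.exitTime W ω ≤ s := Z.exitTime_le hsW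
    have h4 : t = s := by
      rw [← ht] at h3 hle
      rw [← hs] at hle
      exact le_antisymm (by exact_mod_cast h3) (by exact_mod_cast hle)
    rwa [h4] at h2

variable [MeasurableSpace 𝒳] [BorelSpace 𝒳]

/-- The event is covered by three others: lasting a time `t` (Markov's inequality), leaving the
smaller set by a jump of size at least `σ / 2` (Lévy system), or leaving it into `D` at distance
below `3σ/2` and then moving more than `σ / 4` within time `t` (strong Markov property and exit
probability bound). -/
theorem exitLaw_ball_step (Z : HuntProcess 𝒳 Ω) {J : Kernel 𝒳 𝒳} (hJ : Z.IsLevySystem J)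
    {φ : ℝ → ℝ} {rbar r₀ : ℝ≥0∞} {C₄ C₅ C₆ : ℝ} (hJt : JumpTail J φ rbar C₄ C₅)
    (hEP : Z.ExitProbabilityBound φ r₀ C₆) {D : Set 𝒳} (hD : IsOpen D) {x : 𝒳} (hx : x ∈ D)
    {σ : ℝ} (hσ : 0 < σ) (hσbar : ENNReal.ofReal σ < rbar) (hσ₀ : ENNReal.ofReal σ < r₀)
    {t : ℝ≥0} (ht : 0 < t) :
    Z.exitLaw (D ∩ Metric.ball x (2 * σ)) x (((↑) : 𝒳 → OnePoint 𝒳) '' D) ≤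
      ENNReal.ofReal (C₆ * t / φ (σ / 4)) *
          Z.exitLaw (D ∩ Metric.ball x σ) x (((↑) : 𝒳 → OnePoint 𝒳) '' D) +
        (ENNReal.ofReal (C₅ / φ (σ / 2)) + (t : ℝ≥0∞)⁻¹) *
          Z.meanExit (D ∩ Metric.ball x (2 * σ)) x := by
  set V₁ := D ∩ Metric.ball x σ with hV₁def
  set V₂ := D ∩ Metric.ball x (2 * σ) with hV₂def
  have hV₁ : IsOpen V₁ := hD.inter Metric.isOpen_ball
  have hV₂ : IsOpen V₂ := hD.inter Metric.isOpen_ball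
  have hxV₁ : x ∈ V₁ := ⟨hx, Metric.mem_ball_self hσ⟩
  have hV₁₂ : V₁ ⊆ V₂ := inter_subset_inter_right _ (Metric.ball_subset_ball (by linarith))
  have hT₁ := Z.isStoppingTime_exitTime hV₁
  have hD' : MeasurableSet (((↑) : 𝒳 → OnePoint 𝒳) '' D) :=
    (OnePoint.isOpen_image_coe.2 hD).measurableSet
  let B : Set 𝒳 := D ∩ Metric.ball x (3 / 2 * σ)
  let O : Set 𝒳 := (Metric.closedBall x (7 / 4 * σ))ᶜ
  have hB : IsOpen B := hD.inter Metric.isOpen_ball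
  have hO : IsOpen O := Metric.isClosed_closedBall.isOpen_compl
  -- The displacement event is written with a dense set of times and the open set `O`, so that it is
  -- generated by the process. Between the radii `3σ/2` and `7σ/4` lies a gap of `σ / 4`.
  let Γ : Set Ω := {ω | Z.X 0 ω ∈ ((↑) : 𝒳 → OnePoint 𝒳) '' B} ∩
    ⋃ n : ℕ, ⋃ _ : TopologicalSpace.denseSeq ℝ≥0 n < t,
      {ω | Z.X (TopologicalSpace.denseSeq ℝ≥0 n) ω ∈ ((↑) : 𝒳 → OnePoint 𝒳) '' O}
  have hΓ : MeasurableSet Γ := by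
    refine (Z.measurable_X 0 (OnePoint.isOpen_image_coe.2 hB).measurableSet).inter ?_
    exact MeasurableSet.iUnion fun n => MeasurableSet.iUnion fun _ =>
      Z.measurable_X _ (OnePoint.isOpen_image_coe.2 hO).measurableSet
  have hcover : {ω | Z.exitTime V₂ ω < ⊤ ∧
        stoppedValue Z.X (Z.exitTime V₂) ω ∈ ((↑) : 𝒳 → OnePoint 𝒳) '' D} ⊆
      {ω | Z.exitTime V₁ ω < ⊤ ∧ Z.shift (Z.exitTime V₁ ω).untopA ω ∈ Γ} ∪
      ({ω | Z.exitTime V₁ ω < ⊤ ∧ stoppedValue Z.X (Z.exitTime V₁) ω ∈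
          ((↑) : 𝒳 → OnePoint 𝒳) '' (Metric.ball x (3 / 2 * σ))ᶜ} ∪
        {ω | (t : WithTop ℝ≥0) ≤ Z.exitTime V₂ ω}) := by
    rintro ω ⟨h1, h2⟩
    by_cases htle : (t : WithTop ℝ≥0) ≤ Z.exitTime V₂ ω
    · exact Or.inr (Or.inr htle)
    rw [not_le] at htle
    have hle := Z.exitTime_mono hV₁₂ ω
    obtain ⟨b, hb⟩ := WithTop.ne_top_iff_exists.1 h1.ne
    obtain ⟨a, ha⟩ := WithTop.ne_top_iff_exists.1 (hle.trans_lt h1).ne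
    have hab : a ≤ b := by rw [← ha, ← hb] at hle; exact_mod_cast hle
    have hbt : b < t := by rw [← hb] at htle; exact_mod_cast htle
    rw [Z.stoppedValue_eq hb.symm] at h2
    obtain ⟨z, hz, hzX⟩ := h2
    have hzV₂ : z ∉ V₂ := fun h => Z.notMem_of_exitTime_eq hV₂ hb.symm ⟨z, h, hzX⟩
    have hzball : 2 * σ ≤ dist z x := by
      by_contra! h
      exact hzV₂ ⟨hz, h⟩
    have haD : Z.X a ω ∈ ((↑) : 𝒳 → OnePoint 𝒳) '' D := by
      rcases hab.eq_or_lt with rfl | hlt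
      · exact ⟨z, hz, hzX⟩
      · exact image_mono inter_subset_left
          (Z.mem_of_lt_exitTime (D := V₂) (by rw [← hb]; exact_mod_cast hlt))
    obtain ⟨y, hy, hyX⟩ := haD
    by_cases hyB : y ∈ Metric.ball x (3 / 2 * σ)
    swap
    · refine Or.inr (Or.inl ⟨hle.trans_lt h1, ?_⟩)
      rw [Z.stoppedValue_eq ha.symm]
      exact ⟨y, hyB, hyX⟩
    refine Or.inl ⟨hle.trans_lt h1, ?_⟩
    rw [← ha]
    change Z.shift a ω ∈ Γ
    refine ⟨?_, ?_⟩
    · change Z.X 0 (Z.shift a ω) ∈ ((↑) : 𝒳 → OnePoint 𝒳) '' B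
      rw [Z.X_shift, add_zero]
      exact ⟨y, ⟨hy, hyB⟩, hyX⟩
    · have hXz : Z.X (b - a) (Z.shift a ω) ∈ ((↑) : 𝒳 → OnePoint 𝒳) '' O := by
        rw [Z.X_shift, add_tsub_cancel_of_le hab]
        refine ⟨z, ?_, hzX⟩
        simp only [O, mem_compl_iff, Metric.mem_closedBall, not_le]
        linarith
      obtain ⟨n, hn, hnO⟩ := Z.exists_denseSeq_mem_of_isOpen (OnePoint.isOpen_image_coe.2 hO)
        (tsub_le_self.trans_lt hbt) hXz
      exact mem_iUnion₂.2 ⟨n, hn, hnO⟩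
  -- Keeping the indicator of `D` here produces the factor `exitLaw V₁`, which makes the estimate
  -- recursive in the radius.
  have hΓP : ∀ y : OnePoint 𝒳, Z.P y Γ ≤ (((↑) : 𝒳 → OnePoint 𝒳) '' D).indicator
      (fun _ => ENNReal.ofReal (C₆ * t / φ (σ / 4))) y := by
    intro y
    by_cases hy : y ∈ ((↑) : 𝒳 → OnePoint 𝒳) '' B
    · obtain ⟨y, hyB, rfl⟩ := hy
      rw [indicator_of_mem (mem_image_of_mem _ hyB.1)]
      refine le_trans ?_ (hEP.bound t y (σ / 4) ht (by linarith)
        ((ENNReal.ofReal_le_ofReal (by linarith)).trans_lt hσ₀))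
      refine measure_mono ?_
      rintro ω ⟨-, hω⟩
      obtain ⟨n, hn, z, hz, hzX⟩ := mem_iUnion₂.1 hω
      refine (Z.exitTime_le (t := TopologicalSpace.denseSeq ℝ≥0 n) ?_).trans_lt
        (by exact_mod_cast hn)
      rintro ⟨z', hz', hzX'⟩
      have hzz : z' = z := OnePoint.coe_injective (hzX'.trans hzX.symm)
      subst hzz
      have h1 : dist y x < 3 / 2 * σ := hyB.2
      have h2 : dist z' y < σ / 4 := hz'
      simp only [O, mem_compl_iff, Metric.mem_closedBall, not_le] at hz
      linarith [dist_triangle z' y x]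
    · have : Z.P y Γ = 0 := by
        refine measure_mono_null ?_ (Z.X_zero y)
        rintro ω ⟨hω, -⟩ heq
        change Z.X 0 ω ∈ ((↑) : 𝒳 → OnePoint 𝒳) '' B at hω
        rw [heq] at hω
        exact hy hω
      rw [this]
      exact zero_le
  have hE₃ : Z.P x {ω | Z.exitTime V₁ ω < ⊤ ∧ Z.shift (Z.exitTime V₁ ω).untopA ω ∈ Γ} ≤
      ENNReal.ofReal (C₆ * t / φ (σ / 4)) *
        Z.exitLaw V₁ x (((↑) : 𝒳 → OnePoint 𝒳) '' D) := by
    have h := Z.law_stoppedLaw_apply hT₁ (Measure.dirac ↑x) hΓ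
    rw [Z.law_dirac] at h
    rw [← h, CadlagFamily.law, Measure.bind_apply hΓ Z.P.aemeasurable,
      ← lintegral_indicator_const hD']
    exact lintegral_mono hΓP
  have hE₁ : Z.P x {ω | Z.exitTime V₁ ω < ⊤ ∧ stoppedValue Z.X (Z.exitTime V₁) ω ∈
      ((↑) : 𝒳 → OnePoint 𝒳) '' (Metric.ball x (3 / 2 * σ))ᶜ} ≤
      ENNReal.ofReal (C₅ / φ (σ / 2)) * Z.meanExit V₂ x := by
    have hA : MeasurableSet (Metric.ball x (3 / 2 * σ))ᶜ := measurableSet_ball.compl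
    rw [← Z.exitLaw_apply hV₁ x (OnePoint.measurableEmbedding_coe.measurableSet_image.2 hA)]
    refine (Z.exitLaw_image_le hJ hV₁ (Metric.isClosed_closedBall (x := x) (ε := σ))
      (fun y hy => (Metric.ball_subset_closedBall hy.2)) hA ?_ hxV₁ ENNReal.ofReal_ne_top
      fun w hw => ?_).trans (mul_le_mul_right (Z.meanExit_mono hV₁₂ x) _)
    · rw [disjoint_left]
      intro y hy hy'
      rw [Metric.mem_closedBall] at hy
      simp only [mem_compl_iff, Metric.mem_ball, not_lt] at hy'
      linarith
    · refine le_trans (measure_mono ?_) (hJt.upper w (σ / 2) (by linarith)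
        ((ENNReal.ofReal_le_ofReal (by linarith)).trans_lt hσbar))
      refine compl_subset_compl.2 fun z hz => ?_
      have h1 : dist z w < σ / 2 := hz
      have h2 : dist w x < σ := hw.2
      rw [Metric.mem_ball]
      linarith [dist_triangle z w x]
  have hE₂ : Z.P x {ω | (t : WithTop ℝ≥0) ≤ Z.exitTime V₂ ω} ≤
      (t : ℝ≥0∞)⁻¹ * Z.meanExit V₂ x := by
    have ht0 : (t : ℝ≥0∞) ≠ 0 := by exact_mod_cast ht.ne'
    rw [mul_comm, ← div_eq_mul_inv, ENNReal.le_div_iff_mul_le (Or.inl ht0)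
      (Or.inl ENNReal.coe_ne_top), mul_comm]
    exact Z.mul_measure_le_meanExit hV₂ x t
  rw [Z.exitLaw_apply hV₂ x hD', add_mul]
  exact (measure_mono hcover).trans ((measure_union_le _ _).trans
    (add_le_add hE₃ ((measure_union_le _ _).trans (add_le_add hE₁ hE₂))))

/-- The constant in the bound of the probability of exiting `D ∩ B(x, ρ)` into `D`. -/
def survivalConst (C₅ C₆ c β : ℝ) : ℝ :=
  2 * ((C₅ + C₆ / (2 ^ (-β) / 2)) * (c * 8 ^ β))

/-- `ℙ_x(X_{τ_{D ∩ B(x, ρ)}} ∈ D) ≤ C 𝔼_x τ_{D ∩ B(x, ρ)} / φ(ρ)`. -/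
theorem exitLaw_ball_le (Z : HuntProcess 𝒳 Ω) {J : Kernel 𝒳 𝒳} (hJ : Z.IsLevySystem J)
    {φ : ℝ → ℝ} {rbar r₀ : ℝ≥0∞} {C₄ C₅ C₆ c β : ℝ} (hφ : IsScaleFunction φ c β)
    (hJt : JumpTail J φ rbar C₄ C₅) (hEP : Z.ExitProbabilityBound φ r₀ C₆) {D : Set 𝒳}
    (hD : IsOpen D) {x : 𝒳} (hx : x ∈ D) {ρ : ℝ} (hρ : 0 < ρ) (hρbar : ENNReal.ofReal ρ < rbar)
    (hρ₀ : ENNReal.ofReal ρ < r₀) :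
    Z.exitLaw (D ∩ Metric.ball x ρ) x (((↑) : 𝒳 → OnePoint 𝒳) '' D) ≤
      ENNReal.ofReal (survivalConst C₅ C₆ c β / φ ρ) * Z.meanExit (D ∩ Metric.ball x ρ) x := by
  -- When the radius is halved, the error term grows by a factor `2 ^ β`. With this `ε` one has `ε *
  -- 2 ^ β = 1 / 2`, so the errors form a geometric series summing to twice the first term.
  set ε : ℝ := 2 ^ (-β) / 2 with hε
  set K : ℝ := (C₅ + C₆ / ε) * (c * 8 ^ β) with hK
  have hεpos : 0 < ε := by positivity
  have hε1 : ε < 1 := by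
    have : (2 : ℝ) ^ (-β) ≤ 1 := Real.rpow_le_one_of_one_le_of_nonpos one_le_two (by linarith [hφ.pos])
    linarith
  have hε2 : 2 * ε * 2 ^ β = 1 := by
    rw [hε, Real.rpow_neg (by norm_num)]
    have : (2 : ℝ) ^ β ≠ 0 := by positivity
    field_simp
  have hcpos := hφ.pos_const
  have hC₅ : 0 < C₅ := hJt.pos.trans_le hJt.le
  have hC₆ := hEP.pos
  have hφρ := hφ.apply_pos hρ
  have hKpos : 0 < K := by positivity
  set e := Z.meanExit (D ∩ Metric.ball x ρ) x with he
  set p : ℕ → ℝ≥0∞ := fun k =>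
    Z.exitLaw (D ∩ Metric.ball x (ρ / 2 ^ k)) x (((↑) : 𝒳 → OnePoint 𝒳) '' D) with hp
  have hstep : ∀ k, p k ≤ ENNReal.ofReal ε * p (k + 1) +
      ENNReal.ofReal (K * (2 ^ k) ^ β / φ ρ) * e := by
    intro k
    set σ : ℝ := ρ / 2 ^ (k + 1) with hσdef
    have hσ : 0 < σ := by positivity
    have h2σ : 2 * σ = ρ / 2 ^ k := by rw [hσdef, pow_succ]; field_simp
    have hσρ : 2 * σ ≤ ρ := by
      rw [h2σ]; exact div_le_self hρ.le (one_le_pow₀ one_le_two)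
    have hφσ : 0 < φ (σ / 4) := hφ.apply_pos (by positivity)
    -- The time horizon is chosen so that the exit probability bound `C₆ t / φ(σ / 4)` equals `ε`.
    have htpos : 0 < ε * φ (σ / 4) / C₆ := by positivity
    have := Z.exitLaw_ball_step hJ hJt hEP hD hx hσ
      ((ENNReal.ofReal_le_ofReal (by linarith)).trans_lt hρbar)
      ((ENNReal.ofReal_le_ofReal (by linarith)).trans_lt hρ₀)
      (t := (ε * φ (σ / 4) / C₆).toNNReal) (Real.toNNReal_pos.2 htpos)
    rw [h2σ, Real.coe_toNNReal _ htpos.le] at this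
    have h1 : C₆ * (ε * φ (σ / 4) / C₆) / φ (σ / 4) = ε := by field_simp
    rw [h1] at this
    refine this.trans (add_le_add le_rfl (mul_le_mul' ?_ (Z.meanExit_mono
      (inter_subset_inter_right _ (Metric.ball_subset_ball (h2σ ▸ hσρ))) x)))
    have h2 : ((ε * φ (σ / 4) / C₆).toNNReal : ℝ≥0∞)⁻¹ =
        ENNReal.ofReal (ε * φ (σ / 4) / C₆)⁻¹ := by
      rw [ENNReal.ofReal_inv_of_pos htpos]; rfl
    rw [h2, ← ENNReal.ofReal_add (div_nonneg hC₅.le (hφ.apply_pos (by positivity)).le)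
      (inv_nonneg.2 htpos.le)]
    refine ENNReal.ofReal_le_ofReal ?_
    have h3 : C₅ / φ (σ / 2) ≤ C₅ / φ (σ / 4) :=
      div_le_div_of_nonneg_left hC₅.le hφσ (hφ.mono (by positivity) (by linarith))
    have h4 : (ε * φ (σ / 4) / C₆)⁻¹ = C₆ / ε / φ (σ / 4) := by field_simp
    have h5 := hφ.inv_le (r := σ / 4) (R := ρ) (by positivity) (by linarith)
    have h6 : ρ / (σ / 4) = 8 * 2 ^ k := by rw [hσdef, pow_succ]; field_simp; ring
    rw [h6, Real.mul_rpow (by norm_num) (by positivity)] at h5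
    calc C₅ / φ (σ / 2) + (ε * φ (σ / 4) / C₆)⁻¹
        ≤ (C₅ + C₆ / ε) * (1 / φ (σ / 4)) := by
          rw [h4]
          calc _ ≤ C₅ / φ (σ / 4) + C₆ / ε / φ (σ / 4) := by linarith
            _ = _ := by ring
      _ ≤ (C₅ + C₆ / ε) * (c * (8 ^ β * (2 ^ k) ^ β) / φ ρ) := by gcongr
      _ = _ := by rw [hK]; ring
  -- `N` counts the iterations: the trivial bound `p ≤ 1` contributes `ε ^ N`, which disappears as
  -- `N` tends to infinity.
  have hind : ∀ N k, p k ≤ ENNReal.ofReal (ε ^ N) +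
      ENNReal.ofReal (2 * (K * (2 ^ k) ^ β / φ ρ)) * e := by
    intro N
    induction N with
    | zero =>
      intro k
      refine le_trans ?_ le_self_add
      rw [pow_zero, ENNReal.ofReal_one]
      exact (measure_mono (subset_univ _)).trans
        (Z.exitLaw_univ_le (hD.inter Metric.isOpen_ball) x)
    | succ N ih =>
      intro k
      refine (hstep k).trans ?_
      have hpow : ((2 : ℝ) ^ (k + 1)) ^ β = (2 ^ k) ^ β * 2 ^ β := by
        rw [pow_succ, Real.mul_rpow (by positivity) (by norm_num)]
      calc ENNReal.ofReal ε * p (k + 1) + ENNReal.ofReal (K * (2 ^ k) ^ β / φ ρ) * e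
          ≤ ENNReal.ofReal ε * (ENNReal.ofReal (ε ^ N) +
              ENNReal.ofReal (2 * (K * (2 ^ (k + 1)) ^ β / φ ρ)) * e) +
              ENNReal.ofReal (K * (2 ^ k) ^ β / φ ρ) * e := by gcongr; exact ih (k + 1)
        _ = ENNReal.ofReal (ε ^ (N + 1)) +
            (ENNReal.ofReal (ε * (2 * (K * (2 ^ (k + 1)) ^ β / φ ρ))) +
              ENNReal.ofReal (K * (2 ^ k) ^ β / φ ρ)) * e := by
          rw [mul_add, ← mul_assoc, ← ENNReal.ofReal_mul hεpos.le, ← ENNReal.ofReal_mul hεpos.le,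
            ← pow_succ', add_assoc, add_mul]
        _ = _ := by
          rw [← ENNReal.ofReal_add (by positivity) (by positivity)]
          congr 3
          rw [hpow]
          linear_combination (K * (2 ^ k) ^ β / φ ρ) * hε2
  have hlim : Tendsto (fun N : ℕ => ENNReal.ofReal (ε ^ N) +
      ENNReal.ofReal (2 * (K * (2 ^ 0) ^ β / φ ρ)) * e) atTop
      (𝓝 (0 + ENNReal.ofReal (2 * (K * (2 ^ 0) ^ β / φ ρ)) * e)) := by
    refine Tendsto.add ?_ tendsto_const_nhds
    have := ENNReal.tendsto_ofReal (tendsto_pow_atTop_nhds_zero_of_lt_one hεpos.le hε1)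
    rwa [ENNReal.ofReal_zero] at this
  have hfin := ge_of_tendsto' hlim fun N => hind N 0
  simp only [hp, pow_zero, div_one, zero_add, Real.one_rpow, mul_one] at hfin
  refine hfin.trans_eq ?_
  rw [survivalConst, ← hε, ← hK, ← mul_div_assoc]

end HuntProcess

/-! ### Comparison of jump kernels and of integrals against exit laws -/

theorem JumpComparable.apply_le {𝒳 : Type*} [MetricSpace 𝒳] [MeasurableSpace 𝒳] {J : Kernel 𝒳 𝒳}
    {rbar : ℝ≥0∞} {C₁ C₂ C₃ θ : ℝ} (h : JumpComparable J rbar C₁ C₂ C₃ θ) {x y : 𝒳}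
    (hxy : edist x y < rbar) {q : ℝ} (hq : 0 ≤ q) {B : Set 𝒳} (hB : MeasurableSet B)
    (hdist : ∀ z ∈ B, dist y z ≤ q * dist x z) :
    J x B ≤ ENNReal.ofReal (C₁ * (1 + q) ^ θ) * J y B := by
  refine (h.compare x y hxy B).trans ?_
  rw [withDensity_apply _ hB, ← setLIntegral_const]
  refine setLIntegral_mono' hB fun z hz => ENNReal.ofReal_le_ofReal ?_
  have h1 := h.C₁_pos
  have h2 := h.θ_pos
  have : dist y z / dist x z ≤ q := div_le_of_le_mul₀ dist_nonneg hq (hdist z hz)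
  gcongr

namespace OnePoint

variable {𝒳 : Type*} [TopologicalSpace 𝒳] [MeasurableSpace 𝒳] [BorelSpace 𝒳]

theorem restrict_image_le {E : Measure (OnePoint 𝒳)} {ν : Measure 𝒳} {A : Set 𝒳}
    (hA : MeasurableSet A)
    (h : ∀ B ⊆ A, MeasurableSet B → E (((↑) : 𝒳 → OnePoint 𝒳) '' B) ≤ ν B) :
    E.restrict (((↑) : 𝒳 → OnePoint 𝒳) '' A) ≤ (ν.restrict A).map ((↑) : 𝒳 → OnePoint 𝒳) := by
  rw [Measure.le_iff]
  intro S hS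
  have hS' := measurableEmbedding_coe.measurable hS
  rw [Measure.restrict_apply hS, measurableEmbedding_coe.map_apply, Measure.restrict_apply hS',
    inter_comm, ← image_inter_preimage, inter_comm]
  exact h _ inter_subset_right (hS'.inter hA)

theorem le_restrict_image {E : Measure (OnePoint 𝒳)} {ν : Measure 𝒳} {A : Set 𝒳}
    (hA : MeasurableSet A)
    (h : ∀ B ⊆ A, MeasurableSet B → ν B ≤ E (((↑) : 𝒳 → OnePoint 𝒳) '' B)) :
    (ν.restrict A).map ((↑) : 𝒳 → OnePoint 𝒳) ≤ E.restrict (((↑) : 𝒳 → OnePoint 𝒳) '' A) := by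
  rw [Measure.le_iff]
  intro S hS
  have hS' := measurableEmbedding_coe.measurable hS
  rw [Measure.restrict_apply hS, measurableEmbedding_coe.map_apply, Measure.restrict_apply hS',
    inter_comm S, ← image_inter_preimage, inter_comm A]
  exact h _ inter_subset_right (hS'.inter hA)

/-- Comparing the measures rather than approximating the integrand makes the bound valid for
arbitrary `u`, with no measurability. -/
theorem setLIntegral_image_le {E : Measure (OnePoint 𝒳)} {ν : Measure 𝒳} {A : Set 𝒳}
    (hA : MeasurableSet A) {K : ℝ≥0∞}
    (h : ∀ B ⊆ A, MeasurableSet B → E (((↑) : 𝒳 → OnePoint 𝒳) '' B) ≤ K * ν B)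
    (u : OnePoint 𝒳 → ℝ≥0∞) :
    ∫⁻ y in ((↑) : 𝒳 → OnePoint 𝒳) '' A, u y ∂E ≤ K * ∫⁻ z in A, u z ∂ν := by
  refine (lintegral_mono' (restrict_image_le (ν := K • ν) hA h) le_rfl).trans_eq ?_
  rw [measurableEmbedding_coe.lintegral_map, Measure.restrict_smul, lintegral_smul_measure]
  rfl

theorem le_setLIntegral_image {E : Measure (OnePoint 𝒳)} {ν : Measure 𝒳} {A : Set 𝒳}
    (hA : MeasurableSet A) {K : ℝ≥0∞}
    (h : ∀ B ⊆ A, MeasurableSet B → K * ν B ≤ E (((↑) : 𝒳 → OnePoint 𝒳) '' B))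
    (u : OnePoint 𝒳 → ℝ≥0∞) :
    K * ∫⁻ z in A, u z ∂ν ≤ ∫⁻ y in ((↑) : 𝒳 → OnePoint 𝒳) '' A, u y ∂E := by
  refine (Eq.le ?_).trans (lintegral_mono' (le_restrict_image (ν := K • ν) hA h) le_rfl)
  rw [measurableEmbedding_coe.lintegral_map, Measure.restrict_smul, lintegral_smul_measure]
  rfl

end OnePoint

theorem setLIntegral_le_mul_of_le {α : Type*} [MeasurableSpace α] {μ ν : Measure α} {A : Set α}
    (hA : MeasurableSet A) {K : ℝ≥0∞} (h : ∀ B ⊆ A, MeasurableSet B → μ B ≤ K * ν B)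
    (u : α → ℝ≥0∞) : ∫⁻ z in A, u z ∂μ ≤ K * ∫⁻ z in A, u z ∂ν := by
  have hle : μ.restrict A ≤ K • ν.restrict A := by
    rw [Measure.le_iff]
    intro S hS
    rw [Measure.restrict_apply hS, Measure.smul_apply, Measure.restrict_apply hS]
    exact h _ inter_subset_right (hS.inter hA)
  refine (lintegral_mono' hle le_rfl).trans_eq ?_
  rw [lintegral_smul_measure]
  rfl

/-! ### The mean value property over a small ball -/

namespace HuntProcess

variable {𝒳 Ω : Type*} [MeasurableSpace Ω] [MetricSpace 𝒳] [MeasurableSpace 𝒳]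

/-- A Hunt process whose Lévy system satisfies the jump and exit time estimates at scale `φ`. -/
structure JumpEstimates (Z : HuntProcess 𝒳 Ω) (J : Kernel 𝒳 𝒳) (φ : ℝ → ℝ)
    (rbar r₀ : ℝ≥0∞) (C₁ C₂ C₃ θ C₄ C₅ C₆ c β : ℝ) : Prop where
  levy : Z.IsLevySystem J
  scale : IsScaleFunction φ c β
  comparable : JumpComparable J rbar C₁ C₂ C₃ θ
  tail : JumpTail J φ rbar C₄ C₅
  exit : Z.ExitProbabilityBound φ r₀ C₆

namespace JumpEstimates

variable [LocallyCompactSpace 𝒳] [SecondCountableTopology 𝒳] [BorelSpace 𝒳]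
  {Z : HuntProcess 𝒳 Ω} {J : Kernel 𝒳 𝒳} {φ : ℝ → ℝ} {rbar r₀ : ℝ≥0∞}
  {C₁ C₂ C₃ θ C₄ C₅ C₆ c β : ℝ}

theorem survivalConst_pos (H : JumpEstimates Z J φ rbar r₀ C₁ C₂ C₃ θ C₄ C₅ C₆ c β) :
    0 < survivalConst C₅ C₆ c β := by
  have h1 := H.scale.pos_const
  have h2 : 0 < C₅ := H.tail.pos.trans_le H.tail.le
  have h3 := H.exit.pos
  unfold survivalConst
  positivity

theorem jump_ne_top (H : JumpEstimates Z J φ rbar r₀ C₁ C₂ C₃ θ C₄ C₅ C₆ c β) {x : 𝒳} {s : ℝ}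
    (hs : 0 < s) (hsbar : ENNReal.ofReal s < rbar) {B : Set 𝒳} (hB : B ⊆ (Metric.ball x s)ᶜ) :
    J x B ≠ ∞ :=
  ((measure_mono hB).trans_lt ((H.tail.upper x s hs hsbar).trans_lt ENNReal.ofReal_lt_top)).ne

/-- A function with the mean value property at `w` is controlled by its supremum over a
neighbourhood `N` of `w`, with a factor less than one, and by its jump integral outside `N`. -/
theorem exitMean_le_of_near (H : JumpEstimates Z J φ rbar r₀ C₁ C₂ C₃ θ C₄ C₅ C₆ c β)
    {D N : Set 𝒳} (hD : IsOpen D) (hN : MeasurableSet N) {w : 𝒳} (hw : w ∈ D) {s b : ℝ}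
    (hs : 0 < s) (hb : 0 < b) (hsbar : ENNReal.ofReal s < rbar) (hs₀ : ENNReal.ofReal s < r₀)
    (hwN : Metric.ball w (2 * s) ⊆ N) (hJN : ENNReal.ofReal (b / φ s) ≤ J w Nᶜ)
    {u : OnePoint 𝒳 → ℝ≥0∞} (hu : u w = ∫⁻ y, u y ∂(Z.exitLaw (D ∩ Metric.ball w s) w))
    (hu_infty : u OnePoint.infty = 0) (hu_zero : ∀ z ∈ N \ D, u z = 0) {M : ℝ≥0∞}
    (hM : ∀ z ∈ N ∩ D, u z ≤ M) :
    u w ≤ M * ENNReal.ofReal (1 / (1 + b / (C₁ * 3 ^ θ) / survivalConst C₅ C₆ c β)) +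
      ENNReal.ofReal ((C₁ * 3 ^ θ) ^ 2 / b * φ s) * ∫⁻ z in Nᶜ, u z ∂(J w) := by
  set S := survivalConst C₅ C₆ c β with hS
  set K := C₁ * 3 ^ θ with hK
  have hSpos : 0 < S := H.survivalConst_pos
  have hC₁ := H.comparable.C₁_pos
  have hKpos : 0 < K := by positivity
  have hφs := H.scale.apply_pos hs
  set V := D ∩ Metric.ball w s with hVdef
  have hV : IsOpen V := hD.inter Metric.isOpen_ball
  have hwV : w ∈ V := ⟨hw, Metric.mem_ball_self hs⟩
  set E := Z.exitLaw V w with hE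
  set e := Z.meanExit V w with he
  have hVF : V ⊆ Metric.closedBall w s := fun y hy => Metric.ball_subset_closedBall hy.2
  have hfar : ∀ z ∈ Nᶜ, 2 * s ≤ dist w z := by
    intro z hz
    by_contra! h
    exact hz (hwN (by rwa [Metric.mem_ball']))
  have hdisj : ∀ B ⊆ Nᶜ, Disjoint (Metric.closedBall w s) B := by
    intro B hB
    rw [disjoint_left]
    intro z hz hzB
    have := hfar z (hB hzB)
    rw [Metric.mem_closedBall'] at hz
    linarith
  have hedist : ∀ z ∈ V, edist z w < rbar := by
    intro z hz
    rw [edist_dist]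
    exact (ENNReal.ofReal_le_ofReal (le_of_lt hz.2)).trans_lt hsbar
  have h12 : (1 : ℝ) + 2 = 3 := by norm_num
  have hcomp₁ : ∀ z ∈ V, ∀ B ⊆ Nᶜ, MeasurableSet B → J z B ≤ ENNReal.ofReal K * J w B := by
    intro z hz B hB hBm
    have := H.comparable.apply_le (hedist z hz) (q := 2) (by norm_num) hBm fun y hy => ?_
    · rwa [h12] at this
    · have h1 := hfar y (hB hy)
      have h2 : dist z w < s := hz.2
      linarith [dist_triangle_left w y z]
  have hcomp₂ : ∀ z ∈ V, ∀ B ⊆ Nᶜ, MeasurableSet B → J w B ≤ ENNReal.ofReal K * J z B := by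
    intro z hz B hB hBm
    have := H.comparable.apply_le (x := w) (y := z) (by rw [edist_comm]; exact hedist z hz)
      (q := 2) (by norm_num) hBm fun y hy => ?_
    · rwa [h12] at this
    · have h1 := hfar y (hB hy)
      have h2 : dist z w < s := hz.2
      linarith [dist_triangle z w y]
  have hsurv : E (((↑) : 𝒳 → OnePoint 𝒳) '' D) ≤ ENNReal.ofReal (S / φ s) * e :=
    Z.exitLaw_ball_le H.levy H.scale H.tail H.exit hD hw hs hsbar hs₀
  have hNc : ENNReal.ofReal (b / K / φ s) * e ≤ E (((↑) : 𝒳 → OnePoint 𝒳) '' Nᶜ) := by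
    refine Z.le_exitLaw_image H.levy hV Metric.isClosed_closedBall hVF hN.compl
      (hdisj _ subset_rfl) hwV fun z hz => ?_
    have h1 := hJN.trans (hcomp₂ z hz _ subset_rfl hN.compl)
    have h2 : ENNReal.ofReal (b / φ s) = ENNReal.ofReal K * ENNReal.ofReal (b / K / φ s) := by
      rw [← ENNReal.ofReal_mul hKpos.le]
      congr 1
      field_simp
    rw [h2] at h1
    exact (ENNReal.mul_le_mul_iff_right (by simpa using hKpos) ENNReal.ofReal_ne_top).1 h1
  have hE1 : E univ ≤ 1 := Z.exitLaw_univ_le hV w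
  -- The chance of jumping into `Nᶜ` is at least a multiple of the mean exit time, and it is at most
  -- one.
  have he_le : e ≤ ENNReal.ofReal (K / b * φ s) := by
    have h1 : ENNReal.ofReal (b / K / φ s) * e ≤ 1 :=
      hNc.trans ((measure_mono (subset_univ _)).trans hE1)
    have h2 : ENNReal.ofReal (K / b * φ s) * ENNReal.ofReal (b / K / φ s) = 1 := by
      rw [← ENNReal.ofReal_mul (by positivity), ← ENNReal.ofReal_one]
      congr 1
      field_simp
    calc e = ENNReal.ofReal (K / b * φ s) * (ENNReal.ofReal (b / K / φ s) * e) := by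
          rw [← mul_assoc, h2, one_mul]
      _ ≤ ENNReal.ofReal (K / b * φ s) * 1 := by gcongr
      _ = _ := mul_one _
  have hND : MeasurableSet (((↑) : 𝒳 → OnePoint 𝒳) '' (N ∩ D)) :=
    OnePoint.measurableEmbedding_coe.measurableSet_image.2 (hN.inter hD.measurableSet)
  have hNcm : MeasurableSet (((↑) : 𝒳 → OnePoint 𝒳) '' Nᶜ) :=
    OnePoint.measurableEmbedding_coe.measurableSet_image.2 hN.compl
  -- Landing in `N ∩ D` and landing in `Nᶜ` are disjoint, and the second has at least `b / K / S`
  -- times the probability of the first.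
  have hnear : E (((↑) : 𝒳 → OnePoint 𝒳) '' (N ∩ D)) ≤ ENNReal.ofReal (1 / (1 + b / K / S)) := by
    have h1 : ENNReal.ofReal (b / K / S) * E (((↑) : 𝒳 → OnePoint 𝒳) '' (N ∩ D)) ≤
        E (((↑) : 𝒳 → OnePoint 𝒳) '' Nᶜ) := by
      refine le_trans ?_ hNc
      have h3 : ENNReal.ofReal (b / K / φ s) =
          ENNReal.ofReal (b / K / S) * ENNReal.ofReal (S / φ s) := by
        rw [← ENNReal.ofReal_mul (by positivity)]
        congr 1
        field_simp
      rw [h3, mul_assoc]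
      gcongr
      exact (measure_mono (image_mono inter_subset_right)).trans hsurv
    have h2 : E (((↑) : 𝒳 → OnePoint 𝒳) '' (N ∩ D)) + E (((↑) : 𝒳 → OnePoint 𝒳) '' Nᶜ) ≤ 1 := by
      rw [← measure_union _ hNcm]
      · exact (measure_mono (subset_univ _)).trans hE1
      · exact (disjoint_image_iff OnePoint.coe_injective).2
          (disjoint_compl_right.mono_left inter_subset_left)
    have h3 : ENNReal.ofReal (1 + b / K / S) * E (((↑) : 𝒳 → OnePoint 𝒳) '' (N ∩ D)) ≤ 1 := by
      rw [ENNReal.ofReal_add zero_le_one (by positivity), ENNReal.ofReal_one, add_mul, one_mul]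
      exact (add_le_add le_rfl h1).trans h2
    rw [one_div, ENNReal.ofReal_inv_of_pos (by positivity), ← one_div,
      ENNReal.le_div_iff_mul_le (Or.inl (by simp; positivity)) (Or.inl ENNReal.ofReal_ne_top),
      mul_comm]
    exact h3
  have hpt : ∀ y, u y ≤ (((↑) : 𝒳 → OnePoint 𝒳) '' (N ∩ D)).indicator (fun _ => M) y +
      (((↑) : 𝒳 → OnePoint 𝒳) '' Nᶜ).indicator u y := by
    intro y
    induction y using OnePoint.rec with
    | infty => rw [hu_infty]; exact zero_le
    | coe z =>
      by_cases hzN : z ∈ N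
      · by_cases hzD : z ∈ D
        · rw [indicator_of_mem (mem_image_of_mem _ (mem_inter hzN hzD))]
          exact (hM z ⟨hzN, hzD⟩).trans le_self_add
        · rw [hu_zero z ⟨hzN, hzD⟩]; exact zero_le
      · rw [indicator_of_mem (s := ((↑) : 𝒳 → OnePoint 𝒳) '' Nᶜ) (mem_image_of_mem _ hzN)]
        exact le_add_self
  have hjump : ∫⁻ y in ((↑) : 𝒳 → OnePoint 𝒳) '' Nᶜ, u y ∂E ≤
      (ENNReal.ofReal K * e) * ∫⁻ z in Nᶜ, u z ∂(J w) := by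
    refine OnePoint.setLIntegral_image_le hN.compl (fun B hB hBm => ?_) u
    have hfin : J w B ≠ ∞ := H.jump_ne_top hs hsbar fun z hz => by
      have := hfar z (hB hz)
      simp only [mem_compl_iff, Metric.mem_ball', not_lt]
      linarith
    refine (Z.exitLaw_image_le H.levy hV Metric.isClosed_closedBall hVF hBm (hdisj B hB) hwV
      (ENNReal.mul_ne_top ENNReal.ofReal_ne_top hfin)
      fun z hz => hcomp₁ z hz B hB hBm).trans_eq ?_
    rw [mul_assoc, mul_assoc, mul_comm (J w B)]
  rw [hu]
  calc ∫⁻ y, u y ∂E ≤ ∫⁻ y, ((((↑) : 𝒳 → OnePoint 𝒳) '' (N ∩ D)).indicator (fun _ => M) y +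
        (((↑) : 𝒳 → OnePoint 𝒳) '' Nᶜ).indicator u y) ∂E := lintegral_mono hpt
    _ = M * E (((↑) : 𝒳 → OnePoint 𝒳) '' (N ∩ D)) +
        ∫⁻ y in ((↑) : 𝒳 → OnePoint 𝒳) '' Nᶜ, u y ∂E := by
      rw [lintegral_add_left (measurable_const.indicator hND), lintegral_indicator_const hND,
        lintegral_indicator hNcm]
    _ ≤ M * ENNReal.ofReal (1 / (1 + b / K / S)) +
        (ENNReal.ofReal K * ENNReal.ofReal (K / b * φ s)) * ∫⁻ z in Nᶜ, u z ∂(J w) := by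
      gcongr
      exact hjump.trans (by gcongr)
    _ = _ := by
      rw [← ENNReal.ofReal_mul hKpos.le]
      congr 3
      ring

end JumpEstimates
end HuntProcess

/-- Absorption of `τ * G` into the left side; finiteness of `G` is essential. -/
theorem ENNReal.le_ofReal_mul_of_le_mul_add {G Y : ℝ≥0∞} {τ : ℝ} (hτ₀ : 0 ≤ τ) (hτ : τ < 1)
    (hG : G ≠ ∞) (h : G ≤ ENNReal.ofReal τ * G + Y) : G ≤ ENNReal.ofReal (1 / (1 - τ)) * Y := by
  have hpos : 0 < 1 - τ := by linarith
  by_cases hY : Y = ∞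
  · rw [hY, ENNReal.mul_top (by simpa using hpos)]
    exact le_top
  lift G to ℝ≥0 using hG
  lift Y to ℝ≥0 using hY
  have h1 : (G : ℝ) ≤ τ * G + Y := by
    have := ENNReal.toReal_mono (by finiteness) h
    rwa [ENNReal.toReal_add (by finiteness) (by finiteness), ENNReal.toReal_mul,
      ENNReal.toReal_ofReal hτ₀] at this
  have h2 : (G : ℝ) ≤ 1 / (1 - τ) * Y := by
    rw [one_div, inv_mul_eq_div, le_div_iff₀ hpos]
    linarith
  calc (G : ℝ≥0∞) = ENNReal.ofReal G := by simp
    _ ≤ ENNReal.ofReal (1 / (1 - τ) * Y) := ENNReal.ofReal_le_ofReal h2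
    _ = _ := by rw [ENNReal.ofReal_mul (by positivity)]; simp

/-! ### The Carleson estimate -/

namespace HuntProcess

variable {𝒳 Ω : Type*} [MeasurableSpace Ω] [MetricSpace 𝒳] [MeasurableSpace 𝒳]

/-- The distance of `w` to the sphere of radius `2r` in units of `r`, truncated at `σ`. -/
def edgeDist (ξ : 𝒳) (r σ : ℝ) (w : 𝒳) : ℝ := min (2 - dist w ξ / r) σ

/-- The contraction factor obtained from an escape rate of at least `b / φ`. -/
def contraction (C₁ θ C₅ C₆ c β b : ℝ) : ℝ :=
  1 / (1 + b / (C₁ * 3 ^ θ) / survivalConst C₅ C₆ c β)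

/-- The escape rate, in units of `1 / φ`, from small balls inside `B(ξ, 2r)`. -/
def escapeRate (C₁ C₂ θ C₄ c β σ : ℝ) : ℝ :=
  min ((1 - C₂) * C₄ / (c * 2 ^ β)) (C₄ / (C₁ * 3 ^ θ) / (c * (4 / σ) ^ β))

/-- The constant of the Carleson estimate. -/
def carlesonConst (C₁ C₂ θ C₄ C₅ C₆ c β σ a : ℝ) : ℝ :=
  (σ ^ θ)⁻¹ * (1 / (1 - (1 + contraction C₁ θ C₅ C₆ c β (escapeRate C₁ C₂ θ C₄ c β σ)) / 2) *
    ((C₁ * 3 ^ θ) ^ 2 / escapeRate C₁ C₂ θ C₄ c β σ * C₁ * (2 * σ + 2 + 1 / a) ^ θ))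

theorem edgeDist_pos {ξ : 𝒳} {r σ : ℝ} (hr : 0 < r) (hσ : 0 < σ) {w : 𝒳}
    (hw : w ∈ Metric.ball ξ (2 * r)) : 0 < edgeDist ξ r σ w := by
  refine lt_min ?_ hσ
  have : dist w ξ / r < 2 := by rw [div_lt_iff₀ hr]; exact hw
  linarith

theorem edgeDist_le (ξ : 𝒳) (r σ : ℝ) (w : 𝒳) : edgeDist ξ r σ w ≤ σ := min_le_right _ _

theorem edgeDist_eq {ξ : 𝒳} {r σ : ℝ} (hr : 0 < r) {w : 𝒳} (hw : dist w ξ ≤ (2 - σ) * r) :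
    edgeDist ξ r σ w = σ := by
  refine min_eq_right ?_
  have : dist w ξ / r ≤ 2 - σ := by rwa [div_le_iff₀ hr]
  linarith

namespace JumpEstimates

variable [LocallyCompactSpace 𝒳] [SecondCountableTopology 𝒳] [BorelSpace 𝒳]
  {Z : HuntProcess 𝒳 Ω} {J : Kernel 𝒳 𝒳} {φ : ℝ → ℝ} {rbar r₀ : ℝ≥0∞}
  {C₁ C₂ C₃ θ C₄ C₅ C₆ c β : ℝ}

theorem contraction_mem (H : JumpEstimates Z J φ rbar r₀ C₁ C₂ C₃ θ C₄ C₅ C₆ c β) {b : ℝ}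
    (hb : 0 < b) : contraction C₁ θ C₅ C₆ c β b ∈ Ioo (0 : ℝ) 1 := by
  have hS := H.survivalConst_pos
  have hC₁ := H.comparable.C₁_pos
  have hpos : 0 < b / (C₁ * 3 ^ θ) / survivalConst C₅ C₆ c β := by positivity
  unfold contraction
  refine ⟨by positivity, ?_⟩
  rw [div_lt_one (by positivity)]
  linarith

theorem escapeRate_pos (H : JumpEstimates Z J φ rbar r₀ C₁ C₂ C₃ θ C₄ C₅ C₆ c β) {σ : ℝ}
    (hσ : 0 < σ) : 0 < escapeRate C₁ C₂ θ C₄ c β σ := by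
  have hC₁ := H.comparable.C₁_pos
  have hC₂ : 0 < 1 - C₂ := by linarith [H.comparable.C₂_mem.2]
  have hC₄ := H.tail.pos
  have hc := H.scale.pos_const
  exact lt_min (by positivity) (by positivity)

/-- Escape from `w` in the interior part of `B(ξ, 2r)`. -/
theorem escapeRate_le_interior (H : JumpEstimates Z J φ rbar r₀ C₁ C₂ C₃ θ C₄ C₅ C₆ c β)
    {ξ : 𝒳} {r σ : ℝ} (hr : 0 < r) (h2r : ENNReal.ofReal (2 * r) < rbar) (hσ : 0 < σ)
    (hσ1 : 3 * σ < 2) {w : 𝒳} (hw : dist w ξ < (2 - 2 * σ) * r) :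
    ENNReal.ofReal (escapeRate C₁ C₂ θ C₄ c β σ / φ (σ * r / 2)) ≤
      J w (Metric.ball w (2 * (σ * r / 2)) ∪ Metric.ball ξ ((2 - 3 * σ) * r))ᶜ := by
  have hC₁ := H.comparable.C₁_pos
  have hC₄ := H.tail.pos
  have hc := H.scale.pos_const
  have hσr : 0 < σ * r := by positivity
  have hφs := H.scale.apply_pos (show 0 < σ * r / 2 by positivity)
  have hφ2 := H.scale.apply_pos (show 0 < 2 * r by positivity)
  set K := C₁ * 3 ^ θ with hK
  have hKpos : 0 < K := by positivity
  -- In the interior part all of `N` stays in `B(ξ, 2r)`, and jumps out of that ball have at `w` a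
  -- rate comparable with the rate at `ξ`, of order `1 / φ(2r)`.
  have hsub : (Metric.ball ξ (2 * r))ᶜ ⊆
      (Metric.ball w (2 * (σ * r / 2)) ∪ Metric.ball ξ ((2 - 3 * σ) * r))ᶜ := by
    refine compl_subset_compl.2 (union_subset (fun z hz => ?_)
      (Metric.ball_subset_ball (by nlinarith)))
    rw [Metric.mem_ball] at hz ⊢
    linarith [dist_triangle z w ξ]
  refine le_trans ?_ (measure_mono hsub)
  have h1 : J ξ (Metric.ball ξ (2 * r))ᶜ ≤ ENNReal.ofReal K * J w (Metric.ball ξ (2 * r))ᶜ := by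
    have := H.comparable.apply_le (x := ξ) (y := w) ?_ (q := 2) (by norm_num)
      (B := (Metric.ball ξ (2 * r))ᶜ) measurableSet_ball.compl fun z hz => ?_
    · rwa [show (1 : ℝ) + 2 = 3 by norm_num] at this
    · rw [edist_comm, edist_dist]
      exact (ENNReal.ofReal_le_ofReal (by linarith)).trans_lt h2r
    · simp only [mem_compl_iff, Metric.mem_ball', not_lt] at hz
      linarith [dist_triangle w ξ z]
  have h2 := (H.tail.lower ξ (2 * r) (by positivity) h2r).trans h1
  have h3 : ENNReal.ofReal (C₄ / φ (2 * r)) =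
      ENNReal.ofReal K * ENNReal.ofReal (C₄ / K / φ (2 * r)) := by
    rw [← ENNReal.ofReal_mul hKpos.le]
    congr 1
    field_simp
  rw [h3] at h2
  refine le_trans (ENNReal.ofReal_le_ofReal ?_)
    ((ENNReal.mul_le_mul_iff_right (by simpa using hKpos) ENNReal.ofReal_ne_top).1 h2)
  have h4 := H.scale.inv_le (r := σ * r / 2) (R := 2 * r) (by positivity) (by nlinarith)
  have h5 : 2 * r / (σ * r / 2) = 4 / σ := by field_simp; norm_num
  rw [h5] at h4
  calc escapeRate C₁ C₂ θ C₄ c β σ / φ (σ * r / 2)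
      ≤ (C₄ / K / (c * (4 / σ) ^ β)) / φ (σ * r / 2) := by
        gcongr
        exact min_le_right _ _
    _ = (C₄ / K / (c * (4 / σ) ^ β)) * (1 / φ (σ * r / 2)) := by ring
    _ ≤ (C₄ / K / (c * (4 / σ) ^ β)) * (c * (4 / σ) ^ β / φ (2 * r)) := by gcongr
    _ = C₄ / K / φ (2 * r) := by field_simp

/-- Escape from `w` in the outer part of `B(ξ, 2r)`. -/
theorem escapeRate_le_outer (H : JumpEstimates Z J φ rbar r₀ C₁ C₂ C₃ θ C₄ C₅ C₆ c β)
    {ξ : 𝒳} {r σ : ℝ} (hr : 0 < r) (h2r : ENNReal.ofReal (2 * r) < rbar) (hσ : 0 < σ)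
    (hσ1 : 3 * σ < 2) {w : 𝒳} (hw : (2 - 2 * σ) * r ≤ dist w ξ) {s : ℝ} (hs : 0 < s)
    (hsr : s ≤ r) (hsσ : C₃ * (2 * s) < σ * r) :
    ENNReal.ofReal (escapeRate C₁ C₂ θ C₄ c β σ / φ s) ≤
      J w (Metric.ball w (2 * s) ∪ Metric.ball ξ ((2 - 3 * σ) * r))ᶜ := by
  have hC₂ : 0 < 1 - C₂ := by linarith [H.comparable.C₂_mem.2]
  have hC₂' := H.comparable.C₂_mem.1
  have hC₄ := H.tail.pos
  have hc := H.scale.pos_const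
  have hφs := H.scale.apply_pos hs
  have hφ2 := H.scale.apply_pos (show 0 < 2 * s by positivity)
  have h2s : ENNReal.ofReal (2 * s) < rbar :=
    (ENNReal.ofReal_le_ofReal (by linarith)).trans_lt h2r
  have hρ : 0 < (2 - 3 * σ) * r := mul_pos (by linarith) hr
  set N := Metric.ball w (2 * s) ∪ Metric.ball ξ ((2 - 3 * σ) * r) with hN
  -- In the outer part `w` is at distance at least `σ * r` from the inner ball, so at most a
  -- proportion `C₂ < 1` of the jumps leaving `B(w, 2s)` can land there.
  have hesc := H.comparable.escape w ξ (2 * s) ((2 - 3 * σ) * r) (by positivity) h2s hρ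
    ((ENNReal.ofReal_le_ofReal (by nlinarith)).trans_lt h2r) (by nlinarith)
  set Y := J w (Metric.ball w (2 * s))ᶜ with hY
  have hYfin : Y ≠ ∞ := H.jump_ne_top (by positivity) h2s subset_rfl
  have hle : Y ≤ J w Nᶜ + ENNReal.ofReal C₂ * Y := by
    refine le_trans (measure_mono (t := Nᶜ ∪ Metric.ball ξ ((2 - 3 * σ) * r)) ?_)
      ((measure_union_le _ _).trans (add_le_add le_rfl hesc))
    intro z hz
    by_cases h : z ∈ Metric.ball ξ ((2 - 3 * σ) * r)
    · exact Or.inr h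
    · exact Or.inl fun h' => h'.elim hz h
  have hmain : ENNReal.ofReal (1 - C₂) * Y ≤ J w Nᶜ := by
    have h1 : ENNReal.ofReal (1 - C₂) * Y + ENNReal.ofReal C₂ * Y = Y := by
      rw [← add_mul, ← ENNReal.ofReal_add hC₂.le hC₂'.le]
      simp
    exact (ENNReal.add_le_add_iff_right
      (ENNReal.mul_ne_top (ENNReal.ofReal_ne_top (r := C₂)) hYfin)).1 (h1.trans_le hle)
  refine le_trans ?_ hmain
  refine le_trans ?_ (mul_le_mul_right (H.tail.lower w (2 * s) (by positivity) h2s) _)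
  rw [← ENNReal.ofReal_mul hC₂.le]
  refine ENNReal.ofReal_le_ofReal ?_
  have h4 := H.scale.inv_le (r := s) (R := 2 * s) hs (by linarith)
  have h5 : 2 * s / s = 2 := by field_simp
  rw [h5] at h4
  calc escapeRate C₁ C₂ θ C₄ c β σ / φ s
      ≤ ((1 - C₂) * C₄ / (c * 2 ^ β)) / φ s := by
        gcongr
        exact min_le_left _ _
    _ = ((1 - C₂) * C₄ / (c * 2 ^ β)) * (1 / φ s) := by ring
    _ ≤ ((1 - C₂) * C₄ / (c * 2 ^ β)) * (c * 2 ^ β / φ (2 * s)) := by gcongr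
    _ = (1 - C₂) * (C₄ / φ (2 * s)) := by field_simp

/-- The local estimate multiplied by the weight. On `N` the weight drops at most by the factor `(1 -
2a) ^ θ`; the `θ`-power in the comparison of `J w` with `J ξ` is absorbed by the weight through the
bound `L`. -/
theorem weighted_le_of_escape (H : JumpEstimates Z J φ rbar r₀ C₁ C₂ C₃ θ C₄ C₅ C₆ c β)
    {D : Set 𝒳} (hD : IsOpen D) {ξ : 𝒳} {r σ a : ℝ} (hr : 0 < r)
    (h2r : ENNReal.ofReal (2 * r) < rbar) (hr₀ : ENNReal.ofReal r < r₀) (hσ : 0 < σ)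
    (ha : 0 < a) (ha4 : a ≤ 1 / 4) {u : OnePoint 𝒳 → ℝ≥0∞}
    (hu : ∀ V ⊆ D ∩ Metric.ball ξ (2 * r), IsOpen V → ∀ w : 𝒳, u w = ∫⁻ y, u y ∂(Z.exitLaw V w))
    (hu_infty : u OnePoint.infty = 0) (hu_zero : ∀ z ∈ Metric.ball ξ (2 * r) \ D, u z = 0)
    {G : ℝ≥0∞}
    (hG : ∀ z ∈ D ∩ Metric.ball ξ (2 * r), ENNReal.ofReal (edgeDist ξ r σ z ^ θ) * u z ≤ G)
    {w : 𝒳} (hw : w ∈ D ∩ Metric.ball ξ (2 * r)) {s b L : ℝ} (hs : 0 < s) (hsr : s ≤ r)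
    (hb : 0 < b) (hball : Metric.ball w (2 * s) ⊆ Metric.ball ξ (2 * r))
    (hJ : ENNReal.ofReal (b / φ s) ≤
      J w (Metric.ball w (2 * s) ∪ Metric.ball ξ ((2 - 3 * σ) * r))ᶜ)
    (hδ : ∀ z ∈ Metric.ball w (2 * s), (1 - 2 * a) * edgeDist ξ r σ w ≤ edgeDist ξ r σ z)
    (hL : edgeDist ξ r σ w * (2 + r / s) ≤ L) :
    ENNReal.ofReal (edgeDist ξ r σ w ^ θ) * u w ≤
      ENNReal.ofReal (contraction C₁ θ C₅ C₆ c β b / (1 - 2 * a) ^ θ) * G +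
        ENNReal.ofReal ((C₁ * 3 ^ θ) ^ 2 / b * C₁ * L ^ θ * φ r) *
          ∫⁻ z in (Metric.ball ξ ((2 - 3 * σ) * r))ᶜ, u z ∂(J ξ) := by
  have hC₁ := H.comparable.C₁_pos
  have hθ := H.comparable.θ_pos
  have hφs := H.scale.apply_pos hs
  have hφr := H.scale.apply_pos hr
  have hτ := (H.contraction_mem hb).1
  set τ := contraction C₁ θ C₅ C₆ c β b with hτdef
  set δ := edgeDist ξ r σ w with hδdef
  have hδpos : 0 < δ := edgeDist_pos hr hσ hw.2
  have h1a : 0 < 1 - 2 * a := by linarith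
  set N := Metric.ball w (2 * s) ∪ Metric.ball ξ ((2 - 3 * σ) * r) with hN
  set Λ := ∫⁻ z in (Metric.ball ξ ((2 - 3 * σ) * r))ᶜ, u z ∂(J ξ) with hΛ
  have hsub2 : Metric.ball ξ ((2 - 3 * σ) * r) ⊆ Metric.ball ξ (2 * r) :=
    Metric.ball_subset_ball (by nlinarith)
  have hNsub : N ⊆ Metric.ball ξ (2 * r) := union_subset hball hsub2
  have hNδ : ∀ z ∈ N, (1 - 2 * a) * δ ≤ edgeDist ξ r σ z := by
    rintro z (hz | hz)
    · exact hδ z hz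
    · rw [edgeDist_eq hr (le_of_lt (lt_of_lt_of_le hz (by nlinarith)))]
      have := edgeDist_le ξ r σ w
      nlinarith
  have hM : ∀ z ∈ N ∩ D, u z ≤ ENNReal.ofReal (((1 - 2 * a) * δ) ^ θ)⁻¹ * G := by
    intro z hz
    have h1 := hNδ z hz.1
    have hd : 0 < (1 - 2 * a) * δ := by positivity
    have hz' : 0 < edgeDist ξ r σ z := hd.trans_le h1
    have h2 : ENNReal.ofReal (edgeDist ξ r σ z ^ θ)⁻¹ * ENNReal.ofReal (edgeDist ξ r σ z ^ θ) = 1 := by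
      rw [← ENNReal.ofReal_mul (by positivity), inv_mul_cancel₀ (by positivity), ENNReal.ofReal_one]
    calc u z = ENNReal.ofReal (edgeDist ξ r σ z ^ θ)⁻¹ *
          (ENNReal.ofReal (edgeDist ξ r σ z ^ θ) * u z) := by rw [← mul_assoc, h2, one_mul]
      _ ≤ _ := by
        gcongr
        exact hG z ⟨hz.2, hNsub hz.1⟩
  have hmain := H.exitMean_le_of_near hD
    (measurableSet_ball.union measurableSet_ball : MeasurableSet N) hw.1 hs hb
    ((ENNReal.ofReal_le_ofReal (by linarith)).trans_lt h2r)
    ((ENNReal.ofReal_le_ofReal hsr).trans_lt hr₀) subset_union_left hJ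
    (hu _ (inter_subset_inter_right _ ((Metric.ball_subset_ball (by linarith)).trans hball))
      (hD.inter Metric.isOpen_ball) w) hu_infty (fun z hz => hu_zero z ⟨hNsub hz.1, hz.2⟩) hM
  change u w ≤ _ * ENNReal.ofReal τ + _ at hmain
  -- Off `N` the distance from `w` is at least `2 * s`, while `w` is within `2 * r` of `ξ`; hence
  -- `dist ξ z ≤ (1 + r / s) * dist w z`.
  have hjumpint : ∫⁻ z in Nᶜ, u z ∂(J w) ≤ ENNReal.ofReal (C₁ * (2 + r / s) ^ θ) * Λ := by
    have h1 : ∫⁻ z in Nᶜ, u z ∂(J w) ≤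
        ENNReal.ofReal (C₁ * (1 + (1 + r / s)) ^ θ) * ∫⁻ z in Nᶜ, u z ∂(J ξ) := by
      refine setLIntegral_le_mul_of_le (A := Nᶜ)
        (measurableSet_ball.union measurableSet_ball).compl (fun B hB hBm => ?_) fun z : 𝒳 => u z
      refine H.comparable.apply_le ?_ (by positivity) hBm fun z hz => ?_
      · rw [edist_dist]
        exact (ENNReal.ofReal_le_ofReal (le_of_lt hw.2)).trans_lt h2r
      · have hzw : 2 * s ≤ dist w z := by
          by_contra! h
          exact hB hz (Or.inl (by rwa [Metric.mem_ball']))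
        have hwξ : dist w ξ < 2 * r := hw.2
        have h3 : 2 * r ≤ r / s * dist w z := by
          rw [div_mul_eq_mul_div, le_div_iff₀ hs]
          nlinarith
        linarith [dist_triangle_left ξ z w]
    rw [show 1 + (1 + r / s) = 2 + r / s by ring] at h1
    exact h1.trans (mul_le_mul_right
      (lintegral_mono_set (compl_subset_compl.2 subset_union_right)) _)
  have hLpos : 0 ≤ L := le_trans (by positivity) hL
  set K := (C₁ * 3 ^ θ) ^ 2 / b with hK
  calc ENNReal.ofReal (δ ^ θ) * u w
      ≤ ENNReal.ofReal (δ ^ θ) * (ENNReal.ofReal (((1 - 2 * a) * δ) ^ θ)⁻¹ * G * ENNReal.ofReal τ +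
          ENNReal.ofReal (K * φ s) * (ENNReal.ofReal (C₁ * (2 + r / s) ^ θ) * Λ)) := by
        gcongr
        exact hmain.trans (by gcongr)
    _ = ENNReal.ofReal (δ ^ θ) * ENNReal.ofReal (((1 - 2 * a) * δ) ^ θ)⁻¹ * ENNReal.ofReal τ * G +
          ENNReal.ofReal (δ ^ θ) * ENNReal.ofReal (K * φ s) *
            ENNReal.ofReal (C₁ * (2 + r / s) ^ θ) * Λ := by ring
    _ ≤ _ := by
        rw [← ENNReal.ofReal_mul (by positivity), ← ENNReal.ofReal_mul (by positivity),
          ← ENNReal.ofReal_mul (by positivity), ← ENNReal.ofReal_mul (by positivity)]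
        refine add_le_add (mul_le_mul_left (ENNReal.ofReal_le_ofReal ?_) _)
          (mul_le_mul_left (ENNReal.ofReal_le_ofReal ?_) _)
        · rw [Real.mul_rpow h1a.le hδpos.le]
          refine le_of_eq ?_
          field_simp
        · calc δ ^ θ * (K * φ s) * (C₁ * (2 + r / s) ^ θ)
              = K * C₁ * (δ * (2 + r / s)) ^ θ * φ s := by
                rw [Real.mul_rpow hδpos.le (by positivity)]; ring
            _ ≤ K * C₁ * L ^ θ * φ r := by
                gcongr
                exact H.scale.mono hs.le hsr

/-- The Carleson estimate for bounded functions with the mean value property. -/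
theorem carleson_of_bounded (H : JumpEstimates Z J φ rbar r₀ C₁ C₂ C₃ θ C₄ C₅ C₆ c β)
    {D : Set 𝒳} (hD : IsOpen D) {ξ : 𝒳} {r σ a : ℝ} (hr : 0 < r)
    (h2r : ENNReal.ofReal (2 * r) < rbar) (hr₀ : ENNReal.ofReal r < r₀) (hσ : 0 < σ)
    (hσ1 : 3 * σ < 2) (ha : 0 < a) (haC₃ : 4 * a * C₃ ≤ 1)
    (haτ : contraction C₁ θ C₅ C₆ c β (escapeRate C₁ C₂ θ C₄ c β σ) ≤
      (1 + contraction C₁ θ C₅ C₆ c β (escapeRate C₁ C₂ θ C₄ c β σ)) / 2 * (1 - 2 * a) ^ θ)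
    {u : OnePoint 𝒳 → ℝ≥0∞}
    (hu : ∀ V ⊆ D ∩ Metric.ball ξ (2 * r), IsOpen V → ∀ w : 𝒳, u w = ∫⁻ y, u y ∂(Z.exitLaw V w))
    (hu_infty : u OnePoint.infty = 0) (hu_zero : ∀ z ∈ Metric.ball ξ (2 * r) \ D, u z = 0)
    {B : ℝ≥0∞} (hB : B ≠ ∞) (hu_le : ∀ y, u y ≤ B) {x : 𝒳}
    (hx : x ∈ D ∩ Metric.ball ξ ((2 - 3 * σ) * r)) :
    u x ≤ ENNReal.ofReal (carlesonConst C₁ C₂ θ C₄ C₅ C₆ c β σ a * φ r) *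
      ∫⁻ z in (Metric.ball ξ ((2 - 3 * σ) * r))ᶜ, u z ∂(J ξ) := by
  have hC₁ := H.comparable.C₁_pos
  have hC₃ := H.comparable.C₃_gt
  have hθ := H.comparable.θ_pos
  have hφr := H.scale.apply_pos hr
  have hb := H.escapeRate_pos hσ
  obtain ⟨hτ₀, hτ₁⟩ := H.contraction_mem hb
  have ha4 : a ≤ 1 / 4 := by nlinarith
  have h1a : 0 < 1 - 2 * a := by linarith
  rw [carlesonConst]
  set b := escapeRate C₁ C₂ θ C₄ c β σ with hbdef
  set τ := contraction C₁ θ C₅ C₆ c β b with hτdef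
  set L := 2 * σ + 2 + 1 / a with hL
  set Λ := ∫⁻ z in (Metric.ball ξ ((2 - 3 * σ) * r))ᶜ, u z ∂(J ξ) with hΛ
  set K := (C₁ * 3 ^ θ) ^ 2 / b * C₁ * L ^ θ with hK
  set G : ℝ≥0∞ := ⨆ z ∈ D ∩ Metric.ball ξ (2 * r), ENNReal.ofReal (edgeDist ξ r σ z ^ θ) * u z
    with hGdef
  have hG : ∀ z ∈ D ∩ Metric.ball ξ (2 * r), ENNReal.ofReal (edgeDist ξ r σ z ^ θ) * u z ≤ G :=
    fun z hz => le_iSup₂ (f := fun z (_ : z ∈ D ∩ Metric.ball ξ (2 * r)) =>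
      ENNReal.ofReal (edgeDist ξ r σ z ^ θ) * u z) z hz
  -- The only use of boundedness: it allows the contraction term to be absorbed at the end.
  have hGfin : G ≠ ∞ := by
    refine ne_top_of_le_ne_top (ENNReal.mul_ne_top (ENNReal.ofReal_ne_top (r := σ ^ θ)) hB)
      (iSup₂_le fun z hz => ?_)
    have := edgeDist_pos hr hσ hz.2
    gcongr
    · exact edgeDist_le ξ r σ z
    · exact hu_le z
  have hstep : ∀ w ∈ D ∩ Metric.ball ξ (2 * r), ENNReal.ofReal (edgeDist ξ r σ w ^ θ) * u w ≤
      ENNReal.ofReal (τ / (1 - 2 * a) ^ θ) * G + ENNReal.ofReal (K * φ r) * Λ := by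
    intro w hw
    have hδpos : 0 < edgeDist ξ r σ w := edgeDist_pos hr hσ hw.2
    have hδle := edgeDist_le ξ r σ w
    -- In the interior a ball of fixed relative size `σ / 2` serves. Near the sphere the radius must
    -- shrink with the distance to it, as `a * δ * r`.
    by_cases hin : dist w ξ < (2 - 2 * σ) * r
    · have hball : ∀ z ∈ Metric.ball w (2 * (σ * r / 2)), dist z ξ < (2 - σ) * r := by
        intro z hz
        rw [Metric.mem_ball] at hz
        linarith [dist_triangle z w ξ]
      refine H.weighted_le_of_escape hD hr h2r hr₀ hσ ha ha4 hu hu_infty hu_zero hG hw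
        (s := σ * r / 2) (by positivity) (by nlinarith) hb ?_
        (H.escapeRate_le_interior hr h2r hσ hσ1 hin) ?_ ?_
      · intro z hz
        rw [Metric.mem_ball]
        nlinarith [hball z hz]
      · intro z hz
        rw [edgeDist_eq hr (hball z hz).le]
        nlinarith
      · rw [edgeDist_eq hr (hin.le.trans (by nlinarith))]
        have : σ * (2 + r / (σ * r / 2)) = 2 * σ + 2 := by field_simp
        rw [this, hL]
        have : 0 < 1 / a := by positivity
        linarith
    · rw [not_lt] at hin
      set δ := edgeDist ξ r σ w with hδ
      have haδ : a * δ * r ≤ r / 4 := by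
        have : a * δ ≤ 1 / 4 * 1 := by
          gcongr
          linarith
        nlinarith
      have hδd : δ * r ≤ 2 * r - dist w ξ := by
        have : δ ≤ 2 - dist w ξ / r := min_le_left _ _
        calc δ * r ≤ (2 - dist w ξ / r) * r := by gcongr
          _ = _ := by field_simp
      have hdz : ∀ z ∈ Metric.ball w (2 * (a * δ * r)), dist z ξ ≤ dist w ξ + 2 * (a * δ * r) := by
        intro z hz
        rw [Metric.mem_ball] at hz
        linarith [dist_triangle z w ξ]
      have haδr : a * δ * r ≤ 1 / 4 * (δ * r) := by
        rw [mul_assoc]; gcongr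
      refine H.weighted_le_of_escape hD hr h2r hr₀ hσ ha ha4 hu hu_infty hu_zero hG hw
        (s := a * δ * r) (by positivity) (by linarith) hb ?_
        (H.escapeRate_le_outer hr h2r hσ hσ1 hin (by positivity) (by linarith) ?_) ?_ ?_
      · intro z hz
        rw [Metric.mem_ball]
        have : 0 < δ * r := by positivity
        linarith [hdz z hz]
      · have h1 : C₃ * (2 * (a * δ * r)) = (4 * a * C₃) * (δ * r / 2) := by ring
        rw [h1]
        have h2 : (4 * a * C₃) * (δ * r / 2) ≤ 1 * (δ * r / 2) := by gcongr
        nlinarith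
      · intro z hz
        refine le_min ?_ (by nlinarith)
        have h1 : dist z ξ / r ≤ dist w ξ / r + 2 * (a * δ) := by
          rw [div_le_iff₀ hr]
          calc dist z ξ ≤ dist w ξ + 2 * (a * δ * r) := hdz z hz
            _ = _ := by field_simp
        have : δ ≤ 2 - dist w ξ / r := min_le_left _ _
        linarith
      -- With a radius proportional to `δ * r`, the weight cancels the blow-up of `r / s`, and the
      -- bound no longer depends on `δ`.
      · have : δ * (2 + r / (a * δ * r)) = 2 * δ + 1 / a := by field_simp
        rw [this, hL]
        linarith
  have hGle : G ≤ ENNReal.ofReal ((1 + τ) / 2) * G + ENNReal.ofReal (K * φ r) * Λ := by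
    refine iSup₂_le fun w hw => (hstep w hw).trans ?_
    refine add_le_add (mul_le_mul_left (ENNReal.ofReal_le_ofReal ?_) _) le_rfl
    rw [div_le_iff₀ (by positivity)]
    exact haτ
  have hfinal := ENNReal.le_ofReal_mul_of_le_mul_add (by linarith) (by linarith) hGfin hGle
  have hxG := hG x ⟨hx.1, Metric.ball_subset_ball (by nlinarith) hx.2⟩
  rw [edgeDist_eq hr (le_of_lt (lt_of_lt_of_le hx.2 (by nlinarith)))] at hxG
  have h1 : ENNReal.ofReal (σ ^ θ)⁻¹ * ENNReal.ofReal (σ ^ θ) = 1 := by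
    rw [← ENNReal.ofReal_mul (by positivity), inv_mul_cancel₀ (by positivity), ENNReal.ofReal_one]
  have hτpos : 0 < 1 - (1 + τ) / 2 := by linarith
  calc u x = ENNReal.ofReal (σ ^ θ)⁻¹ * (ENNReal.ofReal (σ ^ θ) * u x) := by
        rw [← mul_assoc, h1, one_mul]
    _ ≤ ENNReal.ofReal (σ ^ θ)⁻¹ * (ENNReal.ofReal (1 / (1 - (1 + τ) / 2)) *
        (ENNReal.ofReal (K * φ r) * Λ)) := by
        exact mul_le_mul_right (hxG.trans hfinal) _
    _ = _ := by
        rw [← mul_assoc, ← mul_assoc, ← ENNReal.ofReal_mul (by positivity),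
          ← ENNReal.ofReal_mul (by positivity)]
        congr 2
        ring

end JumpEstimates
end HuntProcess

/-! ### Factorization of harmonic functions -/

namespace HuntProcess

/-- The relative size of the balls used close to the sphere of radius `2r`. -/
def edgeScale (C₁ C₂ C₃ θ C₄ C₅ C₆ c β σ : ℝ) : ℝ :=
  min ((1 - (contraction C₁ θ C₅ C₆ c β (escapeRate C₁ C₂ θ C₄ c β σ) /
    ((1 + contraction C₁ θ C₅ C₆ c β (escapeRate C₁ C₂ θ C₄ c β σ)) / 2)) ^ (1 / θ)) / 2)
    (1 / (4 * C₃))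

/-- The constant of the upper bound in the factorization of harmonic functions. -/
def factorConst (C₁ C₂ C₃ θ C₄ C₅ C₆ c β σ : ℝ) : ℝ :=
  carlesonConst C₁ C₂ θ C₄ C₅ C₆ c β σ (edgeScale C₁ C₂ C₃ θ C₄ C₅ C₆ c β σ) *
    survivalConst C₅ C₆ c β * (c * (1 / σ) ^ β) + C₁ * (1 + 2 / σ) ^ θ

variable {𝒳 Ω : Type*} [MeasurableSpace Ω] [MetricSpace 𝒳] [MeasurableSpace 𝒳]

namespace JumpEstimates

variable [LocallyCompactSpace 𝒳] [SecondCountableTopology 𝒳] [BorelSpace 𝒳]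
  {Z : HuntProcess 𝒳 Ω} {J : Kernel 𝒳 𝒳} {φ : ℝ → ℝ} {rbar r₀ : ℝ≥0∞}
  {C₁ C₂ C₃ θ C₄ C₅ C₆ c β : ℝ}

/-- The bound with `C₃` keeps the balls near the sphere small enough for the escape condition. The
last bound says that the loss in the weight leaves a contraction by the midpoint of `τ` and 1. -/
theorem edgeScale_spec (H : JumpEstimates Z J φ rbar r₀ C₁ C₂ C₃ θ C₄ C₅ C₆ c β) {σ : ℝ}
    (hσ : 0 < σ) :
    0 < edgeScale C₁ C₂ C₃ θ C₄ C₅ C₆ c β σ ∧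
    4 * edgeScale C₁ C₂ C₃ θ C₄ C₅ C₆ c β σ * C₃ ≤ 1 ∧
    contraction C₁ θ C₅ C₆ c β (escapeRate C₁ C₂ θ C₄ c β σ) ≤
      (1 + contraction C₁ θ C₅ C₆ c β (escapeRate C₁ C₂ θ C₄ c β σ)) / 2 *
        (1 - 2 * edgeScale C₁ C₂ C₃ θ C₄ C₅ C₆ c β σ) ^ θ := by
  obtain ⟨hτ₀, hτ₁⟩ := H.contraction_mem (H.escapeRate_pos hσ)
  have hC₃ := H.comparable.C₃_gt
  have hθ := H.comparable.θ_pos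
  unfold edgeScale
  set τ := contraction C₁ θ C₅ C₆ c β (escapeRate C₁ C₂ θ C₄ c β σ)
  have hC₃' : 0 < C₃ := by linarith
  have hratio : τ / ((1 + τ) / 2) < 1 := by
    rw [div_lt_one (by positivity)]
    linarith
  have hratio₀ : 0 < τ / ((1 + τ) / 2) := by positivity
  set t := (τ / ((1 + τ) / 2)) ^ (1 / θ) with ht
  have ht₀ : 0 < t := by positivity
  have ht₁ : t < 1 := Real.rpow_lt_one hratio₀.le hratio (by positivity)
  set a := min ((1 - t) / 2) (1 / (4 * C₃)) with ha
  have ha₁ : a ≤ (1 - t) / 2 := min_le_left _ _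
  have ha₂ : a ≤ 1 / (4 * C₃) := min_le_right _ _
  refine ⟨lt_min (by linarith) (by positivity), ?_, ?_⟩
  · calc 4 * a * C₃ ≤ 4 * (1 / (4 * C₃)) * C₃ := by gcongr
      _ = 1 := by field_simp
  · have h1 : t ^ θ ≤ (1 - 2 * a) ^ θ := Real.rpow_le_rpow ht₀.le (by linarith) hθ.le
    have h2 : t ^ θ = τ / ((1 + τ) / 2) := by
      rw [ht, ← Real.rpow_mul hratio₀.le, one_div_mul_cancel hθ.ne', Real.rpow_one]
    calc τ = (1 + τ) / 2 * (τ / ((1 + τ) / 2)) := by field_simp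
      _ ≤ _ := by
        rw [← h2]
        gcongr

theorem carlesonConst_pos (H : JumpEstimates Z J φ rbar r₀ C₁ C₂ C₃ θ C₄ C₅ C₆ c β) {σ a : ℝ}
    (hσ : 0 < σ) (ha : 0 < a) : 0 < carlesonConst C₁ C₂ θ C₄ C₅ C₆ c β σ a := by
  have hb := H.escapeRate_pos hσ
  have hC₁ := H.comparable.C₁_pos
  have hτ : 0 < 1 - (1 + contraction C₁ θ C₅ C₆ c β (escapeRate C₁ C₂ θ C₄ c β σ)) / 2 := by
    linarith [(H.contraction_mem hb).2]
  unfold carlesonConst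
  positivity

/-- The Carleson estimate. -/
theorem carleson (H : JumpEstimates Z J φ rbar r₀ C₁ C₂ C₃ θ C₄ C₅ C₆ c β)
    {D : Set 𝒳} (hD : IsOpen D) {ξ : 𝒳} {r σ : ℝ} (hr : 0 < r)
    (h2r : ENNReal.ofReal (2 * r) < rbar) (hr₀ : ENNReal.ofReal r < r₀) (hσ : 0 < σ)
    (hσ1 : 3 * σ < 2) {g : 𝒳 → ℝ≥0∞}
    (hg : ∀ ν : Measure 𝒳, IsFiniteMeasure ν → AEMeasurable g ν) (hfin : ∀ y, g y ≠ ∞)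
    (hg_zero : ∀ z ∈ Metric.ball ξ (2 * r) \ D, g z = 0) {x : 𝒳}
    (hx : x ∈ D ∩ Metric.ball ξ ((2 - 3 * σ) * r)) :
    Z.exitMean (D ∩ Metric.ball ξ (2 * r)) g x ≤
      ENNReal.ofReal (carlesonConst C₁ C₂ θ C₄ C₅ C₆ c β σ
        (edgeScale C₁ C₂ C₃ θ C₄ C₅ C₆ c β σ) * φ r) *
      ∫⁻ z in (Metric.ball ξ ((2 - 3 * σ) * r))ᶜ,
        Z.exitMean (D ∩ Metric.ball ξ (2 * r)) g z ∂(J ξ) := by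
  have hU : IsOpen (D ∩ Metric.ball ξ (2 * r)) := hD.inter Metric.isOpen_ball
  obtain ⟨ha, haC₃, haτ⟩ := H.edgeScale_spec hσ
  rw [Z.exitMean_eq_iSup_min hU hg hfin]
  refine iSup_le fun n => ?_
  have hgn : ∀ ν : Measure 𝒳, IsFiniteMeasure ν → AEMeasurable (fun z => min (g z) (n : ℝ≥0∞)) ν :=
    fun ν hν => (hg ν hν).min aemeasurable_const
  refine (H.carleson_of_bounded hD hr h2r hr₀ hσ hσ1 ha haC₃ haτ
    (u := Z.exitMean (D ∩ Metric.ball ξ (2 * r)) fun z => min (g z) n)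
    (fun V hVU hV w => Z.exitMean_eq_lintegral_exitLaw hU hV hVU hgn w) ?_ (fun z hz => ?_)
    (ENNReal.natCast_ne_top n) (Z.exitMean_le_of_le _ fun y => min_le_right _ _) hx).trans ?_
  · rw [Z.exitMean_of_notMem _ (by simp)]
    rfl
  · rw [Z.exitMean_of_notMem _ (by
      rintro ⟨z', hz', heq⟩
      rw [OnePoint.coe_eq_coe] at heq
      exact hz.2 (heq ▸ hz'.1))]
    simp [hg_zero z hz]
  · exact mul_le_mul_right (lintegral_mono fun z : 𝒳 =>
      Z.exitMean_mono _ (fun y => min_le_left _ _) (z : OnePoint 𝒳)) _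

/-- Upper bound in the factorization of functions harmonic in `D ∩ B(ξ, 2r)`. -/
theorem exitMean_le_factor (H : JumpEstimates Z J φ rbar r₀ C₁ C₂ C₃ θ C₄ C₅ C₆ c β)
    {D : Set 𝒳} (hD : IsOpen D) {ξ : 𝒳} {r σ : ℝ} (hr : 0 < r)
    (h2r : ENNReal.ofReal (2 * r) < rbar) (hr₀ : ENNReal.ofReal r < r₀) (hσ : 0 < σ)
    (hσ1 : 5 * σ < 2) {g : 𝒳 → ℝ≥0∞}
    (hg : ∀ ν : Measure 𝒳, IsFiniteMeasure ν → AEMeasurable g ν) (hfin : ∀ y, g y ≠ ∞)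
    (hg_zero : ∀ z ∈ Metric.ball ξ (2 * r) \ D, g z = 0) {x : 𝒳}
    (hx : x ∈ D ∩ Metric.ball ξ ((2 - 5 * σ) * r)) :
    Z.exitMean (D ∩ Metric.ball ξ (2 * r)) g x ≤
      ENNReal.ofReal (factorConst C₁ C₂ C₃ θ C₄ C₅ C₆ c β σ) *
        (Z.meanExit (D ∩ Metric.ball ξ ((2 - 4 * σ) * r)) x *
          ∫⁻ z in (Metric.ball ξ ((2 - 3 * σ) * r))ᶜ,
            Z.exitMean (D ∩ Metric.ball ξ (2 * r)) g z ∂(J ξ)) := by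
  have hU : IsOpen (D ∩ Metric.ball ξ (2 * r)) := hD.inter Metric.isOpen_ball
  have ha := (H.edgeScale_spec hσ).1
  have hcarl := fun {y : 𝒳} (hy : y ∈ D ∩ Metric.ball ξ ((2 - 3 * σ) * r)) =>
    H.carleson hD hr h2r hr₀ hσ (by linarith) hg hfin hg_zero hy
  have hcc := H.carlesonConst_pos hσ ha
  unfold factorConst
  set Cc := carlesonConst C₁ C₂ θ C₄ C₅ C₆ c β σ (edgeScale C₁ C₂ C₃ θ C₄ C₅ C₆ c β σ)
  set u := Z.exitMean (D ∩ Metric.ball ξ (2 * r)) g with hu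
  set V := D ∩ Metric.ball ξ ((2 - 4 * σ) * r) with hVdef
  set N := Metric.ball ξ ((2 - 3 * σ) * r) with hN
  set Λ := ∫⁻ z in Nᶜ, u z ∂(J ξ) with hΛ
  set S := survivalConst C₅ C₆ c β with hS
  have hSpos : 0 < S := H.survivalConst_pos
  have hC₁ := H.comparable.C₁_pos
  have hc := H.scale.pos_const
  have hσr : 0 < σ * r := by positivity
  have hσrr : σ * r ≤ r := by nlinarith
  have hφr := H.scale.apply_pos hr
  have hφσ := H.scale.apply_pos hσr
  have hV : IsOpen V := hD.inter Metric.isOpen_ball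
  have hxV : x ∈ V := ⟨hx.1, Metric.ball_subset_ball (by nlinarith) hx.2⟩
  have hVU : V ⊆ D ∩ Metric.ball ξ (2 * r) :=
    inter_subset_inter_right _ (Metric.ball_subset_ball (by nlinarith))
  set E := Z.exitLaw V x with hE
  set e := Z.meanExit V x with he
  have hNr : ENNReal.ofReal ((2 - 3 * σ) * r) < rbar :=
    (ENNReal.ofReal_le_ofReal (by nlinarith)).trans_lt h2r
  have hNpos : 0 < (2 - 3 * σ) * r := mul_pos (by linarith) hr
  have hND : MeasurableSet (((↑) : 𝒳 → OnePoint 𝒳) '' (N ∩ D)) :=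
    OnePoint.measurableEmbedding_coe.measurableSet_image.2
      (measurableSet_ball.inter hD.measurableSet)
  have hNcm : MeasurableSet (((↑) : 𝒳 → OnePoint 𝒳) '' Nᶜ) :=
    OnePoint.measurableEmbedding_coe.measurableSet_image.2 measurableSet_ball.compl
  have hpt : ∀ y, u y ≤ (((↑) : 𝒳 → OnePoint 𝒳) '' (N ∩ D)).indicator
      (fun _ => ENNReal.ofReal (Cc * φ r) * Λ) y +
      (((↑) : 𝒳 → OnePoint 𝒳) '' Nᶜ).indicator u y := by
    intro y
    induction y using OnePoint.rec with
    | infty =>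
      have : u OnePoint.infty = 0 := Z.exitMean_of_notMem _ (by simp)
      rw [this]; exact zero_le
    | coe z =>
      by_cases hzN : z ∈ N
      · by_cases hzD : z ∈ D
        · rw [indicator_of_mem (mem_image_of_mem _ (mem_inter hzN hzD))]
          exact (hcarl ⟨hzD, hzN⟩).trans le_self_add
        · have : u z = 0 := by
            rw [hu, Z.exitMean_of_notMem _ (by
              rintro ⟨z', hz', heq⟩
              rw [OnePoint.coe_eq_coe] at heq
              exact hzD (heq ▸ hz'.1))]
            exact hg_zero z ⟨Metric.ball_subset_ball (by nlinarith) hzN, hzD⟩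
          rw [this]; exact zero_le
      · rw [indicator_of_mem (s := ((↑) : 𝒳 → OnePoint 𝒳) '' Nᶜ) (mem_image_of_mem _ hzN)]
        exact le_add_self
  -- The point `x` has a margin `σ * r` inside the ball defining `V`, so the survival estimate on `D
  -- ∩ B(x, σr)` bounds the probability of leaving the larger set `V` into `D`.
  have hnear : E (((↑) : 𝒳 → OnePoint 𝒳) '' (N ∩ D)) ≤ ENNReal.ofReal (S / φ (σ * r)) * e := by
    have hball : D ∩ Metric.ball x (σ * r) ⊆ V := by
      rintro z ⟨hzD, hz⟩
      refine ⟨hzD, ?_⟩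
      have h1 : dist x ξ < (2 - 5 * σ) * r := hx.2
      rw [Metric.mem_ball] at hz ⊢
      linarith [dist_triangle z x ξ]
    calc E (((↑) : 𝒳 → OnePoint 𝒳) '' (N ∩ D)) ≤ E (((↑) : 𝒳 → OnePoint 𝒳) '' D) :=
          measure_mono (image_mono inter_subset_right)
      _ ≤ Z.exitLaw (D ∩ Metric.ball x (σ * r)) x (((↑) : 𝒳 → OnePoint 𝒳) '' D) :=
          Z.exitLaw_image_anti hD (hD.inter Metric.isOpen_ball) hV hball (fun y hy _ => hy.1) x
      _ ≤ ENNReal.ofReal (S / φ (σ * r)) * Z.meanExit (D ∩ Metric.ball x (σ * r)) x :=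
          Z.exitLaw_ball_le H.levy H.scale H.tail H.exit hD hx.1 hσr
            ((ENNReal.ofReal_le_ofReal (by linarith)).trans_lt h2r)
            ((ENNReal.ofReal_le_ofReal hσrr).trans_lt hr₀)
      _ ≤ _ := mul_le_mul_right (Z.meanExit_mono hball x) _
  -- The constant works because `(2 - 3σ)(2 - σ) = 4 - 8σ + 3σ²` exceeds `2(2 - 4σ)`.
  have hdist : ∀ w ∈ V, ∀ z ∈ Nᶜ, dist ξ z ≤ 2 / σ * dist w z := by
    intro w hw z hz
    have h1 : dist w ξ < (2 - 4 * σ) * r := hw.2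
    simp only [hN, mem_compl_iff, Metric.mem_ball', not_lt] at hz
    have h2 := dist_triangle_left ξ z w
    rw [div_mul_eq_mul_div, le_div_iff₀ hσ]
    have h3 : (2 - 3 * σ) * r * (2 - σ) ≤ dist ξ z * (2 - σ) :=
      mul_le_mul_of_nonneg_right hz (by linarith)
    have h4 : 0 < σ * σ * r := by positivity
    nlinarith
  have hjump : ∫⁻ y in ((↑) : 𝒳 → OnePoint 𝒳) '' Nᶜ, u y ∂E ≤
      (ENNReal.ofReal (C₁ * (1 + 2 / σ) ^ θ) * e) * Λ := by
    refine OnePoint.setLIntegral_image_le measurableSet_ball.compl (fun B hB hBm => ?_) u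
    refine (Z.exitLaw_image_le H.levy hV (Metric.isClosed_closedBall (x := ξ)
      (ε := (2 - 4 * σ) * r)) (fun y hy => Metric.ball_subset_closedBall hy.2) hBm ?_ hxV
      (ENNReal.mul_ne_top ENNReal.ofReal_ne_top (H.jump_ne_top hNpos hNr hB))
      fun w hw => H.comparable.apply_le (y := ξ) ?_ (by positivity) hBm
        fun z hz => hdist w hw z (hB hz)).trans_eq ?_
    · rw [disjoint_left]
      intro z hz hzB
      have := hB hzB
      rw [Metric.mem_closedBall] at hz
      simp only [mem_compl_iff, Metric.mem_ball, not_lt] at this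
      nlinarith
    · rw [edist_dist]
      exact (ENNReal.ofReal_le_ofReal (le_of_lt (hVU hw).2)).trans_lt h2r
    · rw [mul_assoc, mul_assoc, mul_comm (J ξ B)]
  have hφ := H.scale.inv_le hσr hσrr
  rw [show r / (σ * r) = 1 / σ by field_simp] at hφ
  have hmean : u x = ∫⁻ y, u y ∂E := Z.exitMean_eq_lintegral_exitLaw hU hV hVU hg x
  calc u x = ∫⁻ y, u y ∂E := hmean
    _ ≤ ∫⁻ y, ((((↑) : 𝒳 → OnePoint 𝒳) '' (N ∩ D)).indicator
          (fun _ => ENNReal.ofReal (Cc * φ r) * Λ) y +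
        (((↑) : 𝒳 → OnePoint 𝒳) '' Nᶜ).indicator u y) ∂E := lintegral_mono hpt
    _ = ENNReal.ofReal (Cc * φ r) * Λ * E (((↑) : 𝒳 → OnePoint 𝒳) '' (N ∩ D)) +
        ∫⁻ y in ((↑) : 𝒳 → OnePoint 𝒳) '' Nᶜ, u y ∂E := by
      rw [lintegral_add_left (measurable_const.indicator hND), lintegral_indicator_const hND,
        lintegral_indicator hNcm]
    _ ≤ ENNReal.ofReal (Cc * φ r) * Λ * (ENNReal.ofReal (S / φ (σ * r)) * e) +
        (ENNReal.ofReal (C₁ * (1 + 2 / σ) ^ θ) * e) * Λ :=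
      add_le_add (mul_le_mul_right hnear _) hjump
    _ = (ENNReal.ofReal (Cc * φ r) * ENNReal.ofReal (S / φ (σ * r)) +
        ENNReal.ofReal (C₁ * (1 + 2 / σ) ^ θ)) * (e * Λ) := by ring
    _ ≤ _ := by
      rw [← ENNReal.ofReal_mul (by positivity), ← ENNReal.ofReal_add (by positivity) (by positivity)]
      refine mul_le_mul_left (ENNReal.ofReal_le_ofReal (add_le_add ?_ le_rfl)) _
      calc Cc * φ r * (S / φ (σ * r)) = Cc * φ r * S * (1 / φ (σ * r)) := by ring
        _ ≤ Cc * φ r * S * (c * (1 / σ) ^ β / φ r) := by gcongr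
        _ = _ := by field_simp

/-- Lower bound in the factorization of functions harmonic in `D ∩ B(ξ, 2r)`. -/
theorem factor_le_exitMean (H : JumpEstimates Z J φ rbar r₀ C₁ C₂ C₃ θ C₄ C₅ C₆ c β)
    {D : Set 𝒳} (hD : IsOpen D) {ξ : 𝒳} {r σ : ℝ} (hr : 0 < r)
    (h2r : ENNReal.ofReal (2 * r) < rbar) (hσ : 0 < σ) {g : 𝒳 → ℝ≥0∞}
    (hg : ∀ ν : Measure 𝒳, IsFiniteMeasure ν → AEMeasurable g ν) {x : 𝒳}
    (hx : x ∈ D ∩ Metric.ball ξ ((2 - 5 * σ) * r)) :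
    Z.meanExit (D ∩ Metric.ball ξ ((2 - 4 * σ) * r)) x *
        (∫⁻ z in (Metric.ball ξ ((2 - 3 * σ) * r))ᶜ,
          Z.exitMean (D ∩ Metric.ball ξ (2 * r)) g z ∂(J ξ)) ≤
      ENNReal.ofReal (C₁ * 3 ^ θ) * Z.exitMean (D ∩ Metric.ball ξ (2 * r)) g x := by
  have hU : IsOpen (D ∩ Metric.ball ξ (2 * r)) := hD.inter Metric.isOpen_ball
  set u := Z.exitMean (D ∩ Metric.ball ξ (2 * r)) g with hu
  set V := D ∩ Metric.ball ξ ((2 - 4 * σ) * r) with hVdef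
  set N := Metric.ball ξ ((2 - 3 * σ) * r) with hN
  set K := C₁ * 3 ^ θ with hK
  have hC₁ := H.comparable.C₁_pos
  have hKpos : 0 < K := by positivity
  have hσr : 0 < σ * r := by positivity
  have hV : IsOpen V := hD.inter Metric.isOpen_ball
  have hxV : x ∈ V := ⟨hx.1, Metric.ball_subset_ball (by nlinarith) hx.2⟩
  have hVU : V ⊆ D ∩ Metric.ball ξ (2 * r) :=
    inter_subset_inter_right _ (Metric.ball_subset_ball (by nlinarith))
  have hfar : ∀ z ∈ Nᶜ, (2 - 3 * σ) * r ≤ dist ξ z := fun z hz => by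
    simpa only [hN, mem_compl_iff, Metric.mem_ball', not_lt] using hz
  have hinv : ENNReal.ofReal K * ENNReal.ofReal K⁻¹ = 1 := by
    rw [← ENNReal.ofReal_mul hKpos.le, mul_inv_cancel₀ hKpos.ne', ENNReal.ofReal_one]
  -- Points `w` of `V` are closer to `ξ` than points `z` of `Nᶜ`, so `dist w z ≤ 2 * dist ξ z`,
  -- which gives the constant `C₁ * 3 ^ θ`.
  have hjump : (ENNReal.ofReal K⁻¹ * Z.meanExit V x) * ∫⁻ z in Nᶜ, u z ∂(J ξ) ≤
      ∫⁻ y in ((↑) : 𝒳 → OnePoint 𝒳) '' Nᶜ, u y ∂(Z.exitLaw V x) := by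
    refine OnePoint.le_setLIntegral_image measurableSet_ball.compl (fun B hB hBm => ?_) u
    have h1 : ∀ w ∈ V, ENNReal.ofReal K⁻¹ * J ξ B ≤ J w B := by
      intro w hw
      have hwξ : dist w ξ < (2 - 4 * σ) * r := hw.2
      have h2 : J ξ B ≤ ENNReal.ofReal K * J w B := by
        have := H.comparable.apply_le (x := ξ) (y := w) ?_ (q := 2) (by norm_num) hBm
          fun z hz => ?_
        · rwa [show (1 : ℝ) + 2 = 3 by norm_num] at this
        · rw [edist_comm, edist_dist]
          exact (ENNReal.ofReal_le_ofReal (le_of_lt (hVU hw).2)).trans_lt h2r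
        · linarith [dist_triangle w ξ z, hfar z (hB hz)]
      calc ENNReal.ofReal K⁻¹ * J ξ B ≤ ENNReal.ofReal K⁻¹ * (ENNReal.ofReal K * J w B) := by gcongr
        _ = J w B := by rw [← mul_assoc, mul_comm (ENNReal.ofReal K⁻¹), hinv, one_mul]
    have h3 := Z.le_exitLaw_image H.levy hV (Metric.isClosed_closedBall (x := ξ)
      (ε := (2 - 4 * σ) * r)) (fun y hy => Metric.ball_subset_closedBall hy.2) hBm ?_ hxV h1
    · rwa [mul_right_comm] at h3
    · rw [disjoint_left]
      intro z hz hzB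
      have := hfar z (hB hzB)
      rw [Metric.mem_closedBall'] at hz
      linarith
  have hmean : u x = ∫⁻ y, u y ∂(Z.exitLaw V x) :=
    Z.exitMean_eq_lintegral_exitLaw hU hV hVU hg x
  rw [hmean]
  calc Z.meanExit V x * ∫⁻ z in Nᶜ, u z ∂(J ξ)
      = ENNReal.ofReal K * ((ENNReal.ofReal K⁻¹ * Z.meanExit V x) * ∫⁻ z in Nᶜ, u z ∂(J ξ)) := by
        rw [← mul_assoc, ← mul_assoc, hinv, one_mul]
    _ ≤ _ := mul_le_mul_right (hjump.trans (setLIntegral_le_lintegral _ _)) _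

end JumpEstimates
end HuntProcess
end

/-! ### The boundary Harnack principle -/

theorem theorem1p3 (κ : ℝ) (hκ : κ ∈ Ioo (0 : ℝ) 2) (C₁ C₂ C₃ θ C₄ C₅ C₆ c β : ℝ) :
    ∃ C : ℝ, 1 < C ∧
      ∀ (𝒳 : Type*) [MetricSpace 𝒳] [LocallyCompactSpace 𝒳] [SecondCountableTopology 𝒳]
        [MeasurableSpace 𝒳] [BorelSpace 𝒳] (Ω : Type*) [MeasurableSpace Ω]
        (Z : HuntProcess 𝒳 Ω) (J : Kernel 𝒳 𝒳) (φ : ℝ → ℝ) (rbar r₀ : ℝ≥0∞),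
        0 < rbar → 0 < r₀ →
        Z.IsLevySystem J →
        IsScaleFunction φ c β →
        JumpComparable J rbar C₁ C₂ C₃ θ →
        JumpTail J φ rbar C₄ C₅ →
        Z.ExitProbabilityBound φ r₀ C₆ →
        ∀ D : Set 𝒳, IsOpen D → D ≠ univ →
        ∀ r : ℝ, 0 < r → ENNReal.ofReal r < min (rbar / 2) r₀ →
        ∀ ξ ∈ frontier D,
        ∀ h₁ h₂ : 𝒳 → ℝ, (∀ x, 0 ≤ h₁ x) → (∀ x, 0 ≤ h₂ x) →
          Z.IsRegularHarmonic h₁ (D ∩ Metric.ball ξ (2 * r)) →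
          Z.IsRegularHarmonic h₂ (D ∩ Metric.ball ξ (2 * r)) →
          (∀ x ∈ Metric.ball ξ (2 * r) \ D, h₁ x = 0) →
          (∀ x ∈ Metric.ball ξ (2 * r) \ D, h₂ x = 0) →
          ∀ x ∈ D ∩ Metric.ball ξ (κ * r), ∀ y ∈ D ∩ Metric.ball ξ (κ * r),
            h₁ x * h₂ y ≤ C * (h₁ y * h₂ x) := by
  -- Between the radii `κ * r` and `2 * r` there are five shells of width `σ * r`; the factorization
  -- uses the radii `2 - 5σ`, `2 - 4σ`, `2 - 3σ` and `2`, in units of `r`.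
  set σ := (2 - κ) / 5 with hσdef
  have hσ : 0 < σ := by have := hκ.2; rw [hσdef]; linarith
  have hσ1 : 5 * σ < 2 := by have := hκ.1; rw [hσdef]; linarith
  set A := HuntProcess.factorConst C₁ C₂ C₃ θ C₄ C₅ C₆ c β σ with hA
  -- The constant is fixed before any sign of the parameters is known; the square and the added 2
  -- make it exceed 1 in every case.
  refine ⟨(A * (C₁ * 3 ^ θ)) ^ 2 + 2, by nlinarith [sq_nonneg (A * (C₁ * 3 ^ θ))], ?_⟩
  intro 𝒳 _ _ _ _ _ Ω _ Z J φ rbar r₀ _ _ hlevy hscale hcomp htail hexit D hD _ r hr hrR ξ _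
    h₁ h₂ hh₁ hh₂ hreg₁ hreg₂ hz₁ hz₂ x hx y hy
  have H : Z.JumpEstimates J φ rbar r₀ C₁ C₂ C₃ θ C₄ C₅ C₆ c β :=
    ⟨hlevy, hscale, hcomp, htail, hexit⟩
  have h2r : ENNReal.ofReal (2 * r) < rbar := by
    have h1 := hrR.trans_le (min_le_left _ _)
    rw [ENNReal.lt_div_iff_mul_lt (by simp) (by simp)] at h1
    rw [ENNReal.ofReal_mul (by norm_num), mul_comm]
    simpa using h1
  have hr₀ : ENNReal.ofReal r < r₀ := hrR.trans_le (min_le_right _ _)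
  have hU : IsOpen (D ∩ Metric.ball ξ (2 * r)) := hD.inter Metric.isOpen_ball
  have hκσ : κ = 2 - 5 * σ := by rw [hσdef]; ring
  rw [hκσ] at hx hy
  have hmeas : ∀ h : 𝒳 → ℝ, Z.IsRegularHarmonic h (D ∩ Metric.ball ξ (2 * r)) →
      ∀ ν : Measure 𝒳, IsFiniteMeasure ν → AEMeasurable (fun z => ENNReal.ofReal (h z)) ν :=
    fun h hreg ν hν => (hreg.universallyMeasurable ν).ennreal_ofReal
  have hupper : ∀ h : 𝒳 → ℝ, (∀ z, 0 ≤ h z) →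
      Z.IsRegularHarmonic h (D ∩ Metric.ball ξ (2 * r)) →
      (∀ z ∈ Metric.ball ξ (2 * r) \ D, h z = 0) →
      ∀ z ∈ D ∩ Metric.ball ξ ((2 - 5 * σ) * r), ENNReal.ofReal (h z) ≤ ENNReal.ofReal A *
        (Z.meanExit (D ∩ Metric.ball ξ ((2 - 4 * σ) * r)) z *
          ∫⁻ w in (Metric.ball ξ ((2 - 3 * σ) * r))ᶜ, ENNReal.ofReal (h w) ∂(J ξ)) := by
    intro h hh hreg hz z hzm
    have := H.exitMean_le_factor hD hr h2r hr₀ hσ hσ1 (hmeas h hreg)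
      (fun _ => ENNReal.ofReal_ne_top) (fun w hw => by rw [hz w hw, ENNReal.ofReal_zero]) hzm
    simpa only [← hreg.ofReal_eq_exitMean hU hh] using this
  have hlower : ∀ h : 𝒳 → ℝ, (∀ z, 0 ≤ h z) →
      Z.IsRegularHarmonic h (D ∩ Metric.ball ξ (2 * r)) →
      ∀ z ∈ D ∩ Metric.ball ξ ((2 - 5 * σ) * r),
        Z.meanExit (D ∩ Metric.ball ξ ((2 - 4 * σ) * r)) z *
          (∫⁻ w in (Metric.ball ξ ((2 - 3 * σ) * r))ᶜ, ENNReal.ofReal (h w) ∂(J ξ)) ≤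
        ENNReal.ofReal (C₁ * 3 ^ θ) * ENNReal.ofReal (h z) := by
    intro h hh hreg z hzm
    have := H.factor_le_exitMean hD hr h2r hσ (hmeas h hreg) hzm
    simpa only [← hreg.ofReal_eq_exitMean hU hh] using this
  have hC₁ := H.comparable.C₁_pos
  have hK : 0 < C₁ * 3 ^ θ := by positivity
  have hApos : 0 ≤ A := by
    have h1 := H.carlesonConst_pos hσ (H.edgeScale_spec hσ).1
    have h2 := H.survivalConst_pos
    have h3 := H.scale.pos_const
    rw [hA, HuntProcess.factorConst]
    positivity
  set e := Z.meanExit (D ∩ Metric.ball ξ ((2 - 4 * σ) * r))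
  set K := C₁ * 3 ^ θ
  set Λ₁ := ∫⁻ w in (Metric.ball ξ ((2 - 3 * σ) * r))ᶜ, ENNReal.ofReal (h₁ w) ∂(J ξ)
  set Λ₂ := ∫⁻ w in (Metric.ball ξ ((2 - 3 * σ) * r))ᶜ, ENNReal.ofReal (h₂ w) ∂(J ξ)
  have hmain : ENNReal.ofReal (h₁ x * h₂ y) ≤ ENNReal.ofReal ((A * K) ^ 2 * (h₁ y * h₂ x)) := by
    calc ENNReal.ofReal (h₁ x * h₂ y)
        = ENNReal.ofReal (h₁ x) * ENNReal.ofReal (h₂ y) := ENNReal.ofReal_mul (hh₁ x)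
      _ ≤ (ENNReal.ofReal A * (e x * Λ₁)) * (ENNReal.ofReal A * (e y * Λ₂)) :=
        mul_le_mul' (hupper h₁ hh₁ hreg₁ hz₁ x hx) (hupper h₂ hh₂ hreg₂ hz₂ y hy)
      -- The mean exit times at `x` and `y` are exchanged between the two functions. In extended
      -- non-negative numbers this requires no finiteness of `Λ₁` and `Λ₂`.
      _ = (ENNReal.ofReal A * ENNReal.ofReal A) * ((e y * Λ₁) * (e x * Λ₂)) := by ring
      _ ≤ (ENNReal.ofReal A * ENNReal.ofReal A) *
          ((ENNReal.ofReal K * ENNReal.ofReal (h₁ y)) *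
            (ENNReal.ofReal K * ENNReal.ofReal (h₂ x))) :=
        mul_le_mul_right (mul_le_mul' (hlower h₁ hh₁ hreg₁ y hy) (hlower h₂ hh₂ hreg₂ x hx)) _
      _ = _ := by
        have := hh₁ y
        have := hh₂ x
        rw [← ENNReal.ofReal_mul hK.le, ← ENNReal.ofReal_mul hK.le,
          ← ENNReal.ofReal_mul hApos, ← ENNReal.ofReal_mul (by positivity),
          ← ENNReal.ofReal_mul (by positivity)]
        congr 1
        ring
  have hnn : 0 ≤ h₁ y * h₂ x := mul_nonneg (hh₁ y) (hh₂ x)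
  have h3 := (ENNReal.ofReal_le_ofReal_iff (by positivity)).1 hmain
  linarith
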